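/- Let $M$ be a smooth manifold, $N\subset M$ a closed (embedded) submanifold with normal bundle $\nu(M,N)=TM|_N/TN$, and $F\subset\nu(M,N)$ a smooth subbundle with preimage $\tilde F\subset TM|_N$. Let $\mathcal I\subset C^\infty_M$ be the ideal sheaf of functions vanishing along $N$, and $\mathcal J\subset\mathcal I$ the ideal sheaf of functions $f$ with $f|_N=0$ and $df|_{\tilde F}=0$. For $k\ge 0$ let $\mathcal A_{(k)}\subset C^\infty_M$ be the ideal sheaf spanned by products of $a$ elements of $\mathcal I$ and $b$ elements of $\mathcal J$ with $a+2b\ge k$ (so $\mathcal A_{(0)}=C^\infty_M$, $\mathcal A_{(1)}=\mathcal I$, $\mathcal A_{(2)}=\mathcal J$), and let $\operatorname{gr}(\mathcal A)_k=\mathcal A_{(k)}/\mathcal A_{(k+1)}$, a sheaf supported on $N$. Let $\mathsf A=\bigoplus_k\mathsf A_k\to N$ be the bundle of graded algebras with sheaf of sections $\operatorname{gr}(\mathcal A)$: its fibre $\mathsf A_k|_q$ is the quotient of the stalk of $\operatorname{gr}(\mathcal A)_k$ at $q$ by the products with germs of functions vanishing at $q$, and its smooth sections are those given locally by sections of $\mathcal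 A_{(k)}$. Then $\mathsf A_0,\mathsf A_1,\mathsf A_2$ are smooth vector bundles over $N$, with sheaves of sections $\operatorname{gr}(\mathcal A)_0,\operatorname{gr}(\mathcal A)_1,\operatorname{gr}(\mathcal A)_2$, and: 1. $[f]\mapsto f|_N$ is an isomorphism of smooth vector bundles from $\mathsf A_0$ onto the trivial line bundle $N\times\mathbb R$ (so the sections of $\mathsf A_0$ are the smooth functions on $N$). 2. $[f]\mapsto df|_F$ is an isomorphism of smooth vector bundles $\mathsf A_1\cong F^*$. 3. There is an exact sequence of smooth vector bundles over $N$ $$0\to\operatorname{Sym}^2(F^*)\to\mathsf A_2\to\operatorname{ann}(F)\to 0,$$ where $\operatorname{ann}(F)\subset\nu(M,N)^*$ is the annihilator of $F$, the first map is the multiplication $\operatorname{Sym}^2(\mathsf A_1)\to\mathsf A_2$ of $\mathsf A$ combined with $\mathsf A_1\cong F^*$, and the second map is $[f]\mapsto df$. -/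

import Mathlib

open scoped Manifold ContDiff Topology

noncomputable section

namespace WeightedNormal

/-! ### Families of vector spaces with smooth local sections

A vector bundle over `N` is presented by its fibres `V q` together with the predicate
"`s` is a smooth section over the open set `W`". Only the values of `s` on `W` matter. -/

section Bundles

universe u v w

variable (E' : Type u) [NormedAddCommGroup E'] [NormedSpace ℝ E']
  {N : Type v} [TopologicalSpace N] [ChartedSpace E' N]
  {V : N → Type w} [∀ q, AddCommGroup (V q)] [∀ q, Module ℝ (V q)]

/-- The smooth sections `sm` make the fibres `V q` into a smooth vector bundle of finite (locally
constant) rank: near every point there is a frame such that the smooth sections are exactly the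
combinations of the frame with smooth coefficients. -/
def IsVectorBundle (sm : Set N → (∀ q, V q) → Prop) : Prop :=
  ∀ q₀ : N, ∃ W : Set N, IsOpen W ∧ q₀ ∈ W ∧ ∃ (n : ℕ) (e : Fin n → ∀ q, V q),
    (∀ q ∈ W, LinearIndependent ℝ (fun j => e j q) ∧
      Submodule.span ℝ (Set.range fun j => e j q) = ⊤) ∧
    ∀ W' : Set N, IsOpen W' → W' ⊆ W → ∀ s : ∀ q, V q,
      (sm W' s ↔ ∃ c : Fin n → N → ℝ,
        (∀ j, ContMDiffOn 𝓘(ℝ, E') 𝓘(ℝ) ∞ (c j) W') ∧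
        ∀ q ∈ W', s q = ∑ j, c j q • e j q)

/-- Smooth sections of the trivial line bundle: smooth real functions. -/
def trivialSmooth (W : Set N) (s : N → ℝ) : Prop :=
  ContMDiffOn 𝓘(ℝ, E') 𝓘(ℝ) ∞ s W

/-- Smooth sections of the dual bundle: their pairing with every smooth local section is smooth. -/
def dualSmooth (sm : Set N → (∀ q, V q) → Prop) (W : Set N)
    (α : ∀ q, Module.Dual ℝ (V q)) : Prop :=
  ∀ W' : Set N, IsOpen W' → W' ⊆ W → ∀ s : ∀ q, V q, sm W' s →
    ContMDiffOn 𝓘(ℝ, E') 𝓘(ℝ) ∞ (fun q => α q (s q)) W'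

/-- The second symmetric power of a real vector space. -/
abbrev Sym2Power (X : Type w) [AddCommGroup X] [Module ℝ X] : Type w :=
  SymmetricPower ℝ (Fin 2) X

/-- The symmetric product `a · b ∈ Sym²(X)` of `a, b ∈ X`. -/
def symProd {X : Type w} [AddCommGroup X] [Module ℝ X] (a b : X) : Sym2Power X :=
  SymmetricPower.tprod ℝ ![a, b]

/-- Smooth sections of `Sym²(V)`: locally finite sums of symmetric products of smooth sections
of `V`. -/
def sym2Smooth (sm : Set N → (∀ q, V q) → Prop) (W : Set N)
    (t : ∀ q, Sym2Power (V q)) : Prop :=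
  ∀ q₀ ∈ W, ∃ W' : Set N, IsOpen W' ∧ q₀ ∈ W' ∧ W' ⊆ W ∧
    ∃ (n : ℕ) (a b : Fin n → ∀ q, V q), (∀ j, sm W' (a j)) ∧ (∀ j, sm W' (b j)) ∧
      ∀ q ∈ W', t q = ∑ j, symProd (a j q) (b j q)

/-- A fibrewise linear map is a smooth bundle map if it takes smooth local sections to smooth
local sections. -/
def IsSmoothBundleMap {V₁ : N → Type*} {V₂ : N → Type*}
    [∀ q, AddCommGroup (V₁ q)] [∀ q, Module ℝ (V₁ q)]
    [∀ q, AddCommGroup (V₂ q)] [∀ q, Module ℝ (V₂ q)]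
    (sm₁ : Set N → (∀ q, V₁ q) → Prop) (sm₂ : Set N → (∀ q, V₂ q) → Prop)
    (φ : ∀ q, V₁ q →ₗ[ℝ] V₂ q) : Prop :=
  ∀ W : Set N, IsOpen W → ∀ s : ∀ q, V₁ q, sm₁ W s → sm₂ W (fun q => φ q (s q))

/-- A fibrewise linear isomorphism is an isomorphism of smooth bundles if it and its inverse are
smooth bundle maps. -/
def IsSmoothBundleIso {V₁ : N → Type*} {V₂ : N → Type*}
    [∀ q, AddCommGroup (V₁ q)] [∀ q, Module ℝ (V₁ q)]
    [∀ q, AddCommGroup (V₂ q)] [∀ q, Module ℝ (V₂ q)]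
    (sm₁ : Set N → (∀ q, V₁ q) → Prop) (sm₂ : Set N → (∀ q, V₂ q) → Prop)
    (φ : ∀ q, V₁ q ≃ₗ[ℝ] V₂ q) : Prop :=
  IsSmoothBundleMap sm₁ sm₂ (fun q => (φ q).toLinearMap) ∧
    IsSmoothBundleMap sm₂ sm₁ (fun q => (φ q).symm.toLinearMap)

end Bundles

/-! ### Germs of smooth functions -/

instance germAlgebra {X : Type*} (l : Filter X) : Algebra ℝ (Filter.Germ l ℝ) :=
  Algebra.ofModule
    (fun r x y => by
      induction x using Filter.Germ.inductionOn
      induction y using Filter.Germ.inductionOn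
      exact congrArg Filter.Germ.ofFun (smul_mul_assoc r _ _))
    (fun r x y => by
      induction x using Filter.Germ.inductionOn
      induction y using Filter.Germ.inductionOn
      exact congrArg Filter.Germ.ofFun (mul_smul_comm r _ _))

section Germs

variable (E : Type*) [NormedAddCommGroup E] [NormedSpace ℝ E]
  {M : Type*} [TopologicalSpace M] [ChartedSpace E M]

/-- `f` is smooth on some neighbourhood of `x`. -/
def SmoothNear (x : M) (f : M → ℝ) : Prop :=
  ∀ᶠ y in 𝓝 x, ContMDiffAt 𝓘(ℝ, E) 𝓘(ℝ) ∞ f y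

/-- The germs at `x` of smooth functions, as a subalgebra of all germs of functions. -/
def smoothGerms (x : M) : Subalgebra ℝ (Filter.Germ (𝓝 x) ℝ) where
  carrier := {g | ∃ f : M → ℝ, SmoothNear E x f ∧ g = (f : Filter.Germ (𝓝 x) ℝ)}
  mul_mem' := by
    rintro _ _ ⟨f, hf, rfl⟩ ⟨g, hg, rfl⟩
    exact ⟨f * g, by filter_upwards [hf, hg] with y h₁ h₂ using h₁.mul h₂, rfl⟩
  add_mem' := by
    rintro _ _ ⟨f, hf, rfl⟩ ⟨g, hg, rfl⟩
    exact ⟨f + g, by filter_upwards [hf, hg] with y h₁ h₂ using h₁.add h₂, rfl⟩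
  algebraMap_mem' r :=
    ⟨fun _ => r • 1, Filter.Eventually.of_forall fun _ => contMDiffAt_const, by
      rw [Algebra.algebraMap_eq_smul_one]; rfl⟩

/-- The algebra of germs at `x` of smooth functions: the stalk at `x` of the sheaf `C^∞_M`. -/
def SmoothGerm (x : M) : Type _ := smoothGerms E x

instance (x : M) : CommRing (SmoothGerm E x) := inferInstanceAs (CommRing (smoothGerms E x))

instance (x : M) : Algebra ℝ (SmoothGerm E x) := inferInstanceAs (Algebra ℝ (smoothGerms E x))

variable {E} in
/-- The germ at `x` of a function that is smooth near `x`. -/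
def germ {x : M} (f : M → ℝ) (hf : SmoothNear E x f) : SmoothGerm E x :=
  ⟨(f : Filter.Germ (𝓝 x) ℝ), f, hf, rfl⟩

/-- The ideal of germs at `x` of functions vanishing at `x`. -/
def maxIdeal (x : M) : Ideal (SmoothGerm E x) where
  carrier := {g | ∃ (f : M → ℝ) (hf : SmoothNear E x f), g = germ f hf ∧ f x = 0}
  zero_mem' := ⟨0, Filter.Eventually.of_forall fun _ => contMDiffAt_const, rfl, rfl⟩
  add_mem' := by
    rintro _ _ ⟨f, hf, rfl, hf0⟩ ⟨g, hg, rfl, hg0⟩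
    exact ⟨f + g, by filter_upwards [hf, hg] with y h₁ h₂ using h₁.add h₂, rfl,
      by simp [hf0, hg0]⟩
  smul_mem' := by
    rintro ⟨_, f, hf, rfl⟩ _ ⟨g, hg, rfl, hg0⟩
    exact ⟨f * g, by filter_upwards [hf, hg] with y h₁ h₂ using h₁.mul h₂, rfl,
      by simp [hg0]⟩

end Germs

/-! ### The normal bundle of a submanifold `ι : N → M` and its subbundles -/

section Normal

variable {E : Type*} [NormedAddCommGroup E] [NormedSpace ℝ E]
  {E' : Type*} [NormedAddCommGroup E'] [NormedSpace ℝ E']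
  {M : Type*} [TopologicalSpace M] [ChartedSpace E M]
  {N : Type*} [TopologicalSpace N] [ChartedSpace E' N]

variable (E E') in
/-- The fibre `T_{ι q} M / T_q N` of the normal bundle `ν(M,N)`. -/
abbrev NormalSpace (ι : N → M) (q : N) : Type _ :=
  TangentSpace 𝓘(ℝ, E) (ι q) ⧸
    LinearMap.range (mfderiv 𝓘(ℝ, E') 𝓘(ℝ, E) ι q).toLinearMap

variable (E E') in
/-- The class in the normal space of a tangent vector of `M` at a point of `N`. -/
abbrev normalClass (ι : N → M) (q : N) (v : TangentSpace 𝓘(ℝ, E) (ι q)) :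
    NormalSpace E E' ι q :=
  Submodule.Quotient.mk v

variable (E E') in
/-- Smooth sections of `ν(M,N) = TM|_N / TN`: those that lift locally to smooth sections
of `TM|_N`. -/
def normalSmooth [IsManifold 𝓘(ℝ, E) ∞ M] (ι : N → M) (W : Set N) (s : ∀ q, NormalSpace E E' ι q) : Prop :=
  ∀ q₀ ∈ W, ∃ W' : Set N, IsOpen W' ∧ q₀ ∈ W' ∧ W' ⊆ W ∧
    ∃ σ : ∀ q, TangentSpace 𝓘(ℝ, E) (ι q),
      ContMDiffOn 𝓘(ℝ, E') 𝓘(ℝ, E).tangent ∞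
        (fun q => (⟨ι q, σ q⟩ : TangentBundle 𝓘(ℝ, E) M)) W' ∧
      ∀ q ∈ W', s q = normalClass E E' ι q (σ q)

/-- Smooth sections of a family of subspaces `F ⊂ ν(M,N)`. -/
def subSmooth [IsManifold 𝓘(ℝ, E) ∞ M] {ι : N → M} (F : ∀ q, Submodule ℝ (NormalSpace E E' ι q)) (W : Set N)
    (s : ∀ q, F q) : Prop :=
  normalSmooth E E' ι W (fun q => (s q : NormalSpace E E' ι q))

/-- `F ⊂ ν(M,N)` is a smooth subbundle: it has smooth local frames. -/
def IsSubbundle [IsManifold 𝓘(ℝ, E) ∞ M] {ι : N → M} (F : ∀ q, Submodule ℝ (NormalSpace E E' ι q)) : Prop :=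
  ∀ q₀ : N, ∃ W : Set N, IsOpen W ∧ q₀ ∈ W ∧ ∃ (n : ℕ) (e : Fin n → ∀ q, F q),
    (∀ j, subSmooth F W (e j)) ∧
    ∀ q ∈ W, LinearIndependent ℝ (fun j => e j q) ∧
      Submodule.span ℝ (Set.range fun j => e j q) = ⊤

/-- The fibre at `q` of the annihilator bundle `ann(F) ⊂ ν(M,N)^*`. -/
abbrev Ann {ι : N → M} (F : ∀ q, Submodule ℝ (NormalSpace E E' ι q)) (q : N) :
    Submodule ℝ (Module.Dual ℝ (NormalSpace E E' ι q)) :=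
  (F q).dualAnnihilator

/-- Smooth sections of `ann(F)`: smooth sections of `ν(M,N)^*` with values in `ann(F)`. -/
def annSmooth [IsManifold 𝓘(ℝ, E) ∞ M] {ι : N → M} (F : ∀ q, Submodule ℝ (NormalSpace E E' ι q)) (W : Set N)
    (β : ∀ q, Ann F q) : Prop :=
  dualSmooth E' (normalSmooth E E' ι) W (fun q => (β q : Module.Dual ℝ (NormalSpace E E' ι q)))

/-- Smooth sections of `F^*`. -/
def subDualSmooth [IsManifold 𝓘(ℝ, E) ∞ M] {ι : N → M} (F : ∀ q, Submodule ℝ (NormalSpace E E' ι q)) (W : Set N)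
    (α : ∀ q, Module.Dual ℝ (F q)) : Prop :=
  dualSmooth E' (subSmooth F) W α

/-! ### The weighted filtration -/

variable (E) in
/-- The stalk at `ι q` of the ideal sheaf `𝓘` of functions vanishing along `N`. -/
def idealI (ι : N → M) (q : N) : Ideal (SmoothGerm E (ι q)) where
  carrier := {g | ∃ (f : M → ℝ) (hf : SmoothNear E (ι q) f), g = germ f hf ∧
    ∀ᶠ q' in Filter.comap ι (𝓝 (ι q)), f (ι q') = 0}
  zero_mem' := ⟨0, Filter.Eventually.of_forall fun _ => contMDiffAt_const, rfl, by simp⟩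
  add_mem' := by
    rintro _ _ ⟨f, hf, rfl, hf0⟩ ⟨g, hg, rfl, hg0⟩
    refine ⟨f + g, by filter_upwards [hf, hg] with y h₁ h₂ using h₁.add h₂, rfl, ?_⟩
    filter_upwards [hf0, hg0] with q' h₁ h₂
    simp [h₁, h₂]
  smul_mem' := by
    rintro ⟨_, f, hf, rfl⟩ _ ⟨g, hg, rfl, hg0⟩
    refine ⟨f * g, by filter_upwards [hf, hg] with y h₁ h₂ using h₁.mul h₂, rfl, ?_⟩
    filter_upwards [hg0] with q' h₂
    simp [h₂]

/-- The stalk at `ι q` of the ideal sheaf `𝓙 ⊂ 𝓘` of functions that vanish along `N` and whose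
differential vanishes on the preimage of `F` in `TM|_N`. -/
def idealJ {ι : N → M} (F : ∀ q, Submodule ℝ (NormalSpace E E' ι q)) (q : N) :
    Ideal (SmoothGerm E (ι q)) where
  carrier := {g | ∃ (f : M → ℝ) (hf : SmoothNear E (ι q) f), g = germ f hf ∧
    ∀ᶠ q' in Filter.comap ι (𝓝 (ι q)), f (ι q') = 0 ∧
      ∀ v : TangentSpace 𝓘(ℝ, E) (ι q'), normalClass E E' ι q' v ∈ F q' →
        mfderiv 𝓘(ℝ, E) 𝓘(ℝ) f (ι q') v = 0}
  zero_mem' := by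
    refine ⟨0, Filter.Eventually.of_forall fun _ => contMDiffAt_const, rfl,
      Filter.Eventually.of_forall fun q' => ⟨rfl, fun v _ => ?_⟩⟩
    have h : mfderiv 𝓘(ℝ, E) 𝓘(ℝ) (0 : M → ℝ) (ι q') = 0 := mfderiv_const
    rw [h]; rfl
  add_mem' := by
    rintro _ _ ⟨f, hf, rfl, hf0⟩ ⟨g, hg, rfl, hg0⟩
    refine ⟨f + g, by filter_upwards [hf, hg] with y h₁ h₂ using h₁.add h₂, rfl, ?_⟩
    filter_upwards [hf0, hg0, hf.comap ι, hg.comap ι] with q' h₁ h₂ h₃ h₄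
    refine ⟨by simp [h₁.1, h₂.1], fun v hv => ?_⟩
    have h := ((h₃.mdifferentiableAt (by simp)).hasMFDerivAt.add
      (h₄.mdifferentiableAt (by simp)).hasMFDerivAt).mfderiv
    have e₁ := h₁.2 v hv
    have e₂ := h₂.2 v hv
    rw [h]
    exact (congrArg₂ (fun a b : ℝ => a + b) e₁ e₂).trans (add_zero 0)
  smul_mem' := by
    rintro ⟨_, f, hf, rfl⟩ _ ⟨g, hg, rfl, hg0⟩
    refine ⟨f * g, by filter_upwards [hf, hg] with y h₁ h₂ using h₁.mul h₂, rfl, ?_⟩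
    filter_upwards [hg0, hf.comap ι, hg.comap ι] with q' h₂ h₃ h₄
    refine ⟨by simp [h₂.1], fun v hv => ?_⟩
    have h := ((h₃.mdifferentiableAt (by simp)).hasMFDerivAt.mul
      (h₄.mdifferentiableAt (by simp)).hasMFDerivAt).mfderiv
    have e₂ := h₂.2 v hv
    rw [h, h₂.1]
    have e₃ : ∀ a b : ℝ, b = 0 → f (ι q') * b + 0 * a = 0 := by intros a b hb; simp [hb]
    exact e₃ _ _ e₂

/-- The stalk at `ι q` of the `k`-th filtration sheaf `𝒜_(k)`: spanned by products of `a` elements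
of `𝓘` and `b` elements of `𝓙` with `a + 2 b ≥ k`. -/
def filt {ι : N → M} (F : ∀ q, Submodule ℝ (NormalSpace E E' ι q)) (k : ℕ) (q : N) :
    Ideal (SmoothGerm E (ι q)) :=
  ⨆ (a : ℕ) (b : ℕ) (_ : k ≤ a + 2 * b), idealI E ι q ^ a * idealJ F q ^ b

theorem filt_mul_le {ι : N → M} (F : ∀ q, Submodule ℝ (NormalSpace E E' ι q)) (j k : ℕ) (q : N) :
    filt F j q * filt F k q ≤ filt F (j + k) q := by
  simp only [filt, Ideal.iSup_mul, Ideal.mul_iSup, iSup_le_iff]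
  intro a b hab c d hcd
  refine le_trans (le_of_eq ?_) (le_iSup_of_le (a + c) (le_iSup_of_le (b + d)
    (le_iSup_of_le (by omega) le_rfl)))
  rw [pow_add, pow_add]; ring

/-- The submodule of `𝒜_(k)` (at `ι q`) divided out in the fibre `A_k|_q`. -/
def grKer {ι : N → M} (F : ∀ q, Submodule ℝ (NormalSpace E E' ι q)) (k : ℕ) (q : N) :
    Submodule (SmoothGerm E (ι q)) (filt F k q) :=
  (filt F (k + 1) q ⊔ maxIdeal E (ι q) * filt F k q).submoduleOf (filt F k q)

/-- The fibre at `q` of the degree `k` part `A_k` of the associated graded algebra bundle, i.e.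
the fibre of the sheaf `gr(𝒜)_k = 𝒜_(k) / 𝒜_(k+1)`: the quotient of its stalk by the action of
the functions that vanish at the point. -/
abbrev GrFibre {ι : N → M} (F : ∀ q, Submodule ℝ (NormalSpace E E' ι q)) (k : ℕ) (q : N) :
    Type _ :=
  filt F k q ⧸ grKer F k q

/-- The class in `A_k|_q` of the germ at `ι q` of a function `f` in `𝒜_(k)`. -/
def grClass {ι : N → M} (F : ∀ q, Submodule ℝ (NormalSpace E E' ι q)) (k : ℕ) (q : N)
    (f : M → ℝ) (hf : SmoothNear E (ι q) f) (hk : germ f hf ∈ filt F k q) : GrFibre F k q :=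
  (grKer F k q).mkQ ⟨germ f hf, hk⟩

theorem mul_mem_grKer {ι : N → M} (F : ∀ q, Submodule ℝ (NormalSpace E E' ι q)) (j k n : ℕ)
    (hn : n = j + k) (q : N) (x : filt F j q) (hx : x ∈ grKer F j q) (y : filt F k q)
    (z : filt F n q) (hz : z.1 = x.1 * y.1) : z ∈ grKer F n q := by
  subst hn
  have hx' : x.1 ∈ filt F (j + 1) q ⊔ maxIdeal E (ι q) * filt F j q := hx
  have h₁ : x.1 * y.1 ∈ (filt F (j + 1) q ⊔ maxIdeal E (ι q) * filt F j q) * filt F k q :=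
    Ideal.mul_mem_mul hx' y.2
  rw [Ideal.sup_mul, mul_assoc, ← hz] at h₁
  have h₂ := filt_mul_le F (j + 1) k q
  rw [add_right_comm] at h₂
  exact sup_le_sup h₂ (Ideal.mul_mono_right (filt_mul_le F j k q)) h₁

/-- The multiplication `A_j|_q × A_k|_q → A_{j+k}|_q` of the graded algebra bundle, induced by the
product of functions. -/
def grMul {ι : N → M} (F : ∀ q, Submodule ℝ (NormalSpace E E' ι q)) (j k : ℕ) (q : N) :
    GrFibre F j q →ₗ[SmoothGerm E (ι q)] GrFibre F k q →ₗ[SmoothGerm E (ι q)]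
      GrFibre F (j + k) q :=
  let μ : filt F j q →ₗ[SmoothGerm E (ι q)] filt F k q →ₗ[SmoothGerm E (ι q)]
      GrFibre F (j + k) q :=
    LinearMap.mk₂ _
      (fun x y => (grKer F (j + k) q).mkQ
        ⟨x.1 * y.1, filt_mul_le F j k q (Ideal.mul_mem_mul x.2 y.2)⟩)
      (fun x x' y => by
        rw [← map_add]; congr 1; exact Subtype.ext (add_mul x.1 x'.1 y.1))
      (fun c x y => by
        rw [← map_smul]; congr 1; exact Subtype.ext (mul_assoc c x.1 y.1))
      (fun x y y' => by
        rw [← map_add]; congr 1; exact Subtype.ext (mul_add x.1 y.1 y'.1))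
      (fun c x y => by
        rw [← map_smul]; congr 1; exact Subtype.ext (mul_left_comm x.1 c y.1))
  Submodule.liftQ _ (LinearMap.flip (Submodule.liftQ _ μ.flip (fun y hy => by
    rw [LinearMap.mem_ker]
    ext x
    exact (Submodule.Quotient.mk_eq_zero _).2
      (mul_mem_grKer F k j _ (add_comm j k) q y hy x _ (mul_comm x.1 y.1))))) (fun x hx => by
    rw [LinearMap.mem_ker]
    ext y
    exact (Submodule.Quotient.mk_eq_zero _).2 (mul_mem_grKer F j k _ rfl q x hx y _ rfl))

/-- The product of the classes of `f` and `g` is the class of `f * g`. -/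
theorem grMul_grClass {ι : N → M} (F : ∀ q, Submodule ℝ (NormalSpace E E' ι q)) (j k : ℕ) (q : N)
    (f g : M → ℝ) (hf : SmoothNear E (ι q) f) (hg : SmoothNear E (ι q) g)
    (hj : germ f hf ∈ filt F j q) (hk : germ g hg ∈ filt F k q)
    (hfg : SmoothNear E (ι q) (f * g)) (hjk : germ (f * g) hfg ∈ filt F (j + k) q) :
    grMul F j k q (grClass F j q f hf hj) (grClass F k q g hg hk) =
      grClass F (j + k) q (f * g) hfg hjk :=
  rfl

/-- Smooth sections of `A_k`: those given locally by sections of the sheaf `𝒜_(k)`. -/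
def grSmooth {ι : N → M} (F : ∀ q, Submodule ℝ (NormalSpace E E' ι q)) (k : ℕ) (W : Set N)
    (s : ∀ q, GrFibre F k q) : Prop :=
  ∀ q₀ ∈ W, ∃ U : Set M, IsOpen U ∧ ι q₀ ∈ U ∧ ι ⁻¹' U ⊆ W ∧
    ∃ f : M → ℝ, ∀ q, ι q ∈ U → ∃ (hf : SmoothNear E (ι q) f) (hk : germ f hf ∈ filt F k q),
      s q = grClass F k q f hf hk

/-- The smooth sections of `A_k` form the sheaf `gr(𝒜)_k`: a section of `𝒜_(k)` whose class in every
fibre of `A_k` is zero is a section of `𝒜_(k+1)`. (By definition, every smooth section of `A_k` comes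
locally from a section of `𝒜_(k)`.) -/
def SectionsAreGr {ι : N → M} (F : ∀ q, Submodule ℝ (NormalSpace E E' ι q)) (k : ℕ) : Prop :=
  ∀ U : Set M, IsOpen U → ∀ (f : M → ℝ) (hf : ∀ q, ι q ∈ U → SmoothNear E (ι q) f)
    (hk : ∀ q (hq : ι q ∈ U), germ f (hf q hq) ∈ filt F k q),
    (∀ q (hq : ι q ∈ U), grClass F k q f (hf q hq) (hk q hq) = 0) →
    ∀ q (hq : ι q ∈ U), germ f (hf q hq) ∈ filt F (k + 1) q

end Normal

end WeightedNormal

end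

/-! Near a point of `N` there are functions (y, z) vanishing on `N`, transverse coordinates, and a
retraction π onto `N` such that F is the common kernel of the dz_j while the dy_i are dual to a
smooth frame e_i of F (`exists_adaptedCoords`). Hadamard's lemma writes any f vanishing on `N` as Σ
g_i y_i + Σ h_j z_j, and along `N` one finds df(e_i) = g_i. So f lies in 𝓙 exactly when every g_i
vanishes along `N`; a second use of Hadamard, on the g_i, shows that 𝓙 is generated by the y_i y_k
(i ≤ k) and the z_j (`AdaptedCoords.idealJ_eq_span`). With 𝓘² ⊂ 𝓙 ⊂ 𝓘 the filtration begins C^∞, 𝓘,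
𝓙, 𝓘𝓙.

Hence gr_0, gr_1, gr_2 are generated locally by 1, by the y_i, and by the y_i y_k together with the
z_j. These generators are frames: a combination lying in the next filtration step has coefficients
vanishing at the point. In degree 0 this is evaluation, in degree 1 pairing df with e_i. In degree 2
a relation modulo 𝓘𝓙 becomes an exact relation after the coefficients are changed by elements of 𝓘,
and an exact relation is tested on curves whose normal coordinates are s·v, where the linear and
quadratic terms scale differently (`AdaptedCoords.quadGen_indep`). `LocalGenerators` isolates what
these three cases share; the bundle structure and the identification of sections follow from it for
every k, with π extending coefficients from `N` to `M`.

The maps can now be read off in frames. In degree 0, [1] goes to 1; in degree 1, [y_i] goes to the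
functional dual to e_i. In degree 2, d kills the y_i y_k and sends z_j to dz_j; the dz_j are
independent and span ann(F), so d is onto with kernel spanned by the y_i y_k. These are the images
of products that span Sym²(F^*), and they are independent in A_2, so multiplication is injective
with image that kernel. -/

noncomputable section

namespace WeightedNormal

/-! ### Hadamard's lemma in a product of vector spaces. -/

section Hadamard

variable {H : Type*} [NormedAddCommGroup H] [NormedSpace ℝ H] [FiniteDimensional ℝ H]

/-- Differentiation under the integral sign. The dominating constant comes from compactness of the
closed unit ball times [0, 1], which uses the finite dimension of `H`. -/
theorem hasFDerivAt_unitIntegral {F : H → ℝ → ℝ} (hF : ContDiff ℝ 1 (Function.uncurry F)) (x₀ : H) :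
    HasFDerivAt (fun x => ∫ s in (0 : ℝ)..1, F x s)
      (∫ s in (0 : ℝ)..1, (fderiv ℝ (Function.uncurry F) (x₀, s)).comp
        (ContinuousLinearMap.inl ℝ H ℝ)) x₀ := by
  have hc : Continuous fun p : H × ℝ => (fderiv ℝ (Function.uncurry F) p).comp
      (ContinuousLinearMap.inl ℝ H ℝ) :=
    (hF.continuous_fderiv one_ne_zero).clm_comp continuous_const
  have hcx : ∀ x : H, Continuous (F x) := fun x =>
    hF.continuous.comp (Continuous.prodMk_right x)
  obtain ⟨C, hC⟩ := ((isCompact_closedBall x₀ 1).prod (isCompact_Icc (a := (0 : ℝ))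
    (b := 1))).exists_bound_of_continuousOn hc.continuousOn
  refine intervalIntegral.hasFDerivAt_integral_of_dominated_of_fderiv_le
    (F' := fun x s => (fderiv ℝ (Function.uncurry F) (x, s)).comp (ContinuousLinearMap.inl ℝ H ℝ))
    (bound := fun _ => C) (Metric.closedBall_mem_nhds x₀ one_pos)
    (Filter.Eventually.of_forall fun x => (hcx x).aestronglyMeasurable)
    ((hcx x₀).intervalIntegrable _ _)
    (hc.comp (Continuous.prodMk_right x₀)).aestronglyMeasurable
    (Filter.Eventually.of_forall fun s hs x hx => hC (x, s) ⟨hx, ?_⟩)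
    intervalIntegrable_const
    (Filter.Eventually.of_forall fun s _ x _ => ?_)
  · rw [Set.uIoc_of_le zero_le_one] at hs
    exact ⟨hs.1.le, hs.2⟩
  · have h₁ : HasFDerivAt (Function.uncurry F) (fderiv ℝ (Function.uncurry F) (x, s)) (x, s) :=
      (hF.differentiable one_ne_zero _).hasFDerivAt
    exact HasFDerivAt.comp (f := fun e => (e, s)) x h₁ (hasFDerivAt_prodMk_left x s)

/-- Integrating a smooth function over `[0, 1]` in one variable gives a smooth function of the
others. -/
theorem contDiff_unitIntegral {F : H → ℝ → ℝ} (hF : ContDiff ℝ ∞ (Function.uncurry F)) :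
    ContDiff ℝ ∞ fun x => ∫ s in (0 : ℝ)..1, F x s := by
  rw [contDiff_infty]
  intro n
  induction n generalizing F with
  | zero =>
    exact contDiff_zero.2
      (intervalIntegral.continuous_parametric_intervalIntegral_of_continuous' hF.continuous 0 1)
  | succ n ih =>
    have h := hasFDerivAt_unitIntegral (hF.of_le (by simp))
    push_cast
    refine contDiff_succ_iff_fderiv_apply.2 ⟨fun x => (h x).differentiableAt, by simp, fun y => ?_⟩
    have hc : Continuous fun p : H × ℝ => (fderiv ℝ (Function.uncurry F) p).comp
        (ContinuousLinearMap.inl ℝ H ℝ) :=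
      (hF.continuous_fderiv (by simp)).clm_comp continuous_const
    -- A directional derivative of the integral is again the integral of a smooth integrand, so the
    -- induction hypothesis, stated for all integrands, applies to it.
    have h' : (fun x => fderiv ℝ (fun x => ∫ s in (0 : ℝ)..1, F x s) x y) =
        fun x => ∫ s in (0 : ℝ)..1, fderiv ℝ (Function.uncurry F) (x, s) (y, 0) := by
      funext x
      rw [(h x).fderiv, ContinuousLinearMap.intervalIntegral_apply]
      · rfl
      · exact (hc.comp (Continuous.prodMk_right x)).intervalIntegrable _ _
    rw [h']
    refine ih (F := fun x s => fderiv ℝ (Function.uncurry F) (x, s) (y, 0)) ?_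
    exact (hF.fderiv_right (m := ∞) (by simp)).clm_apply contDiff_const

variable {A : Type*} [NormedAddCommGroup A] [NormedSpace ℝ A] [FiniteDimensional ℝ A] {d : ℕ}

/-- Fundamental theorem of calculus along s ↦ (u, s·t) for s in [0, 1]: the coefficient g_a is the
integral of the partial derivative ∂_a f over this segment. -/
theorem hadamard_global {f : A × (Fin d → ℝ) → ℝ} (hf : ContDiff ℝ ∞ f) :
    ∃ g : Fin d → A × (Fin d → ℝ) → ℝ, (∀ a, ContDiff ℝ ∞ (g a)) ∧
      ∀ p, f p = f (p.1, 0) + ∑ a, g a p * p.2 a := by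
  refine ⟨fun a p => ∫ s in (0 : ℝ)..1, fderiv ℝ f (p.1, s • p.2) (0, Pi.single a 1),
    fun a => contDiff_unitIntegral ?_, fun p => ?_⟩
  · exact ((hf.fderiv_right (m := ∞) (by simp)).comp (g := fderiv ℝ f)
      (f := fun q : (A × (Fin d → ℝ)) × ℝ => (q.1.1, q.2 • q.1.2)) (by fun_prop)).clm_apply
      contDiff_const
  · have hd : ∀ s : ℝ, HasDerivAt (fun s : ℝ => f (p.1, s • p.2))
        (fderiv ℝ f (p.1, s • p.2) (0, p.2)) s := fun s => by
      have h₁ : HasDerivAt (fun s : ℝ => ((p.1, s • p.2) : A × (Fin d → ℝ))) (0, p.2) s := by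
        have := (hasDerivAt_id s).smul_const p.2
        rw [one_smul] at this
        exact (hasDerivAt_const s p.1).prodMk this
      exact ((hf.differentiable (by simp) _).hasFDerivAt).comp_hasDerivAt s h₁
    have hcont : ∀ v, Continuous fun s : ℝ => fderiv ℝ f (p.1, s • p.2) v := fun v =>
      (((hf.continuous_fderiv (by simp)).comp (f := fun s : ℝ => (p.1, s • p.2))
        (by fun_prop))).clm_apply continuous_const
    have h₂ := intervalIntegral.integral_eq_sub_of_hasDerivAt (a := 0) (b := 1)
      (fun s _ => hd s) ((hcont _).intervalIntegrable _ _)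
    have h₃ : ((0, p.2) : A × (Fin d → ℝ)) = ∑ a, p.2 a • (0, Pi.single a 1) := by
      refine Prod.ext (by simp [Prod.fst_sum]) ?_
      ext b
      simp [Prod.snd_sum, Pi.single_apply]
    have h₄ : ∀ s : ℝ, fderiv ℝ f (p.1, s • p.2) (0, p.2) =
        ∑ a, p.2 a * fderiv ℝ f (p.1, s • p.2) (0, Pi.single a 1) := fun s => by
      rw [h₃, map_sum]
      simp only [map_smul, smul_eq_mul]
    simp only [h₄, one_smul, zero_smul] at h₂
    rw [intervalIntegral.integral_finsetSum
      (fun a _ => ((hcont _).const_mul _).intervalIntegrable _ _)] at h₂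
    simp only [intervalIntegral.integral_const_mul] at h₂
    have h₅ : f p = f (p.1, 0) + (f (p.1, p.2) - f (p.1, 0)) := by simp
    rw [h₅, ← h₂]
    simp [mul_comm]

/-- A bump function replaces a locally smooth f by a globally smooth one with the same germ; the
integral formula over whole segments then applies to it. -/
theorem exists_contDiff_eventuallyEq {f : H → ℝ} {p : H}
    (hf : ∀ᶠ x in 𝓝 p, ContDiffAt ℝ ∞ f x) :
    ∃ f' : H → ℝ, ContDiff ℝ ∞ f' ∧ f' =ᶠ[𝓝 p] f := by
  obtain ⟨ε, hε, hb⟩ := Metric.eventually_nhds_iff_ball.1 hf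
  -- The outer radius is smaller than ε, so the product with `χ` vanishes near every point outside
  -- the ball where f is known to be smooth.
  let χ : ContDiffBump p := ⟨ε / 4, ε / 2, by positivity, by linarith⟩
  refine ⟨fun x => χ x * f x, contDiff_iff_contDiffAt.2 fun x => ?_, ?_⟩
  · by_cases hx : x ∈ Metric.ball p ε
    · exact χ.contDiff.contDiffAt.mul (hb x hx)
    · have h₀ : ∀ᶠ y in 𝓝 x, y ∉ Metric.closedBall p (ε / 2) :=
        Metric.isClosed_closedBall.isOpen_compl.mem_nhds fun h =>
          hx (Metric.closedBall_subset_ball (by linarith) h)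
      refine (contDiffAt_const (c := (0 : ℝ))).congr_of_eventuallyEq ?_
      filter_upwards [h₀] with y hy
      rw [χ.zero_of_le_dist, zero_mul]
      simpa using (not_le.1 hy).le
  · filter_upwards [χ.eventuallyEq_one] with x hx
    simp [hx]

/-- Hadamard's lemma. -/
theorem hadamard {f : A × (Fin d → ℝ) → ℝ} {u : A}
    (hf : ∀ᶠ p in 𝓝 (u, (0 : Fin d → ℝ)), ContDiffAt ℝ ∞ f p) (h0 : ∀ᶠ u' in 𝓝 u, f (u', 0) = 0) :
    ∃ g : Fin d → A × (Fin d → ℝ) → ℝ, (∀ a, ContDiff ℝ ∞ (g a)) ∧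
      ∀ᶠ p in 𝓝 (u, (0 : Fin d → ℝ)), f p = ∑ a, g a p * p.2 a := by
  obtain ⟨f', hf', he⟩ := exists_contDiff_eventuallyEq hf
  obtain ⟨g, hg, h⟩ := hadamard_global hf'
  refine ⟨g, hg, ?_⟩
  have h₁ : Filter.Tendsto (fun p : A × (Fin d → ℝ) => (p.1, (0 : Fin d → ℝ)))
      (𝓝 (u, 0)) (𝓝 (u, 0)) :=
    Continuous.tendsto' (by fun_prop) _ _ rfl
  have h₂ : Filter.Tendsto (fun p : A × (Fin d → ℝ) => p.1) (𝓝 (u, 0)) (𝓝 u) :=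
    Continuous.tendsto' (by fun_prop) _ _ rfl
  filter_upwards [he, h₁.eventually he, h₂.eventually h0] with p hp hp' hp0
  rw [← hp, h p, hp', hp0, zero_add]

end Hadamard

/-! ### Differentials of functions and their restriction to the submanifold. -/

section Differential

variable {E : Type*} [NormedAddCommGroup E] [NormedSpace ℝ E]
  {M : Type*} [TopologicalSpace M] [ChartedSpace E M]

/-- The differential of a real function at a point, as a linear form. -/
def dAt (x : M) (f : M → ℝ) : TangentSpace 𝓘(ℝ, E) x →ₗ[ℝ] ℝ :=
  (mfderiv 𝓘(ℝ, E) 𝓘(ℝ) f x).toLinearMap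

theorem HasMFDerivAt.dAt_apply {x : M} {f : M → ℝ} {f' : TangentSpace 𝓘(ℝ, E) x →L[ℝ] ℝ}
    (h : HasMFDerivAt 𝓘(ℝ, E) 𝓘(ℝ) f x f') (v : TangentSpace 𝓘(ℝ, E) x) : dAt x f v = f' v :=
  congrArg (fun l : TangentSpace 𝓘(ℝ, E) x →L[ℝ] ℝ => l v) h.mfderiv

theorem dAt_congr {x : M} {f g : M → ℝ} (h : f =ᶠ[𝓝 x] g) : dAt (E := E) x f = dAt x g :=
  congrArg (fun l : TangentSpace 𝓘(ℝ, E) x →L[ℝ] ℝ => l.toLinearMap) h.mfderiv_eq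

theorem dAt_const (x : M) (c : ℝ) : dAt (E := E) x (fun _ => c) = 0 := by
  ext v
  exact HasMFDerivAt.dAt_apply (hasMFDerivAt_const c x) v

theorem SmoothNear.contMDiffAt {x : M} {f : M → ℝ} (hf : SmoothNear E x f) :
    ContMDiffAt 𝓘(ℝ, E) 𝓘(ℝ) ∞ f x :=
  Filter.Eventually.self_of_nhds hf

theorem SmoothNear.hasMFDerivAt {x : M} {f : M → ℝ} (hf : SmoothNear E x f) :
    HasMFDerivAt 𝓘(ℝ, E) 𝓘(ℝ) f x (mfderiv 𝓘(ℝ, E) 𝓘(ℝ) f x) :=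
  (hf.contMDiffAt.mdifferentiableAt (by simp)).hasMFDerivAt

theorem SmoothNear.eventually {x : M} {f : M → ℝ} (hf : SmoothNear E x f) :
    ∀ᶠ y in 𝓝 x, SmoothNear E y f :=
  eventually_eventually_nhds.2 hf

theorem SmoothNear.add {x : M} {f g : M → ℝ} (hf : SmoothNear E x f) (hg : SmoothNear E x g) :
    SmoothNear E x (f + g) := by
  filter_upwards [hf, hg] with y h₁ h₂ using h₁.add h₂

theorem SmoothNear.sub {x : M} {f g : M → ℝ} (hf : SmoothNear E x f) (hg : SmoothNear E x g) :
    SmoothNear E x (f - g) := by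
  filter_upwards [hf, hg] with y h₁ h₂ using h₁.sub h₂

theorem SmoothNear.mul {x : M} {f g : M → ℝ} (hf : SmoothNear E x f) (hg : SmoothNear E x g) :
    SmoothNear E x (f * g) := by
  filter_upwards [hf, hg] with y h₁ h₂ using h₁.mul h₂

theorem smoothNear_const (x : M) (c : ℝ) : SmoothNear E x (fun _ => c) :=
  Filter.Eventually.of_forall fun _ => contMDiffAt_const

theorem SmoothNear.sum {κ : Type*} (t : Finset κ) {x : M} {f : κ → M → ℝ}
    (hf : ∀ j ∈ t, SmoothNear E x (f j)) : SmoothNear E x (∑ j ∈ t, f j) := by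
  classical
  induction t using Finset.induction_on with
  | empty => exact smoothNear_const x 0
  | insert a t ha ih =>
    rw [Finset.sum_insert ha]
    exact (hf a (Finset.mem_insert_self a t)).add
      (ih fun j hj => hf j (Finset.mem_insert_of_mem hj))

theorem smoothNear_of_contMDiffOn {U : Set M} (hU : IsOpen U) {f : M → ℝ}
    (hf : ContMDiffOn 𝓘(ℝ, E) 𝓘(ℝ) ∞ f U) {x : M} (hx : x ∈ U) : SmoothNear E x f := by
  filter_upwards [hU.mem_nhds hx] with y hy using hf.contMDiffAt (hU.mem_nhds hy)

theorem dAt_add {x : M} {f g : M → ℝ} (hf : SmoothNear E x f) (hg : SmoothNear E x g) :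
    dAt (E := E) x (f + g) = dAt x f + dAt x g := by
  ext v
  exact HasMFDerivAt.dAt_apply (hf.hasMFDerivAt.add hg.hasMFDerivAt) v

theorem dAt_mul {x : M} {f g : M → ℝ} (hf : SmoothNear E x f) (hg : SmoothNear E x g) :
    dAt (E := E) x (f * g) = f x • dAt x g + g x • dAt x f := by
  ext v
  exact HasMFDerivAt.dAt_apply (hf.hasMFDerivAt.mul hg.hasMFDerivAt) v

theorem dAt_sum {κ : Type*} (t : Finset κ) {x : M} {f : κ → M → ℝ}
    (hf : ∀ j ∈ t, SmoothNear E x (f j)) :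
    dAt (E := E) x (∑ j ∈ t, f j) = ∑ j ∈ t, dAt x (f j) := by
  classical
  induction t using Finset.induction_on with
  | empty => exact dAt_const x 0
  | insert a t ha ih =>
    have h := fun j hj => hf j (Finset.mem_insert_of_mem hj)
    rw [Finset.sum_insert ha, Finset.sum_insert ha,
      dAt_add (hf a (Finset.mem_insert_self a t)) (SmoothNear.sum t h), ih h]

/-- The differential of `∑ gⱼ wⱼ` at a common zero of the `wⱼ`. -/
theorem dAt_sum_mul {κ : Type*} [Fintype κ] {x : M} {f : M → ℝ} {g w : κ → M → ℝ}
    (hg : ∀ j, SmoothNear E x (g j)) (hw : ∀ j, SmoothNear E x (w j)) (hw0 : ∀ j, w j x = 0)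
    (hf : f =ᶠ[𝓝 x] ∑ j, g j * w j) : dAt (E := E) x f = ∑ j, g j x • dAt x (w j) := by
  rw [dAt_congr hf, dAt_sum _ fun j _ => (hg j).mul (hw j)]
  refine Finset.sum_congr rfl fun j _ => ?_
  rw [dAt_mul (hg j) (hw j), hw0 j, zero_smul, add_zero]

section Submanifold

variable {E' : Type*} [NormedAddCommGroup E'] [NormedSpace ℝ E']
  {N : Type*} [TopologicalSpace N] [ChartedSpace E' N] {ι : N → M}

theorem dAt_mfderiv {q : N} {f : M → ℝ} (hι : MDifferentiableAt 𝓘(ℝ, E') 𝓘(ℝ, E) ι q)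
    (hf : SmoothNear E (ι q) f) (u : TangentSpace 𝓘(ℝ, E') q) :
    dAt (E := E) (ι q) f (mfderiv 𝓘(ℝ, E') 𝓘(ℝ, E) ι q u) = dAt q (f ∘ ι) u :=
  (HasMFDerivAt.dAt_apply (hf.hasMFDerivAt.comp q hι.hasMFDerivAt) u).symm

/-- Chain rule: f ∘ ι vanishes near q, so df kills the image of dι. This is what lets df descend to
the normal space. -/
theorem dAt_eq_zero_of_mem_range {q : N} {f : M → ℝ}
    (hι : MDifferentiableAt 𝓘(ℝ, E') 𝓘(ℝ, E) ι q)
    (hf : SmoothNear E (ι q) f) (h0 : ∀ᶠ q' in 𝓝 q, f (ι q') = 0) {v : TangentSpace 𝓘(ℝ, E) (ι q)}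
    (hv : v ∈ LinearMap.range (mfderiv 𝓘(ℝ, E') 𝓘(ℝ, E) ι q).toLinearMap) :
    dAt (ι q) f v = 0 := by
  obtain ⟨u, rfl⟩ := hv
  refine (dAt_mfderiv hι hf u).trans ?_
  have h : dAt (E := E') q (f ∘ ι) = 0 := by
    rw [← dAt_const q 0]
    exact dAt_congr h0
  rw [h, LinearMap.zero_apply]

theorem contMDiffOn_dAt [IsManifold 𝓘(ℝ, E) ∞ M] {W : Set N} {f : M → ℝ}
    (hf : ∀ q ∈ W, SmoothNear E (ι q) f) {σ : ∀ q, TangentSpace 𝓘(ℝ, E) (ι q)}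
    (hσ : ContMDiffOn 𝓘(ℝ, E') 𝓘(ℝ, E).tangent ∞
        (fun q => (⟨ι q, σ q⟩ : TangentBundle 𝓘(ℝ, E) M)) W) :
    ContMDiffOn 𝓘(ℝ, E') 𝓘(ℝ) ∞ (fun q => dAt (ι q) f (σ q)) W := by
  have : IsManifold 𝓘(ℝ, E) 1 M := IsManifold.of_le (n := ∞) (by simp)
  -- `f` is smooth only near the points ι q. On the open set of all points where it is smooth its
  -- tangent map is smooth, and the pairing is the fibre component of that map composed with `σ`.
  set O : Set M := {y | SmoothNear E y f}
  have hO : IsOpen O := isOpen_iff_mem_nhds.2 fun y hy => SmoothNear.eventually hy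
  have hfO : ContMDiffOn 𝓘(ℝ, E) 𝓘(ℝ) ∞ f O := fun y hy =>
    (SmoothNear.contMDiffAt hy).contMDiffWithinAt
  have h := (contMDiff_snd_tangentBundle_modelSpace (n := ∞) ℝ 𝓘(ℝ)).comp_contMDiffOn
    ((hfO.contMDiffOn_tangentMapWithin (m := ∞) (by simp) hO.uniqueMDiffOn).comp hσ
      fun q hq => hf q hq)
  refine h.congr fun q hq => ?_
  exact congrArg (fun l : TangentSpace 𝓘(ℝ, E) (ι q) →L[ℝ] ℝ => l (σ q))
    (mfderivWithin_of_isOpen hO (hf q hq)).symm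

end Submanifold

end Differential

/-! ### Value and differential as functions of a germ. -/

section GermCalculus

variable {E : Type*} [NormedAddCommGroup E] [NormedSpace ℝ E]
  {M : Type*} [TopologicalSpace M] [ChartedSpace E M] {x : M}

theorem germ_surjective (g : SmoothGerm E x) : ∃ f, ∃ hf : SmoothNear E x f, germ f hf = g := by
  obtain ⟨_, f, hf, rfl⟩ := g
  exact ⟨f, hf, rfl⟩

theorem germ_eq_germ {f g : M → ℝ} {hf : SmoothNear E x f} {hg : SmoothNear E x g} :
    germ f hf = germ g hg ↔ f =ᶠ[𝓝 x] g :=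
  Subtype.ext_iff.trans Filter.Germ.coe_eq

theorem germ_add {f g : M → ℝ} (hf : SmoothNear E x f) (hg : SmoothNear E x g) :
    germ (f + g) (hf.add hg) = germ f hf + germ g hg := rfl

theorem germ_sub {f g : M → ℝ} (hf : SmoothNear E x f) (hg : SmoothNear E x g) :
    germ (f - g) (hf.sub hg) = germ f hf - germ g hg := rfl

theorem germ_mul {f g : M → ℝ} (hf : SmoothNear E x f) (hg : SmoothNear E x g) :
    germ (f * g) (hf.mul hg) = germ f hf * germ g hg := rfl

theorem germ_sum {κ : Type*} (t : Finset κ) {f : κ → M → ℝ}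
    (hf : ∀ j, SmoothNear E x (f j)) :
    germ (∑ j ∈ t, f j) (SmoothNear.sum t fun j _ => hf j) = ∑ j ∈ t, germ (f j) (hf j) := by
  classical
  induction t using Finset.induction_on with
  | empty => rfl
  | insert a t ha ih =>
    refine Eq.trans (germ_eq_germ (hg := (hf a).add (SmoothNear.sum t fun j _ => hf j)).2
      (Filter.EventuallyEq.of_eq (Finset.sum_insert ha))) ?_
    rw [Finset.sum_insert ha, ← ih]
    exact germ_add (hf a) (SmoothNear.sum t fun j _ => hf j)

theorem germ_sum_mul {κ : Type*} [Fintype κ] {f g : κ → M → ℝ}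
    (hf : ∀ j, SmoothNear E x (f j)) (hg : ∀ j, SmoothNear E x (g j)) :
    germ (∑ j, f j * g j) (SmoothNear.sum _ fun j _ => (hf j).mul (hg j)) =
      ∑ j, germ (f j) (hf j) * germ (g j) (hg j) :=
  germ_sum _ fun j => (hf j).mul (hg j)

theorem algebraMap_eq_germ (c : ℝ) :
    algebraMap ℝ (SmoothGerm E x) c = germ (fun _ => c) (smoothNear_const x c) := by
  rw [Algebra.algebraMap_eq_smul_one]
  refine Subtype.ext (congrArg Filter.Germ.ofFun ?_)
  funext y
  exact mul_one c

/-- A function representing a germ. -/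
def germRep (g : SmoothGerm E x) : M → ℝ := (germ_surjective g).choose

theorem germRep_germ {f : M → ℝ} (hf : SmoothNear E x f) : germRep (germ f hf) =ᶠ[𝓝 x] f :=
  germ_eq_germ.1 (germ_surjective (germ f hf)).choose_spec.choose_spec

variable (E x) in
/-- Evaluation of germs at the base point. -/
def evalGerm : SmoothGerm E x →ₐ[ℝ] ℝ where
  toFun g := germRep g x
  map_one' := (germRep_germ (smoothNear_const (E := E) x 1)).self_of_nhds
  map_mul' a b := by
    obtain ⟨f, hf, rfl⟩ := germ_surjective a
    obtain ⟨g, hg, rfl⟩ := germ_surjective b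
    rw [← germ_mul hf hg, (germRep_germ hf).self_of_nhds, (germRep_germ hg).self_of_nhds,
      (germRep_germ (hf.mul hg)).self_of_nhds, Pi.mul_apply]
  map_zero' := (germRep_germ (smoothNear_const (E := E) x 0)).self_of_nhds
  map_add' a b := by
    obtain ⟨f, hf, rfl⟩ := germ_surjective a
    obtain ⟨g, hg, rfl⟩ := germ_surjective b
    rw [← germ_add hf hg, (germRep_germ hf).self_of_nhds, (germRep_germ hg).self_of_nhds,
      (germRep_germ (hf.add hg)).self_of_nhds, Pi.add_apply]
  commutes' c := by
    rw [algebraMap_eq_germ]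
    exact (germRep_germ _).self_of_nhds

@[simp]
theorem evalGerm_germ {f : M → ℝ} (hf : SmoothNear E x f) : evalGerm E x (germ f hf) = f x :=
  (germRep_germ hf).self_of_nhds

variable (E x) in
/-- The differential of germs at the base point. -/
def dGerm : SmoothGerm E x →ₗ[ℝ] Module.Dual ℝ (TangentSpace 𝓘(ℝ, E) x) where
  toFun g := dAt x (germRep g)
  map_add' a b := by
    obtain ⟨f, hf, rfl⟩ := germ_surjective a
    obtain ⟨g, hg, rfl⟩ := germ_surjective b
    rw [← germ_add hf hg, dAt_congr (germRep_germ hf), dAt_congr (germRep_germ hg),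
      dAt_congr (germRep_germ (hf.add hg)), dAt_add hf hg]
  map_smul' c a := by
    obtain ⟨f, hf, rfl⟩ := germ_surjective a
    rw [Algebra.smul_def, algebraMap_eq_germ, ← germ_mul (smoothNear_const x c) hf,
      dAt_congr (germRep_germ hf), dAt_congr (germRep_germ ((smoothNear_const x c).mul hf)),
      dAt_mul (smoothNear_const x c) hf, dAt_const, smul_zero, add_zero, RingHom.id_apply]

theorem dGerm_germ {f : M → ℝ} (hf : SmoothNear E x f) : dGerm E x (germ f hf) = dAt x f :=
  dAt_congr (germRep_germ hf)

theorem dGerm_mul (a b : SmoothGerm E x) :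
    dGerm E x (a * b) = evalGerm E x a • dGerm E x b + evalGerm E x b • dGerm E x a := by
  obtain ⟨f, hf, rfl⟩ := germ_surjective a
  obtain ⟨g, hg, rfl⟩ := germ_surjective b
  rw [← germ_mul hf hg, dGerm_germ, dGerm_germ, dGerm_germ, dAt_mul hf hg, evalGerm_germ,
    evalGerm_germ]

theorem mem_maxIdeal {a : SmoothGerm E x} : a ∈ maxIdeal E x ↔ evalGerm E x a = 0 := by
  constructor
  · rintro ⟨f, hf, rfl, h0⟩
    rw [evalGerm_germ, h0]
  · obtain ⟨f, hf, rfl⟩ := germ_surjective a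
    rw [evalGerm_germ]
    exact fun h => ⟨f, hf, rfl, h⟩

end GermCalculus

/-! ### Coordinates normal to an embedded submanifold. -/

section NormalCoordinates

/-- Coordinates `w` normal to the submanifold `ι : N → M` on an open set `U`, together with a
retraction `π` of `U` onto the submanifold. -/
structure NormalCoords (E : Type*) [NormedAddCommGroup E] [NormedSpace ℝ E]
    (E' : Type*) [NormedAddCommGroup E'] [NormedSpace ℝ E']
    {M : Type*} [TopologicalSpace M] [ChartedSpace E M]
    {N : Type*} [TopologicalSpace N] [ChartedSpace E' N]
    (ι : N → M) (U : Set M) (π : M → N) {κ : Type*} [Fintype κ] (w : κ → M → ℝ) : Prop where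
  isOpen : IsOpen U
  contMDiffOn_proj : ContMDiffOn 𝓘(ℝ, E) 𝓘(ℝ, E') ∞ π U
  proj_apply : ∀ q, ι q ∈ U → π (ι q) = q
  contMDiffOn_coord : ∀ a, ContMDiffOn 𝓘(ℝ, E) 𝓘(ℝ) ∞ (w a) U
  coord_eq_zero : ∀ q, ι q ∈ U → ∀ a, w a (ι q) = 0
  hadamard : ∀ q, ι q ∈ U → ∀ f, SmoothNear E (ι q) f → (∀ᶠ q' in 𝓝 q, f (ι q') = 0) →
    ∃ g : κ → M → ℝ, (∀ a, SmoothNear E (ι q) (g a)) ∧ f =ᶠ[𝓝 (ι q)] ∑ a, g a * w a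
  slice : ∀ q, ι q ∈ U → ∀ v : κ → ℝ, ∃ γ : ℝ → M, ContinuousAt γ 0 ∧ γ 0 = ι q ∧
    ∀ᶠ s in 𝓝 (0 : ℝ), π (γ s) = q ∧ ∀ a, w a (γ s) = s * v a
  surjective : ∀ q, ι q ∈ U → ∀ v : κ → ℝ, ∃ u : TangentSpace 𝓘(ℝ, E) (ι q),
    ∀ a, dAt (ι q) (w a) u = v a
  ker : ∀ q, ι q ∈ U → ∀ u : TangentSpace 𝓘(ℝ, E) (ι q), (∀ a, dAt (ι q) (w a) u = 0) →
    u ∈ LinearMap.range (mfderiv 𝓘(ℝ, E') 𝓘(ℝ, E) ι q).toLinearMap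

variable {E : Type*} [NormedAddCommGroup E] [NormedSpace ℝ E]
  {E' : Type*} [NormedAddCommGroup E'] [NormedSpace ℝ E'] [FiniteDimensional ℝ E']
  {M : Type*} [TopologicalSpace M] [ChartedSpace E M]
  {N : Type*} [TopologicalSpace N] [ChartedSpace E' N]
  {ι : N → M}

/-- A chart of `M` in which the submanifold is a coordinate subspace gives normal coordinates. -/
theorem normalCoords_of_chart {d : ℕ} {U : Set M} {φ : OpenPartialHomeomorph N E'}
    {Ψ : M → E' × (Fin d → ℝ)} {Θ : E' × (Fin d → ℝ) → M} (hU : IsOpen U)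
    (hι : ContMDiff 𝓘(ℝ, E') 𝓘(ℝ, E) ∞ ι)
    (hφ : ContMDiffOn 𝓘(ℝ, E') 𝓘(ℝ, E') ∞ φ.symm φ.target)
    (hsource : ∀ q, ι q ∈ U → q ∈ φ.source) (htarget : ∀ x ∈ U, (Ψ x).1 ∈ φ.target)
    (hΨ : ContMDiffOn 𝓘(ℝ, E) 𝓘(ℝ, E' × (Fin d → ℝ)) ∞ Ψ U)
    (hΘ : ∀ x ∈ U, ∀ᶠ p in 𝓝 (Ψ x), ContMDiffAt 𝓘(ℝ, E' × (Fin d → ℝ)) 𝓘(ℝ, E) ∞ Θ p)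
    (hΘΨ : ∀ x ∈ U, Θ (Ψ x) = x) (hΨΘ : ∀ x ∈ U, ∀ᶠ p in 𝓝 (Ψ x), Ψ (Θ p) = p)
    (hΨι : ∀ q, ι q ∈ U → Ψ (ι q) = (φ q, 0)) :
    NormalCoords E E' ι U (fun x => φ.symm (Ψ x).1) (fun a x => (Ψ x).2 a) := by
  have hΨat : ∀ x ∈ U, ContMDiffAt 𝓘(ℝ, E) 𝓘(ℝ, E' × (Fin d → ℝ)) ∞ Ψ x := fun x hx =>
    hΨ.contMDiffAt (hU.mem_nhds hx)
  have hcoord : ∀ a, ContMDiffOn 𝓘(ℝ, E) 𝓘(ℝ) ∞ (fun x => (Ψ x).2 a) U := fun a =>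
    ((((ContinuousLinearMap.proj (R := ℝ) (φ := fun _ : Fin d => ℝ) a).comp
      (ContinuousLinearMap.snd ℝ E' (Fin d → ℝ))).contMDiff).comp_contMDiffOn hΨ)
  -- Differentiating Θ ∘ Ψ = id and Ψ ∘ Θ = id makes the two differentials mutually inverse.
  have hderiv : ∀ q, ι q ∈ U → ∃ (A : E →L[ℝ] E' × (Fin d → ℝ)) (B : E' × (Fin d → ℝ) →L[ℝ] E),
      HasMFDerivAt 𝓘(ℝ, E) 𝓘(ℝ, E' × (Fin d → ℝ)) Ψ (ι q) A ∧
      HasMFDerivAt 𝓘(ℝ, E' × (Fin d → ℝ)) 𝓘(ℝ, E) Θ (Ψ (ι q)) B ∧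
      (∀ v, B (A v) = v) ∧ (∀ v, A (B v) = v) := by
    intro q hq
    have hA := ((hΨat _ hq).mdifferentiableAt (by simp)).hasMFDerivAt
    have hB := ((hΘ _ hq).self_of_nhds.mdifferentiableAt (by simp)).hasMFDerivAt
    refine ⟨_, _, hA, hB, fun v => ?_, fun v => ?_⟩
    · have h₁ := (hB.comp _ hA).congr_of_eventuallyEq (f₁ := id)
        (by filter_upwards [hU.mem_nhds hq] with x hx using (hΘΨ x hx).symm)
      exact congrArg (fun l : E →L[ℝ] E => l v) (hasMFDerivAt_unique h₁ (hasMFDerivAt_id _))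
    · have hA' : HasMFDerivAt 𝓘(ℝ, E) 𝓘(ℝ, E' × (Fin d → ℝ)) Ψ (Θ (Ψ (ι q)))
          (mfderiv 𝓘(ℝ, E) 𝓘(ℝ, E' × (Fin d → ℝ)) Ψ (ι q)) := by
        rw [hΘΨ _ hq]; exact hA
      have h₁ := (hA'.comp _ hB).congr_of_eventuallyEq (f₁ := id)
        (by filter_upwards [hΨΘ _ hq] with p hp using hp.symm)
      exact congrArg (fun l : E' × (Fin d → ℝ) →L[ℝ] E' × (Fin d → ℝ) => l v)
        (hasMFDerivAt_unique h₁ (hasMFDerivAt_id _))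
  have hd : ∀ q (hq : ι q ∈ U) (A : E →L[ℝ] E' × (Fin d → ℝ)),
      HasMFDerivAt 𝓘(ℝ, E) 𝓘(ℝ, E' × (Fin d → ℝ)) Ψ (ι q) A →
      ∀ a (v : TangentSpace 𝓘(ℝ, E) (ι q)), dAt (ι q) (fun x => (Ψ x).2 a) v = (A v).2 a := by
    intro q hq A hA a v
    have h₁ : HasMFDerivAt 𝓘(ℝ, E' × (Fin d → ℝ)) 𝓘(ℝ) (fun p : E' × (Fin d → ℝ) => p.2 a)
        (Ψ (ι q)) ((ContinuousLinearMap.proj (R := ℝ) (φ := fun _ : Fin d => ℝ) a).comp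
          (ContinuousLinearMap.snd ℝ E' (Fin d → ℝ))) :=
      ContinuousLinearMap.hasMFDerivAt
        ((ContinuousLinearMap.proj (R := ℝ) (φ := fun _ : Fin d => ℝ) a).comp
          (ContinuousLinearMap.snd ℝ E' (Fin d → ℝ)))
    exact HasMFDerivAt.dAt_apply (h₁.comp _ hA) v
  refine ⟨hU, ?_, fun q hq => ?_, hcoord, fun q hq a => ?_, fun q hq f hf h0 => ?_,
    fun q hq v => ?_, fun q hq v => ?_, fun q hq u hu => ?_⟩
  · exact hφ.comp ((ContinuousLinearMap.fst ℝ E' (Fin d → ℝ)).contMDiff.comp_contMDiffOn hΨ) htarget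
  · rw [hΨι q hq]
    exact φ.left_inv (hsource q hq)
  · rw [hΨι q hq]
    rfl
  · have hΘt : Filter.Tendsto Θ (𝓝 (Ψ (ι q))) (𝓝 (ι q)) := by
      have := (hΘ _ hq).self_of_nhds.continuousAt
      rwa [ContinuousAt, hΘΨ _ hq] at this
    have h₁ : ∀ᶠ p in 𝓝 (φ q, (0 : Fin d → ℝ)), ContDiffAt ℝ ∞ (f ∘ Θ) p := by
      rw [← hΨι q hq]
      filter_upwards [hΘ _ hq, hΘt.eventually hf] with p hp hfp
      exact contMDiffAt_iff_contDiffAt.1 (hfp.comp p hp)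
    have hφq : φ q ∈ φ.target := φ.map_source (hsource q hq)
    have hφt : Filter.Tendsto φ.symm (𝓝 (φ q)) (𝓝 q) := φ.tendsto_symm (hsource q hq)
    have h₂ : ∀ᶠ u in 𝓝 (φ q), (f ∘ Θ) (u, 0) = 0 := by
      filter_upwards [φ.open_target.mem_nhds hφq, hφt.eventually h0,
        hφt.eventually (hι.continuous.continuousAt.eventually (hU.mem_nhds hq))] with u hu hfu hUu
      have h₃ := hΨι _ hUu
      rw [φ.right_inv hu] at h₃
      rw [Function.comp_apply, ← h₃, hΘΨ _ hUu, hfu]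
    obtain ⟨g, hg, he⟩ := WeightedNormal.hadamard h₁ h₂
    refine ⟨fun a x => g a (Ψ x), fun a => ?_, ?_⟩
    · filter_upwards [hU.mem_nhds hq] with y hy
      exact (hg a).contMDiff.contMDiffAt.comp y (hΨat y hy)
    · rw [← hΨι q hq] at he
      filter_upwards [(hΨat _ hq).continuousAt.eventually he, hU.mem_nhds hq] with y hy hyU
      rw [Function.comp_apply, hΘΨ y hyU] at hy
      simpa using hy
  -- The required curve is the straight line s ↦ (φ q, s·v) carried to `M` by Θ.
  · have hc : Filter.Tendsto (fun s : ℝ => (φ q, s • v)) (𝓝 0) (𝓝 (Ψ (ι q))) :=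
      Continuous.tendsto' (by fun_prop) _ _ (by rw [hΨι q hq, zero_smul])
    refine ⟨fun s => Θ (φ q, s • v), ?_, ?_, ?_⟩
    · have h₁ : ContinuousAt Θ (φ q, (0 : ℝ) • v) := by
        rw [zero_smul, ← hΨι q hq]
        exact (hΘ _ hq).self_of_nhds.continuousAt
      exact ContinuousAt.comp (g := Θ) (f := fun s : ℝ => (φ q, s • v)) h₁
        (Continuous.continuousAt (by fun_prop))
    · simp only [zero_smul]
      rw [← hΨι q hq, hΘΨ _ hq]
    · filter_upwards [hc.eventually (hΨΘ _ hq)] with s hs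
      refine ⟨?_, fun a => ?_⟩
      · rw [hs]
        exact φ.left_inv (hsource q hq)
      · rw [hs]
        rfl
  · obtain ⟨A, B, hA, hB, hBA, hAB⟩ := hderiv q hq
    refine ⟨B (0, v), fun a => ?_⟩
    exact (hd q hq A hA a _).trans
      (congrArg (fun p : E' × (Fin d → ℝ) => p.2 a) (hAB (0, v)))
  · obtain ⟨A, B, hA, hB, hBA, hAB⟩ := hderiv q hq
    have h₁ : A u = ((A u).1, 0) := Prod.ext rfl (funext fun a => by
      rw [← hd q hq A hA]; exact hu a)
    have hφq : φ q ∈ φ.target := φ.map_source (hsource q hq)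
    have hφt : Filter.Tendsto φ.symm (𝓝 (φ q)) (𝓝 q) := φ.tendsto_symm (hsource q hq)
    have hS := (((hφ.contMDiffAt (φ.open_target.mem_nhds hφq)).mdifferentiableAt
      (by simp))).hasMFDerivAt
    have hI : HasMFDerivAt 𝓘(ℝ, E') 𝓘(ℝ, E) ι (φ.symm (φ q)) (mfderiv 𝓘(ℝ, E') 𝓘(ℝ, E) ι q) := by
      rw [φ.left_inv (hsource q hq)]
      exact (hι.mdifferentiable (by simp) q).hasMFDerivAt
    have hJ : HasMFDerivAt 𝓘(ℝ, E') 𝓘(ℝ, E' × (Fin d → ℝ)) (fun u => (u, (0 : Fin d → ℝ))) (φ q)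
        (ContinuousLinearMap.inl ℝ E' (Fin d → ℝ)) :=
      ContinuousLinearMap.hasMFDerivAt (ContinuousLinearMap.inl ℝ E' (Fin d → ℝ))
    have hB' : HasMFDerivAt 𝓘(ℝ, E' × (Fin d → ℝ)) 𝓘(ℝ, E) Θ (φ q, 0) B := by
      rw [← hΨι q hq]; exact hB
    -- Near φ q the maps ι ∘ φ⁻¹ and Θ ∘ (·, 0) agree. Their differentials therefore agree, and u =
    -- B(A u), whose normal component is zero, lies in the range of dι.
    have h₂ := (hI.comp _ hS).congr_of_eventuallyEq (f₁ := Θ ∘ fun u => (u, (0 : Fin d → ℝ))) (by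
      filter_upwards [φ.open_target.mem_nhds hφq,
        hφt.eventually (hι.continuous.continuousAt.eventually (hU.mem_nhds hq))] with u hu hUu
      have h₃ := hΨι _ hUu
      rw [φ.right_inv hu] at h₃
      rw [Function.comp_apply, Function.comp_apply, ← h₃, hΘΨ _ hUu])
    have h₃ := hasMFDerivAt_unique h₂
      (HasMFDerivAt.comp (f := fun u => (u, (0 : Fin d → ℝ))) (φ q) hB' hJ)
    refine ⟨mfderiv 𝓘(ℝ, E') 𝓘(ℝ, E') φ.symm (φ q) (A u).1, ?_⟩
    refine (congrArg (fun l : E' →L[ℝ] E => l (A u).1) h₃).trans ?_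
    refine Eq.trans ?_ (hBA u)
    rw [h₁]
    rfl

/-- Near every point of an embedded submanifold there are normal coordinates. -/
theorem exists_normalCoords [FiniteDimensional ℝ E]
    (hι : Manifold.IsSmoothEmbedding 𝓘(ℝ, E') 𝓘(ℝ, E) ∞ ι) (q₀ : N) :
    ∃ (U : Set M) (_ : ι q₀ ∈ U) (π : M → N) (d : ℕ) (w : Fin d → M → ℝ),
      NormalCoords E E' ι U π w := by
  have h := hι.isImmersion.isImmersionAt q₀
  have : FiniteDimensional ℝ h.complement :=
    FiniteDimensional.of_injective (h.equiv.toLinearEquiv.toLinearMap ∘ₗ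
      LinearMap.inr ℝ E' h.complement) (h.equiv.injective.comp (Prod.mk_right_injective 0))
  set φ := h.domChart
  set ψ := h.codChart
  set d := Module.finrank ℝ h.complement
  -- A basis of the complement in the local form of the immersion turns the model space into E' ×
  -- ℝ^d, in which the submanifold is the zero slice.
  let T : E ≃L[ℝ] E' × (Fin d → ℝ) := h.equiv.symm.trans
    ((ContinuousLinearEquiv.refl ℝ E').prodCongr (Module.finBasis ℝ h.complement).equivFunL)
  have hψ := contMDiffOn_of_mem_maximalAtlas h.codChart_mem_maximalAtlas
  have hψ' := contMDiffOn_symm_of_mem_maximalAtlas h.codChart_mem_maximalAtlas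
  -- The topology of `N` is induced by ι, so `U₁` can be chosen to meet `N` only in the chart
  -- domain; no other sheet of the submanifold enters.
  obtain ⟨U₁, hU₁, hU₁φ⟩ := hι.isEmbedding.isInducing.isOpen_iff.1 φ.open_source
  have hw : ∀ q ∈ φ.source, T (ψ (ι q)) = (φ q, 0) := fun q hq => by
    have hm : φ q ∈ (φ.extend 𝓘(ℝ, E')).target := by simpa using φ.map_source hq
    have h₁ := h.writtenInCharts hm
    have h₂ : ψ (ι q) = h.equiv (φ q, 0) := by
      have h₂ : ψ (ι (φ.symm (φ q))) = h.equiv (φ q, 0) := by simpa using h₁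
      rwa [φ.left_inv hq] at h₂
    rw [h₂]
    simp [T]
  have hTψ : ContinuousOn (fun x => (T (ψ x)).1) ψ.source := by
    have := ψ.continuousOn
    fun_prop
  have hUo : IsOpen (ψ.source ∩ (fun x => (T (ψ x)).1) ⁻¹' φ.target) :=
    hTψ.isOpen_inter_preimage ψ.open_source φ.open_target
  have hq₀ : q₀ ∈ φ.source := h.mem_domChart_source
  refine ⟨U₁ ∩ (ψ.source ∩ (fun x => (T (ψ x)).1) ⁻¹' φ.target), ⟨?_, ?_, ?_⟩, _, d, _,
    normalCoords_of_chart (φ := φ) (Ψ := fun x => T (ψ x)) (Θ := fun p => ψ.symm (T.symm p))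
      (hU₁.inter hUo) hι.contMDiff
      (contMDiffOn_symm_of_mem_maximalAtlas h.domChart_mem_maximalAtlas)
      (fun q hq => ?_) (fun x hx => hx.2.2) ?_ (fun x hx => ?_) (fun x hx => ?_) (fun x hx => ?_)
      (fun q hq => hw q ?_)⟩
  · exact Set.ext_iff.1 hU₁φ q₀ |>.2 hq₀
  · exact h.mem_codChart_source
  · rw [Set.mem_preimage, hw q₀ hq₀]
    exact φ.map_source hq₀
  · exact Set.ext_iff.1 hU₁φ q |>.1 hq.1
  · exact T.contDiff.contMDiff.comp_contMDiffOn (hψ.mono fun x hx => hx.2.1)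
  · have h₁ : ∀ᶠ p in 𝓝 (T (ψ x)), T.symm p ∈ ψ.target :=
      T.symm.continuous.continuousAt.eventually (by
        rw [T.symm_apply_apply]
        exact ψ.open_target.mem_nhds (ψ.map_source hx.2.1))
    filter_upwards [h₁] with p hp
    exact (hψ'.contMDiffAt (ψ.open_target.mem_nhds hp)).comp p T.symm.contDiff.contMDiff.contMDiffAt
  · simp [ψ.left_inv hx.2.1]
  · have h₁ : ∀ᶠ p in 𝓝 (T (ψ x)), T.symm p ∈ ψ.target :=
      T.symm.continuous.continuousAt.eventually (by
        rw [T.symm_apply_apply]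
        exact ψ.open_target.mem_nhds (ψ.map_source hx.2.1))
    filter_upwards [h₁] with p hp
    simp [ψ.right_inv hp]
  · exact Set.ext_iff.1 hU₁φ q |>.1 hq.1

end NormalCoordinates

/-! ### Change of normal frame and coordinates adapted to F. -/

section AdaptedCoordinates

variable {E : Type*} [NormedAddCommGroup E] [NormedSpace ℝ E]
  {E' : Type*} [NormedAddCommGroup E'] [NormedSpace ℝ E']
  {M : Type*} [TopologicalSpace M] [ChartedSpace E M]
  {N : Type*} [TopologicalSpace N] [ChartedSpace E' N]
  {ι : N → M}

/-- The coordinates obtained from `t` by the change of frame `L`. -/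
def changeCoords {κ κ' : Type*} [Fintype κ] [Fintype κ'] (π : M → N) (t : κ → M → ℝ)
    (L : N → (κ' → ℝ) →L[ℝ] (κ → ℝ)) (c : κ') (x : M) : ℝ :=
  (L (π x)).inverse (fun a => t a x) c

section Change

variable {κ κ' : Type*} [Fintype κ] [Fintype κ'] {U V : Set M} {π : M → N} {t : κ → M → ℝ}
  {L : N → (κ' → ℝ) →L[ℝ] (κ → ℝ)}

omit [TopologicalSpace M] [TopologicalSpace N] in
theorem apply_changeCoords {x : M} (h : L (π x) ∈ Set.range
      (ContinuousLinearEquiv.toContinuousLinearMap : ((κ' → ℝ) ≃L[ℝ] (κ → ℝ)) → _)) :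
    L (π x) (fun c => changeCoords π t L c x) = fun a => t a x := by
  obtain ⟨e, he⟩ := h
  simp only [changeCoords, ← he, ContinuousLinearMap.inverse_equiv]
  exact e.apply_symm_apply _

/-- Inversion is smooth at invertible operators, so x ↦ L(π x)⁻¹ is smooth. -/
theorem NormalCoords.contMDiffOn_changeCoords (h : NormalCoords E E' ι U π t) (hVU : V ⊆ U)
    (hL : ContMDiffOn 𝓘(ℝ, E) 𝓘(ℝ, (κ' → ℝ) →L[ℝ] (κ → ℝ)) ∞ (fun x => L (π x)) V)
    (hinv : ∀ x ∈ V, L (π x) ∈ Set.range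
      (ContinuousLinearEquiv.toContinuousLinearMap : ((κ' → ℝ) ≃L[ℝ] (κ → ℝ)) → _)) (c : κ') :
    ContMDiffOn 𝓘(ℝ, E) 𝓘(ℝ) ∞ (changeCoords π t L c) V := by
  have h₁ : ContMDiffOn 𝓘(ℝ, E) 𝓘(ℝ, (κ → ℝ) →L[ℝ] (κ' → ℝ)) ∞
      (fun x => (L (π x)).inverse) V := fun x hx => by
    obtain ⟨e, he⟩ := hinv x hx
    have h₂ := contDiffAt_map_inverse (n := ∞) e
    rw [he] at h₂
    exact h₂.contMDiffAt.comp_contMDiffWithinAt x (hL x hx)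
  have h₂ : ContMDiffOn 𝓘(ℝ, E) 𝓘(ℝ, κ → ℝ) ∞ (fun x => fun a => t a x) V :=
    contMDiffOn_pi_space.2 fun a => (h.contMDiffOn_coord a).mono hVU
  exact contMDiffOn_pi_space.1 (h₁.clm_apply h₂) c

omit [TopologicalSpace M] [TopologicalSpace N] in
theorem coord_eq_sum_changeCoords (hinv : ∀ x ∈ V, L (π x) ∈ Set.range
      (ContinuousLinearEquiv.toContinuousLinearMap : ((κ' → ℝ) ≃L[ℝ] (κ → ℝ)) → _))
    [DecidableEq κ'] {x : M} (hx : x ∈ V) (a : κ) :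
    t a x = ∑ c, L (π x) (Pi.single c 1) a * changeCoords π t L c x := by
  have h₁ := congrFun (apply_changeCoords (t := t) (hinv x hx)) a
  rw [← h₁]
  conv_lhs => rw [pi_eq_sum_univ' (fun c => changeCoords π t L c x), map_sum]
  simp [Finset.sum_apply, mul_comm]

/-- Differentiate t = L(π x) w. The new coordinates w vanish on `N`, so the terms containing the
derivative of L drop out. -/
theorem NormalCoords.dAt_changeCoords (h : NormalCoords E E' ι U π t) (hV : IsOpen V) (hVU : V ⊆ U)
    (hL : ContMDiffOn 𝓘(ℝ, E) 𝓘(ℝ, (κ' → ℝ) →L[ℝ] (κ → ℝ)) ∞ (fun x => L (π x)) V)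
    (hinv : ∀ x ∈ V, L (π x) ∈ Set.range
      (ContinuousLinearEquiv.toContinuousLinearMap : ((κ' → ℝ) ≃L[ℝ] (κ → ℝ)) → _))
    {q : N} (hq : ι q ∈ V) (u : TangentSpace 𝓘(ℝ, E) (ι q)) :
    L q (fun c => dAt (ι q) (changeCoords π t L c) u) = fun a => dAt (ι q) (t a) u := by
  classical
  have hw : ∀ c, SmoothNear E (ι q) (changeCoords π t L c) := fun c =>
    smoothNear_of_contMDiffOn hV (h.contMDiffOn_changeCoords hVU hL hinv c) hq
  have hℓ : ∀ a c, SmoothNear E (ι q) (fun x => L (π x) (Pi.single c 1) a) := fun a c =>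
    smoothNear_of_contMDiffOn hV
      (contMDiffOn_pi_space.1 (hL.clm_apply contMDiffOn_const) a) hq
  have hw0 : ∀ c, changeCoords π t L c (ι q) = 0 := fun c => by
    have : (fun a => t a (ι q)) = 0 := funext fun a => h.coord_eq_zero q (hVU hq) a
    rw [changeCoords, this, map_zero, Pi.zero_apply]
  funext a
  have h₁ : t a =ᶠ[𝓝 (ι q)]
      ∑ c, (fun x => L (π x) (Pi.single c 1) a) * changeCoords π t L c := by
    filter_upwards [hV.mem_nhds hq] with x hx
    rw [coord_eq_sum_changeCoords (t := t) hinv hx]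
    simp
  rw [dAt_sum_mul (hℓ a) hw hw0 h₁, h.proj_apply q (hVU hq)]
  conv_lhs => rw [pi_eq_sum_univ' (fun c => dAt (ι q) (changeCoords π t L c) u), map_sum]
  simp [Finset.sum_apply, mul_comm]

/-- Normal coordinates stay normal coordinates after a smooth change of frame. -/
theorem NormalCoords.change (h : NormalCoords E E' ι U π t) (hV : IsOpen V) (hVU : V ⊆ U)
    (hL : ContMDiffOn 𝓘(ℝ, E) 𝓘(ℝ, (κ' → ℝ) →L[ℝ] (κ → ℝ)) ∞ (fun x => L (π x)) V)
    (hinv : ∀ x ∈ V, L (π x) ∈ Set.range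
      (ContinuousLinearEquiv.toContinuousLinearMap : ((κ' → ℝ) ≃L[ℝ] (κ → ℝ)) → _)) :
    NormalCoords E E' ι V π (changeCoords π t L) where
  isOpen := hV
  contMDiffOn_proj := h.contMDiffOn_proj.mono hVU
  proj_apply q hq := h.proj_apply q (hVU hq)
  contMDiffOn_coord := h.contMDiffOn_changeCoords hVU hL hinv
  coord_eq_zero q hq c := by
    have : (fun a => t a (ι q)) = 0 := funext fun a => h.coord_eq_zero q (hVU hq) a
    rw [changeCoords, this, map_zero, Pi.zero_apply]
  hadamard q hq f hf h0 := by
    classical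
    obtain ⟨g, hg, he⟩ := h.hadamard q (hVU hq) f hf h0
    refine ⟨fun c => ∑ a, g a * fun x => L (π x) (Pi.single c 1) a, fun c =>
      SmoothNear.sum _ fun a _ => (hg a).mul (smoothNear_of_contMDiffOn hV
        (contMDiffOn_pi_space.1 (hL.clm_apply contMDiffOn_const) a) hq), ?_⟩
    filter_upwards [he, hV.mem_nhds hq] with x hx hxV
    rw [hx]
    simp only [Finset.sum_apply, Pi.mul_apply, Finset.sum_mul]
    rw [Finset.sum_comm]
    refine Finset.sum_congr rfl fun a _ => ?_
    rw [coord_eq_sum_changeCoords (t := t) hinv hxV a, Finset.mul_sum]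
    exact Finset.sum_congr rfl fun c _ => by ring
  slice q hq v := by
    -- Since π is constant along the curve, so is L(π x); the curve with old coordinates s·L(q)v
    -- thus has new coordinates s·v.
    obtain ⟨γ, hγ, h0, he⟩ := h.slice q (hVU hq) (L q v)
    refine ⟨γ, hγ, h0, ?_⟩
    filter_upwards [he] with s hs
    refine ⟨hs.1, fun c => ?_⟩
    obtain ⟨e, hLe⟩ := hinv (ι q) hq
    rw [h.proj_apply q (hVU hq)] at hLe
    have h₁ : (fun a => t a (γ s)) = e (s • v) := funext fun a => by
      rw [hs.2 a, ← hLe, map_smul]; rfl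
    rw [changeCoords, hs.1, h₁, ← hLe, ContinuousLinearMap.inverse_equiv]
    exact congrFun (e.symm_apply_apply (s • v)) c
  surjective q hq v := by
    obtain ⟨u, hu⟩ := h.surjective q (hVU hq) (L q v)
    obtain ⟨e, hLe⟩ := hinv (ι q) hq
    rw [h.proj_apply q (hVU hq)] at hLe
    refine ⟨u, congrFun (e.injective ?_)⟩
    have h₁ := h.dAt_changeCoords hV hVU hL hinv hq u
    rw [funext hu, ← hLe] at h₁
    exact h₁
  ker q hq u hu := by
    refine h.ker q (hVU hq) u (congrFun ?_)
    rw [← h.dAt_changeCoords hV hVU hL hinv hq u, funext hu]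
    exact map_zero _

end Change

variable [IsManifold 𝓘(ℝ, E) ∞ M]

/-- Normal coordinates `(y, z)` adapted to a family of subspaces `F` of the normal bundle: `F` is
the common kernel of the `dz`, and the `dy` are dual to the smooth frame `e` of `F`. -/
structure AdaptedCoords (F : ∀ q, Submodule ℝ (NormalSpace E E' ι q)) (U : Set M) (π : M → N)
    {r : ℕ} {σ : Type*} [Fintype σ] (y : Fin r → M → ℝ) (z : σ → M → ℝ)
    (e : Fin r → ∀ q, F q) : Prop where
  coords : NormalCoords E E' ι U π (Sum.elim y z)
  mem_iff : ∀ q, ι q ∈ U → ∀ v : TangentSpace 𝓘(ℝ, E) (ι q),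
    normalClass E E' ι q v ∈ F q ↔ ∀ j, dAt (ι q) (z j) v = 0
  smooth_frame : ∀ i, subSmooth F (ι ⁻¹' U) (e i)
  dual : ∀ q, ι q ∈ U → ∀ i (v : TangentSpace 𝓘(ℝ, E) (ι q)),
    normalClass E E' ι q v = e i q → ∀ j, dAt (ι q) (y j) v = if j = i then 1 else 0

theorem normalSmooth.mono {W₁ W₂ : Set N} (h : W₁ ⊆ W₂) (hW : IsOpen W₁)
    {s : ∀ q, NormalSpace E E' ι q} (hs : normalSmooth E E' ι W₂ s) :
    normalSmooth E E' ι W₁ s := by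
  intro q hq
  obtain ⟨W', hW', hqW', hW'W, σ, hσ, he⟩ := hs q (h hq)
  exact ⟨W' ∩ W₁, hW'.inter hW, ⟨hqW', hq⟩, Set.inter_subset_right, σ,
    hσ.mono Set.inter_subset_left, fun q' hq' => he q' hq'.1⟩

/-- A tangent vector representing a normal vector. -/
def liftNormal {q : N} (n : NormalSpace E E' ι q) : TangentSpace 𝓘(ℝ, E) (ι q) :=
  Function.surjInv (Submodule.mkQ_surjective _) n

omit [IsManifold 𝓘(ℝ, E) ∞ M] in
@[simp]
theorem normalClass_liftNormal {q : N} (n : NormalSpace E E' ι q) :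
    normalClass E E' ι q (liftNormal n) = n :=
  Function.surjInv_eq (Submodule.mkQ_surjective _) n

omit [IsManifold 𝓘(ℝ, E) ∞ M] in
theorem dAt_eq_of_normalClass_eq {q : N} {f : M → ℝ}
    (hι : MDifferentiableAt 𝓘(ℝ, E') 𝓘(ℝ, E) ι q) (hf : SmoothNear E (ι q) f)
    (h0 : ∀ᶠ q' in 𝓝 q, f (ι q') = 0) {v v' : TangentSpace 𝓘(ℝ, E) (ι q)}
    (h : normalClass E E' ι q v = normalClass E E' ι q v') : dAt (ι q) f v = dAt (ι q) f v' := by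
  rw [← sub_eq_zero, ← map_sub]
  exact dAt_eq_zero_of_mem_range hι hf h0 ((Submodule.Quotient.eq _).1 h)

/-- The chosen lift `liftNormal` need not vary smoothly, but df depends only on the normal class, so
a smooth local lift may be substituted. -/
theorem contMDiffOn_dAt_lift (hι : ContMDiff 𝓘(ℝ, E') 𝓘(ℝ, E) ∞ ι) {W : Set N} (hW : IsOpen W)
    {f : M → ℝ} (hf : ∀ q ∈ W, SmoothNear E (ι q) f) (h0 : ∀ q ∈ W, f (ι q) = 0)
    {s : ∀ q, NormalSpace E E' ι q} (hs : normalSmooth E E' ι W s) :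
    ContMDiffOn 𝓘(ℝ, E') 𝓘(ℝ) ∞ (fun q => dAt (ι q) f (liftNormal (s q))) W := by
  intro q hq
  obtain ⟨W', hW', hqW', hW'W, σ, hσ, he⟩ := hs q hq
  have h₁ := contMDiffOn_dAt (fun q hq => hf q (hW'W hq)) hσ
  refine ContMDiffAt.contMDiffWithinAt ((h₁.contMDiffAt
    (hW'.mem_nhds hqW')).congr_of_eventuallyEq ?_)
  filter_upwards [hW'.mem_nhds hqW'] with q' hq'
  refine dAt_eq_of_normalClass_eq (hι.mdifferentiable (by simp) q') (hf q' (hW'W hq')) ?_ ?_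
  · filter_upwards [hW.mem_nhds (hW'W hq')] with q'' hq'' using h0 q'' hq''
  · rw [normalClass_liftNormal, he q' hq']

/-- The linear map `c ↦ ∑ cᵢ vᵢ`, depending continuously and linearly on the vectors `vᵢ`. -/
def frameMap (κ : Type*) [Fintype κ] (d : ℕ) :
    (κ → Fin d → ℝ) →L[ℝ] (κ → ℝ) →L[ℝ] (Fin d → ℝ) :=
  LinearMap.toContinuousLinearMap
    ((LinearMap.toContinuousLinearMap :
      ((κ → ℝ) →ₗ[ℝ] (Fin d → ℝ)) ≃ₗ[ℝ] _).toLinearMap ∘ₗ Fintype.bilinearCombination ℝ ℝ)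

theorem frameMap_apply {κ : Type*} [Fintype κ] {d : ℕ} (v : κ → Fin d → ℝ) (c : κ → ℝ) :
    frameMap κ d v c = ∑ i, c i • v i := rfl

theorem exists_basis_extending {κ : Type*} [Fintype κ] {d : ℕ} {v : κ → Fin d → ℝ}
    (hv : LinearIndependent ℝ v) :
    ∃ (σ : Type) (_ : Fintype σ) (b : Module.Basis (κ ⊕ σ) ℝ (Fin d → ℝ)),
      ∀ i, b (Sum.inl i) = v i := by
  have : Fintype (κ ⊕ Module.Basis.sumExtendIndex hv) :=
    FiniteDimensional.fintypeBasisIndex (Module.Basis.sumExtend hv)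
  have : Finite (Module.Basis.sumExtendIndex hv) :=
    Finite.of_injective (Sum.inr : _ → κ ⊕ Module.Basis.sumExtendIndex hv) Sum.inr_injective
  exact ⟨Module.Basis.sumExtendIndex hv, Fintype.ofFinite _, Module.Basis.sumExtend hv, fun i => by
    simp only [Module.Basis.sumExtend, Module.Basis.coe_reindex, Module.Basis.coe_extend,
      Function.comp_apply]
    let := Classical.decPred (· ∈ Set.range v)
    exact congrArg Subtype.val (Equiv.Set.sumDiffSubset_apply_inl
      (hv.linearIndepOn_id.subset_extend (Set.subset_univ _)) _)⟩

/-- Near every point there are normal coordinates adapted to a smooth subbundle of the normal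
bundle. -/
theorem exists_adaptedCoords [FiniteDimensional ℝ E] [FiniteDimensional ℝ E']
    (hι : Manifold.IsSmoothEmbedding 𝓘(ℝ, E') 𝓘(ℝ, E) ∞ ι)
    {F : ∀ q, Submodule ℝ (NormalSpace E E' ι q)} (hF : IsSubbundle F) (q₀ : N) :
    ∃ (U : Set M) (_ : ι q₀ ∈ U) (π : M → N) (r : ℕ) (σ : Type) (_ : Fintype σ)
      (y : Fin r → M → ℝ) (z : σ → M → ℝ) (e : Fin r → ∀ q, F q), AdaptedCoords F U π y z e := by
  obtain ⟨U, hq₀U, π, d, t, ht⟩ := exists_normalCoords hι q₀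
  obtain ⟨W, hW, hq₀W, r, e, he, hframe⟩ := hF q₀
  have hιd : ∀ q, MDifferentiableAt 𝓘(ℝ, E') 𝓘(ℝ, E) ι q := hι.contMDiff.mdifferentiable (by simp)
  have hιU : IsOpen (ι ⁻¹' U) := ht.isOpen.preimage hι.contMDiff.continuous
  have hts : ∀ a q, ι q ∈ U → SmoothNear E (ι q) (t a) := fun a q hq =>
    smoothNear_of_contMDiffOn ht.isOpen (ht.contMDiffOn_coord a) hq
  have ht0 : ∀ a q, ι q ∈ U → ∀ᶠ q' in 𝓝 q, t a (ι q') = 0 := fun a q hq => by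
    filter_upwards [hιU.mem_nhds hq] with q' hq' using ht.coord_eq_zero q' hq' a
  -- The column of the frame vector e_i in the coordinates t.
  let col : Fin r → N → Fin d → ℝ := fun i q a =>
    dAt (ι q) (t a) (liftNormal (e i q : NormalSpace E E' ι q))
  have hcol : ∀ q, ι q ∈ U → ∀ c : Fin r → ℝ, ∀ v : TangentSpace 𝓘(ℝ, E) (ι q),
      normalClass E E' ι q v = ∑ i, c i • (e i q : NormalSpace E E' ι q) →
      (fun a => dAt (ι q) (t a) v) = ∑ i, c i • col i q := by
    intro q hq c v hv
    funext a
    have h₁ : normalClass E E' ι q v = normalClass E E' ι q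
        (∑ i, c i • liftNormal (e i q : NormalSpace E E' ι q)) := by
      rw [hv]
      refine Eq.trans ?_ (map_sum (Submodule.mkQ _) _ _).symm
      refine Finset.sum_congr rfl fun i _ => ?_
      exact congrArg (c i • ·) (normalClass_liftNormal _).symm
    rw [dAt_eq_of_normalClass_eq (hιd q) (hts a q hq) (ht0 a q hq) h₁, map_sum]
    simp [col]
  have hker : ∀ q, ι q ∈ U → ∀ c : Fin r → ℝ, ∀ v : TangentSpace 𝓘(ℝ, E) (ι q),
      (fun a => dAt (ι q) (t a) v) = ∑ i, c i • col i q →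
      normalClass E E' ι q v = ∑ i, c i • (e i q : NormalSpace E E' ι q) := by
    intro q hq c v hv
    have h₁ : (∑ i, c i • (e i q : NormalSpace E E' ι q)) =
        normalClass E E' ι q (liftNormal (∑ i, c i • (e i q : NormalSpace E E' ι q))) :=
      (normalClass_liftNormal _).symm
    rw [h₁]
    refine (Submodule.Quotient.eq _).2 (ht.ker q hq _ fun a => ?_)
    rw [map_sub, sub_eq_zero, congrFun hv a]
    exact (congrFun (hcol q hq c _ (normalClass_liftNormal _)) a).symm
  have hindep : LinearIndependent ℝ (fun i => col i q₀) := by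
    rw [Fintype.linearIndependent_iff]
    intro c hc
    have h₁ := hker q₀ hq₀U c 0 (by
      rw [hc]; funext a; exact map_zero _)
    refine Fintype.linearIndependent_iff.1 (hframe q₀ hq₀W).1 c (Subtype.ext ?_)
    rw [Submodule.coe_sum]
    exact h₁.symm
  obtain ⟨σ, _, b, hb⟩ := exists_basis_extending hindep
  -- The columns at `q₀` are completed to a basis, and the added basis vectors are kept constant in
  -- q. The first block then varies smoothly with F and the whole matrix is invertible at `q₀`.
  let vec : N → Fin r ⊕ σ → Fin d → ℝ := fun q =>
    Sum.elim (fun i => col i q) (fun j => b (Sum.inr j))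
  let L : N → ((Fin r ⊕ σ) → ℝ) →L[ℝ] (Fin d → ℝ) := fun q => frameMap (Fin r ⊕ σ) d (vec q)
  have hLe : ∀ q (c : Fin r ⊕ σ → ℝ), (∀ j, c (Sum.inr j) = 0) →
      L q c = ∑ i, c (Sum.inl i) • col i q := fun q c hc => by
    simp only [L, frameMap_apply, Fintype.sum_sum_type, vec, Sum.elim_inl, Sum.elim_inr, hc,
      zero_smul, Finset.sum_const_zero, add_zero]
  have hvec : ContMDiffOn 𝓘(ℝ, E') 𝓘(ℝ, Fin r ⊕ σ → Fin d → ℝ) ∞ vec (W ∩ ι ⁻¹' U) := by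
    refine contMDiffOn_pi_space.2 fun k => contMDiffOn_pi_space.2 fun a => ?_
    cases k with
    | inl i =>
      exact contMDiffOn_dAt_lift hι.contMDiff (hW.inter hιU) (fun q hq => hts a q hq.2)
        (fun q hq => ht.coord_eq_zero q hq.2 a)
        (normalSmooth.mono Set.inter_subset_left (hW.inter hιU) (he i))
    | inr j => exact contMDiffOn_const
  have hL : ContMDiffOn 𝓘(ℝ, E') 𝓘(ℝ, ((Fin r ⊕ σ) → ℝ) →L[ℝ] (Fin d → ℝ)) ∞ L
      (W ∩ ι ⁻¹' U) :=
    (frameMap (Fin r ⊕ σ) d).contMDiff.comp_contMDiffOn hvec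
  have hL₀ : L q₀ ∈ Set.range (ContinuousLinearEquiv.toContinuousLinearMap :
      ((Fin r ⊕ σ → ℝ) ≃L[ℝ] (Fin d → ℝ)) → _) := by
    refine ⟨b.equivFun.symm.toContinuousLinearEquiv, ?_⟩
    refine ContinuousLinearMap.ext fun c => ?_
    have h₁ : vec q₀ = b := funext fun k => by
      cases k with
      | inl i => exact (hb i).symm
      | inr j => rfl
    simp only [L, frameMap_apply, h₁]
    exact b.equivFun_symm_apply c
  set R := Set.range (ContinuousLinearEquiv.toContinuousLinearMap :
      ((Fin r ⊕ σ → ℝ) ≃L[ℝ] (Fin d → ℝ)) → _) with hR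
  -- Invertible operators form an open set, so the matrix stays invertible near `q₀`. The
  -- coordinates are then restricted to the π-preimage of this set, where L(π x) is defined through
  -- `N`.
  have hW₁ : IsOpen ((W ∩ ι ⁻¹' U) ∩ L ⁻¹' R) :=
    hL.continuousOn.isOpen_inter_preimage (hW.inter hιU) ContinuousLinearEquiv.isOpen
  set W₁ := (W ∩ ι ⁻¹' U) ∩ L ⁻¹' R with hW₁def
  have hV : IsOpen (U ∩ π ⁻¹' W₁) :=
    ht.contMDiffOn_proj.continuousOn.isOpen_inter_preimage ht.isOpen hW₁
  have hιW₁ : ∀ q, ι q ∈ U ∩ π ⁻¹' W₁ → q ∈ W₁ := fun q hq => by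
    have := hq.2
    rwa [Set.mem_preimage, ht.proj_apply q hq.1] at this
  have hLπ : ContMDiffOn 𝓘(ℝ, E) 𝓘(ℝ, ((Fin r ⊕ σ) → ℝ) →L[ℝ] (Fin d → ℝ)) ∞
      (fun x => L (π x)) (U ∩ π ⁻¹' W₁) :=
    hL.comp (ht.contMDiffOn_proj.mono Set.inter_subset_left) fun x hx => hx.2.1
  have hinv : ∀ x ∈ U ∩ π ⁻¹' W₁, L (π x) ∈ R := fun x hx => hx.2.2
  have hd : ∀ q, ι q ∈ U ∩ π ⁻¹' W₁ → ∀ v : TangentSpace 𝓘(ℝ, E) (ι q),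
      L q (fun k => dAt (ι q) (changeCoords π t L k) v) = fun a => dAt (ι q) (t a) v :=
    fun q hq v => ht.dAt_changeCoords hV Set.inter_subset_left hLπ hinv hq v
  have hLinj : ∀ q, ι q ∈ U ∩ π ⁻¹' W₁ → Function.Injective (L q) := fun q hq => by
    obtain ⟨e, he⟩ := (hιW₁ q hq).2
    rw [← he]
    exact e.injective
  have hdF : ∀ q (hq : ι q ∈ U ∩ π ⁻¹' W₁) (c : Fin r → ℝ) (v : TangentSpace 𝓘(ℝ, E) (ι q)),
      normalClass E E' ι q v = ∑ i, c i • (e i q : NormalSpace E E' ι q) →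
      (fun k => dAt (ι q) (changeCoords π t L k) v) = Sum.elim c 0 := fun q hq c v hv => by
    refine hLinj q hq ?_
    rw [hd q hq, hcol q hq.1 c v hv, hLe q _ fun j => rfl]
    rfl
  refine ⟨U ∩ π ⁻¹' W₁, ⟨hq₀U, ?_⟩, π, r, σ, inferInstance,
    fun i => changeCoords π t L (Sum.inl i), fun j => changeCoords π t L (Sum.inr j), e,
    ?_, fun q hq v => ⟨fun hv => ?_, fun hv => ?_⟩, fun i => ?_, fun q hq i v hv j => ?_⟩
  · rw [Set.mem_preimage, ht.proj_apply q₀ hq₀U]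
    exact ⟨⟨hq₀W, hq₀U⟩, hL₀⟩
  · have h₁ : Sum.elim (fun i => changeCoords π t L (Sum.inl i))
        (fun j => changeCoords π t L (Sum.inr j)) = changeCoords π t L :=
      Sum.elim_comp_inl_inr (changeCoords π t L)
    rw [h₁]
    exact ht.change hV Set.inter_subset_left hLπ hinv
  · have h₁ : (⟨_, hv⟩ : F q) ∈ Submodule.span ℝ (Set.range fun j => e j q) := by
      rw [(hframe q (hιW₁ q hq).1.1).2]; trivial
    obtain ⟨c, hc⟩ := (Submodule.mem_span_range_iff_exists_fun ℝ).1 h₁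
    have h₂ := congrArg Subtype.val hc
    rw [Submodule.coe_sum] at h₂
    exact fun j => congrFun (hdF q hq c v h₂.symm) (Sum.inr j)
  · have h₁ := hd q hq v
    rw [hLe q _ hv] at h₁
    rw [hker q hq.1 _ v h₁.symm]
    exact Submodule.sum_mem _ fun i _ => Submodule.smul_mem _ _ (e i q).2
  · exact normalSmooth.mono (fun q hq => (hιW₁ q hq).1.1)
      (hV.preimage hι.contMDiff.continuous) (he i)
  · classical
    have h₁ := hdF q hq (Pi.single i 1) v (by
      rw [hv, Finset.sum_eq_single i (fun k _ hk => by rw [Pi.single_eq_of_ne hk, zero_smul])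
        (by simp), Pi.single_eq_same, one_smul])
    have h₂ := congrFun h₁ (Sum.inl j)
    rw [Sum.elim_inl, Pi.single_apply] at h₂
    exact h₂

end AdaptedCoordinates

/-! ### The weighted filtration in low degree and local generators. -/

section Filtration

variable {E : Type*} [NormedAddCommGroup E] [NormedSpace ℝ E]
  {E' : Type*} [NormedAddCommGroup E'] [NormedSpace ℝ E']
  {M : Type*} [TopologicalSpace M] [ChartedSpace E M]
  {N : Type*} [TopologicalSpace N] [ChartedSpace E' N]
  {ι : N → M} {F : ∀ q, Submodule ℝ (NormalSpace E E' ι q)} {q : N}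

/-- The ideal is defined through a comap filter on `N` and some representative. For an inducing ι
that filter is the neighbourhood filter of q, and any representative will do. -/
theorem germ_mem_idealI (hι : Topology.IsInducing ι) {f : M → ℝ} {hf : SmoothNear E (ι q) f} :
    germ f hf ∈ idealI E ι q ↔ ∀ᶠ q' in 𝓝 q, f (ι q') = 0 := by
  constructor
  · rintro ⟨g, hg, h, h0⟩
    rw [← hι.nhds_eq_comap] at h0
    filter_upwards [h0, hι.continuous.continuousAt.eventually (germ_eq_germ.1 h)] with q' h₁ h₂
    exact h₂.trans h₁
  · exact fun h => ⟨f, hf, rfl, by rwa [← hι.nhds_eq_comap]⟩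

theorem germ_mem_idealJ (hι : Topology.IsInducing ι) {f : M → ℝ} {hf : SmoothNear E (ι q) f} :
    germ f hf ∈ idealJ F q ↔ ∀ᶠ q' in 𝓝 q, f (ι q') = 0 ∧
      ∀ v : TangentSpace 𝓘(ℝ, E) (ι q'), normalClass E E' ι q' v ∈ F q' →
        dAt (ι q') f v = 0 := by
  constructor
  · rintro ⟨g, hg, h, h0⟩
    rw [← hι.nhds_eq_comap] at h0
    filter_upwards [h0, hι.continuous.continuousAt.eventually
      (germ_eq_germ.1 h).eventuallyEq_nhds] with q' h₁ h₂
    refine ⟨h₂.self_of_nhds.trans h₁.1, fun v hv => ?_⟩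
    rw [dAt_congr h₂]
    exact h₁.2 v hv
  · intro h
    refine ⟨f, hf, rfl, ?_⟩
    rw [← hι.nhds_eq_comap]
    exact h

theorem idealJ_le_idealI (hι : Topology.IsInducing ι) : idealJ F q ≤ idealI E ι q := by
  intro a ha
  obtain ⟨f, hf, rfl⟩ := germ_surjective a
  exact (germ_mem_idealI hι).2 (((germ_mem_idealJ hι).1 ha).mono fun _ h => h.1)

/-- Leibniz: both factors vanish along `N`, hence so does the whole differential of the product
there. -/
theorem idealI_mul_idealI_le (hι : Topology.IsInducing ι) :
    idealI E ι q * idealI E ι q ≤ idealJ F q := by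
  refine Ideal.mul_le.2 fun a ha b hb => ?_
  obtain ⟨f, hf, rfl⟩ := germ_surjective a
  obtain ⟨g, hg, rfl⟩ := germ_surjective b
  rw [germ_mem_idealI hι] at ha hb
  refine (germ_mem_idealJ hι (hf := hf.mul hg)).2 ?_
  filter_upwards [ha, hb, hι.continuous.continuousAt.eventually hf.eventually,
    hι.continuous.continuousAt.eventually hg.eventually] with q' h₁ h₂ h₃ h₄
  refine ⟨by simp [h₁], fun v _ => ?_⟩
  rw [dAt_mul h₃ h₄, h₁, h₂, zero_smul, zero_smul, add_zero, LinearMap.zero_apply]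

theorem idealI_le_maxIdeal (hι : Topology.IsInducing ι) : idealI E ι q ≤ maxIdeal E (ι q) := by
  intro a ha
  obtain ⟨f, hf, rfl⟩ := germ_surjective a
  rw [mem_maxIdeal, evalGerm_germ]
  exact ((germ_mem_idealI hι).1 ha).self_of_nhds

theorem le_filt (F : ∀ q, Submodule ℝ (NormalSpace E E' ι q)) {k : ℕ} (a b : ℕ)
    (h : k ≤ a + 2 * b) : idealI E ι q ^ a * idealJ F q ^ b ≤ filt F k q :=
  le_iSup_of_le a (le_iSup_of_le b (le_iSup_of_le h le_rfl))

theorem filt_zero : filt F 0 q = ⊤ :=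
  top_le_iff.1 (le_trans (by simp) (le_filt F 0 0 (by simp)))

theorem filt_one (hι : Topology.IsInducing ι) : filt F 1 q = idealI E ι q := by
  refine le_antisymm (iSup_le fun a => iSup_le fun b => iSup_le fun h => ?_)
    (le_trans (by simp) (le_filt F 1 0 (by simp)))
  by_cases ha : a = 0
  · exact Ideal.mul_le_right.trans
      ((Ideal.pow_le_self (by omega)).trans (idealJ_le_idealI hι))
  · exact Ideal.mul_le_left.trans (Ideal.pow_le_self ha)

theorem filt_two (hι : Topology.IsInducing ι) : filt F 2 q = idealJ F q := by
  refine le_antisymm (iSup_le fun a => iSup_le fun b => iSup_le fun h => ?_)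
    (le_trans (by simp) (le_filt F 0 1 (by simp)))
  by_cases hb : b = 0
  · refine Ideal.mul_le_left.trans ((Ideal.pow_le_pow_right (by omega : 2 ≤ a)).trans ?_)
    rw [pow_two]
    exact idealI_mul_idealI_le hι
  · exact Ideal.mul_le_right.trans (Ideal.pow_le_self hb)

/-- With 𝓘² ⊂ 𝓙 ⊂ 𝓘 every generator is absorbed: if b = 0, then a ≥ 3 and 𝓘³ ⊂ 𝓘𝓙; if a = 0, then b
≥ 2 and 𝓙² ⊂ 𝓘𝓙; otherwise both factors occur. -/
theorem filt_three (hι : Topology.IsInducing ι) : filt F 3 q = idealI E ι q * idealJ F q := by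
  refine le_antisymm (iSup_le fun a => iSup_le fun b => iSup_le fun h => ?_)
    (le_trans (by simp) (le_filt F 1 1 (by simp)))
  by_cases hb : b = 0
  · refine Ideal.mul_le_left.trans ((Ideal.pow_le_pow_right (by omega : 3 ≤ a)).trans ?_)
    rw [pow_succ', pow_two]
    exact Ideal.mul_mono_right (idealI_mul_idealI_le hι)
  · by_cases ha : a = 0
    · refine Ideal.mul_le_right.trans ((Ideal.pow_le_pow_right (by omega : 2 ≤ b)).trans ?_)
      rw [pow_two]
      exact Ideal.mul_mono_left (idealJ_le_idealI hι)
    · exact Ideal.mul_mono (Ideal.pow_le_self ha) (Ideal.pow_le_self hb)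

/-- The germs at a point act on the fibres of the graded bundle through their value. -/
theorem germ_smul_grFibre {k : ℕ} (a : SmoothGerm E (ι q)) (ξ : GrFibre F k q) :
    a • ξ = evalGerm E (ι q) a • ξ := by
  obtain ⟨x, rfl⟩ := Submodule.mkQ_surjective _ ξ
  have h₁ : evalGerm E (ι q) a • (grKer F k q).mkQ x =
      algebraMap ℝ (SmoothGerm E (ι q)) (evalGerm E (ι q) a) • (grKer F k q).mkQ x :=
    (algebraMap_smul _ _ _).symm
  rw [h₁, ← sub_eq_zero, ← sub_smul, ← map_smul]
  refine (Submodule.Quotient.mk_eq_zero _).2 (Ideal.mem_sup_right (Ideal.mul_mem_mul ?_ x.2))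
  rw [mem_maxIdeal, map_sub, AlgHom.commutes, Algebra.algebraMap_self, RingHom.id_apply, sub_self]

/-- A germ relation modulo 𝒜_(k+1) becomes a real linear relation in the fibre, since germs act
there through their values. -/
theorem mkQ_eq_sum_smul {k : ℕ} {κ : Type*} [Fintype κ] {x : filt F k q} {u : κ → filt F k q}
    {a : κ → SmoothGerm E (ι q)} (h : x.1 - ∑ j, a j * (u j).1 ∈ filt F (k + 1) q) :
    (grKer F k q).mkQ x = ∑ j, evalGerm E (ι q) (a j) • (grKer F k q).mkQ (u j) := by
  simp only [← germ_smul_grFibre, ← map_smul, ← map_sum]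
  rw [← sub_eq_zero, ← map_sub]
  refine (Submodule.Quotient.mk_eq_zero _).2 (Ideal.mem_sup_left ?_)
  have h₁ : (filt F k q).subtype (x - ∑ j, a j • u j) = x.1 - ∑ j, a j * (u j).1 := by
    rw [map_sub, map_sum]
    rfl
  exact h₁ ▸ h

/-- Functions `uⱼ` whose classes form a basis of the fibres of `gr(𝒜)_k` along `U`. -/
structure LocalGenerators (F : ∀ q, Submodule ℝ (NormalSpace E E' ι q)) (k : ℕ) (U : Set M)
    {κ : Type*} [Fintype κ] (u : κ → M → ℝ) : Prop where
  smooth : ∀ j q, ι q ∈ U → SmoothNear E (ι q) (u j)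
  mem : ∀ j q (hq : ι q ∈ U), germ (u j) (smooth j q hq) ∈ filt F k q
  gen : ∀ q, ι q ∈ U → ∀ f (hf : SmoothNear E (ι q) f), germ f hf ∈ filt F k q →
    ∃ g : κ → M → ℝ, (∀ j, SmoothNear E (ι q) (g j)) ∧ ∀ᶠ q' in 𝓝 q,
      ∀ h : SmoothNear E (ι q') (f - ∑ j, g j * u j), germ _ h ∈ filt F (k + 1) q'
  indep : ∀ q, ι q ∈ U → ∀ (g : κ → M → ℝ), (∀ j, SmoothNear E (ι q) (g j)) →
    ∀ h : SmoothNear E (ι q) (∑ j, g j * u j), germ _ h ∈ filt F (k + 1) q → ∀ j, g j (ι q) = 0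

namespace LocalGenerators

variable {k : ℕ} {U : Set M} {κ : Type*} [Fintype κ] {u : κ → M → ℝ}

/-- The class of the `j`-th generator at points of `U` (and zero elsewhere). -/
def frame (h : LocalGenerators F k U u) (j : κ) (q : N) : GrFibre F k q :=
  open Classical in
  if hq : ι q ∈ U then grClass F k q (u j) (h.smooth j q hq) (h.mem j q hq) else 0

theorem frame_eq (h : LocalGenerators F k U u) (hq : ι q ∈ U) (j : κ) :
    h.frame j q = grClass F k q (u j) (h.smooth j q hq) (h.mem j q hq) :=
  dif_pos hq

theorem gen_germ (h : LocalGenerators F k U u) (hq : ι q ∈ U) {x : SmoothGerm E (ι q)}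
    (hx : x ∈ filt F k q) : ∃ a : κ → SmoothGerm E (ι q),
      x - ∑ j, a j * germ (u j) (h.smooth j q hq) ∈ filt F (k + 1) q := by
  obtain ⟨f, hf, rfl⟩ := germ_surjective x
  obtain ⟨g, hg, he⟩ := h.gen q hq f hf hx
  refine ⟨fun j => germ (g j) (hg j), ?_⟩
  rw [← germ_sum_mul hg fun j => h.smooth j q hq]
  exact he.self_of_nhds (hf.sub (SmoothNear.sum _ fun j _ => (hg j).mul (h.smooth j q hq)))

theorem indep_germ (h : LocalGenerators F k U u) (hq : ι q ∈ U) {a : κ → SmoothGerm E (ι q)}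
    (ha : ∑ j, a j * germ (u j) (h.smooth j q hq) ∈ filt F (k + 1) q) (j : κ) :
    evalGerm E (ι q) (a j) = 0 := by
  choose g hg he using fun j => germ_surjective (a j)
  obtain rfl : (fun j => germ (g j) (hg j)) = a := funext he
  rw [← germ_sum_mul hg fun j => h.smooth j q hq] at ha
  rw [evalGerm_germ]
  exact h.indep q hq g hg _ ha j

theorem grClass_eq_sum (h : LocalGenerators F k U u) (hq : ι q ∈ U) {f : M → ℝ}
    (hf : SmoothNear E (ι q) f) (hk : germ f hf ∈ filt F k q) {g : κ → M → ℝ}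
    (hg : ∀ j, SmoothNear E (ι q) (g j))
    (hr : ∀ h : SmoothNear E (ι q) (f - ∑ j, g j * u j), germ _ h ∈ filt F (k + 1) q) :
    grClass F k q f hf hk = ∑ j, g j (ι q) • h.frame j q := by
  have h₁ := mkQ_eq_sum_smul (x := ⟨germ f hf, hk⟩)
    (u := fun j => ⟨germ (u j) (h.smooth j q hq), h.mem j q hq⟩)
    (a := fun j => germ (g j) (hg j)) (by
      rw [← germ_sum_mul hg fun j => h.smooth j q hq]
      exact hr (hf.sub (SmoothNear.sum _ fun j _ => (hg j).mul (h.smooth j q hq))))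
  simp only [evalGerm_germ] at h₁
  simp only [h.frame_eq hq]
  exact h₁

theorem span_frame (h : LocalGenerators F k U u) (hq : ι q ∈ U) :
    Submodule.span ℝ (Set.range fun j => h.frame j q) = ⊤ := by
  refine Submodule.eq_top_iff'.2 fun ξ => ?_
  obtain ⟨x, rfl⟩ := Submodule.mkQ_surjective _ ξ
  obtain ⟨a, ha⟩ := h.gen_germ hq x.2
  rw [mkQ_eq_sum_smul (u := fun j => ⟨germ (u j) (h.smooth j q hq), h.mem j q hq⟩) ha]
  refine Submodule.sum_mem _ fun j _ => Submodule.smul_mem _ _ (Submodule.subset_span ⟨j, ?_⟩)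
  exact h.frame_eq hq j

/-- The fibre divides by m·𝒜_(k) as well as 𝒜_(k+1), with m the maximal ideal. An element of m·𝒜_(k)
is a combination of the generators with coefficients in m, up to 𝒜_(k+1), so absorbing it leaves the
values of the coefficients unchanged and `indep` applies. -/
theorem linearIndependent_frame (h : LocalGenerators F k U u) (hq : ι q ∈ U) :
    LinearIndependent ℝ fun j => h.frame j q := by
  rw [Fintype.linearIndependent_iff]
  intro c hc
  set G : κ → SmoothGerm E (ι q) := fun j => germ (u j) (h.smooth j q hq) with hG
  let v : κ → filt F k q := fun j => ⟨G j, h.mem j q hq⟩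
  have h₁ : (grKer F k q).mkQ (∑ j, algebraMap ℝ (SmoothGerm E (ι q)) (c j) • v j) = 0 := by
    rw [map_sum, ← hc]
    refine Finset.sum_congr rfl fun j _ => ?_
    rw [map_smul, germ_smul_grFibre, AlgHom.commutes, h.frame_eq hq]
    rfl
  have h₂ : ∑ j, algebraMap ℝ (SmoothGerm E (ι q)) (c j) * G j ∈
      filt F (k + 1) q ⊔ maxIdeal E (ι q) * filt F k q := by
    have := (Submodule.Quotient.mk_eq_zero _).1 h₁
    have h₃ : (filt F k q).subtype (∑ j, algebraMap ℝ (SmoothGerm E (ι q)) (c j) • v j) =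
        ∑ j, algebraMap ℝ (SmoothGerm E (ι q)) (c j) * G j := by
      rw [map_sum]; rfl
    exact h₃ ▸ this
  have key : ∀ t ∈ maxIdeal E (ι q) * filt F k q, ∃ b : κ → SmoothGerm E (ι q),
      (∀ j, evalGerm E (ι q) (b j) = 0) ∧ t - ∑ j, b j * G j ∈ filt F (k + 1) q := by
    intro t ht
    refine Submodule.mul_induction_on ht (fun a ha x hx => ?_) (fun x y hx hy => ?_)
    · obtain ⟨b, hb⟩ := h.gen_germ hq hx
      refine ⟨fun j => a * b j, fun j => ?_, ?_⟩
      · rw [map_mul, mem_maxIdeal.1 ha, zero_mul]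
      · have := Ideal.mul_mem_left _ a hb
        simpa only [mul_sub, Finset.mul_sum, mul_assoc] using this
    · obtain ⟨b, hb, hb'⟩ := hx
      obtain ⟨b', hc, hc'⟩ := hy
      refine ⟨fun j => b j + b' j, fun j => by rw [map_add, hb, hc, add_zero], ?_⟩
      have := Ideal.add_mem _ hb' hc'
      simp only [add_mul, Finset.sum_add_distrib]
      convert this using 1
      ring
  obtain ⟨s, hs, t, ht, hst⟩ := Submodule.mem_sup.1 h₂
  obtain ⟨b, hb, hb'⟩ := key t ht
  intro j
  have h₃ := h.indep_germ hq (a := fun j => algebraMap ℝ (SmoothGerm E (ι q)) (c j) - b j) (by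
    have := Ideal.add_mem _ hs hb'
    simp only [sub_mul, Finset.sum_sub_distrib]
    convert this using 1
    rw [← hst]
    ring) j
  rw [map_sub, hb, AlgHom.commutes, sub_zero] at h₃
  exact h₃

theorem coeff_eq (h : LocalGenerators F k U u) (hq : ι q ∈ U) {c c' : κ → ℝ}
    (hc : ∑ j, c j • h.frame j q = ∑ j, c' j • h.frame j q) : c = c' := by
  have h₁ := Fintype.linearIndependent_iff.1 (h.linearIndependent_frame hq) (c - c') (by
    simp only [Pi.sub_apply, sub_smul, Finset.sum_sub_distrib, hc, sub_self])
  exact funext fun j => sub_eq_zero.1 (h₁ j)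

/-- Combinations of the generators with smooth coefficients are smooth sections. -/
theorem grSmooth_of_coeff (h : LocalGenerators F k U u) {π : M → N} (hU : IsOpen U)
    (hπ : ContMDiffOn 𝓘(ℝ, E) 𝓘(ℝ, E') ∞ π U) (hπι : ∀ q, ι q ∈ U → π (ι q) = q)
    {W : Set N} (hW : IsOpen W) (hWU : W ⊆ ι ⁻¹' U) {c : κ → N → ℝ}
    (hc : ∀ j, ContMDiffOn 𝓘(ℝ, E') 𝓘(ℝ) ∞ (c j) W) {s : ∀ q, GrFibre F k q}
    (hs : ∀ q ∈ W, s q = ∑ j, c j q • h.frame j q) : grSmooth F k W s := by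
  have hV : IsOpen (U ∩ π ⁻¹' W) := hπ.continuousOn.isOpen_inter_preimage hU hW
  have hιV : ∀ q, ι q ∈ U ∩ π ⁻¹' W → q ∈ W := fun q hq => by
    have := hq.2
    rwa [Set.mem_preimage, hπι q hq.1] at this
  -- The coefficients live on `N`; composing with the retraction extends them to `M`, and Σ (c_j ∘
  -- π) u_j represents the section.
  refine fun q₀ hq₀ => ⟨U ∩ π ⁻¹' W, hV, ⟨hWU hq₀, ?_⟩, fun q hq => hιV q hq,
    ∑ j, (c j ∘ π) * u j, fun q hq => ?_⟩
  · rw [Set.mem_preimage, hπι _ (hWU hq₀)]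
    exact hq₀
  · have hcs : ∀ j, SmoothNear E (ι q) (c j ∘ π) := fun j =>
      smoothNear_of_contMDiffOn hV ((hc j).comp (hπ.mono Set.inter_subset_left)
        fun x hx => hx.2) hq
    have hf : SmoothNear E (ι q) (∑ j, (c j ∘ π) * u j) :=
      SmoothNear.sum _ fun j _ => (hcs j).mul (h.smooth j q hq.1)
    have hk : germ _ hf ∈ filt F k q := by
      rw [germ_sum_mul hcs fun j => h.smooth j q hq.1]
      exact Ideal.sum_mem _ fun j _ => Ideal.mul_mem_left _ _ (h.mem j q hq.1)
    refine ⟨hf, hk, ?_⟩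
    rw [h.grClass_eq_sum hq.1 hf hk hcs fun h' => ?_, hs q (hιV q hq)]
    · simp only [Function.comp_apply, hπι q hq.1]
    · have h₁ : germ _ h' = germ _ hf - germ _ hf :=
        (germ_eq_germ (hg := hf.sub hf)).2 (Filter.EventuallyEq.of_eq rfl)
      rw [h₁, sub_self]
      exact Ideal.zero_mem _

/-- The coefficients of a smooth section are smooth. -/
theorem contMDiffOn_coeff (h : LocalGenerators F k U u)
    (hι : ContMDiff 𝓘(ℝ, E') 𝓘(ℝ, E) ∞ ι) {W : Set N} (hWU : W ⊆ ι ⁻¹' U)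
    {c : κ → N → ℝ} {s : ∀ q, GrFibre F k q} (hs : grSmooth F k W s)
    (hc : ∀ q ∈ W, s q = ∑ j, c j q • h.frame j q) (j : κ) :
    ContMDiffOn 𝓘(ℝ, E') 𝓘(ℝ) ∞ (c j) W := by
  intro q₀ hq₀
  obtain ⟨O, hO, hq₀O, hOW, f, hf⟩ := hs q₀ hq₀
  obtain ⟨hf₀, hk₀, -⟩ := hf q₀ hq₀O
  obtain ⟨g, hg, hgr⟩ := h.gen q₀ (hWU hq₀) f hf₀ hk₀
  -- One family g_j from `gen` serves all points near `q₀`. By uniqueness of coefficients c_j = g_j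
  -- ∘ ι there, which is smooth.
  refine ContMDiffAt.contMDiffWithinAt
    (((hg j).contMDiffAt.comp q₀ hι.contMDiffAt).congr_of_eventuallyEq ?_)
  have hgs : ∀ᶠ q in 𝓝 q₀, ∀ j, SmoothNear E (ι q) (g j) :=
    Filter.eventually_all.2 fun j => hι.continuous.continuousAt.eventually (hg j).eventually
  filter_upwards [hgr, hgs, hι.continuous.continuousAt.eventually (hO.mem_nhds hq₀O)]
    with q h₁ h₂ h₃
  obtain ⟨hfq, hkq, hsq⟩ := hf q h₃
  have h₄ := h.grClass_eq_sum (hWU (hOW h₃)) hfq hkq h₂ h₁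
  rw [← hsq, hc q (hOW h₃)] at h₄
  exact congrFun (h.coeff_eq (hWU (hOW h₃)) h₄) j

end LocalGenerators

theorem isVectorBundle_of_localGenerators {k : ℕ} (hι : ContMDiff 𝓘(ℝ, E') 𝓘(ℝ, E) ∞ ι)
    (H : ∀ q₀ : N, ∃ (U : Set M) (_ : IsOpen U) (_ : ι q₀ ∈ U) (π : M → N)
      (_ : ContMDiffOn 𝓘(ℝ, E) 𝓘(ℝ, E') ∞ π U) (_ : ∀ q, ι q ∈ U → π (ι q) = q)
      (κ : Type) (_ : Fintype κ) (u : κ → M → ℝ), LocalGenerators F k U u) :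
    IsVectorBundle E' (grSmooth F k) := by
  intro q₀
  obtain ⟨U, hU, hq₀, π, hπ, hπι, κ, _, u, h⟩ := H q₀
  let φ := Fintype.equivFin κ
  have hsum : ∀ (c : Fin (Fintype.card κ) → N → ℝ) (q : N),
      ∑ j, c j q • h.frame (φ.symm j) q = ∑ j, c (φ j) q • h.frame j q := fun c q => by
    rw [← φ.symm.sum_comp]
    simp
  refine ⟨ι ⁻¹' U, hU.preimage hι.continuous, hq₀, Fintype.card κ,
    fun j q => h.frame (φ.symm j) q, fun q hq => ⟨?_, ?_⟩, fun W hW hWU s => ⟨fun hs => ?_, ?_⟩⟩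
  · exact (h.linearIndependent_frame hq).comp _ φ.symm.injective
  · rw [← h.span_frame hq]
    exact congrArg _ (φ.symm.surjective.range_comp fun j => h.frame j q)
  -- Outside `W` the section is unconstrained and the value 0 is chosen; only values on `W` enter.
  · have h₁ : ∀ q, ∃ c : κ → ℝ, q ∈ W → s q = ∑ j, c j • h.frame j q := fun q => by
      by_cases hq : q ∈ W
      · have : s q ∈ Submodule.span ℝ (Set.range fun j => h.frame j q) := by
          rw [h.span_frame (hWU hq)]; trivial
        obtain ⟨c, hc⟩ := (Submodule.mem_span_range_iff_exists_fun ℝ).1 this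
        exact ⟨c, fun _ => hc.symm⟩
      · exact ⟨0, fun h => absurd h hq⟩
    choose c hc using h₁
    refine ⟨fun j q => c q (φ.symm j), fun j =>
      h.contMDiffOn_coeff hι hWU hs (c := fun j q => c q j) hc (φ.symm j), fun q hq => ?_⟩
    rw [hsum (fun j q => c q (φ.symm j)), hc q hq]
    simp
  · rintro ⟨c, hc, hs⟩
    exact h.grSmooth_of_coeff hU hπ hπι hW hWU (c := fun j => c (φ j)) (fun j => hc (φ j))
      fun q hq => by rw [hs q hq, hsum]

/-- If all nearby classes vanish, the coefficients g_j vanish along `N` near `q₀`, so g_j ∈ 𝓘 =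
𝒜_(1) and g_j u_j ∈ 𝒜_(1)𝒜_(k) ⊂ 𝒜_(k+1). Vanishing at `q₀` alone would not suffice. -/
theorem sectionsAreGr_of_localGenerators {k : ℕ} (hι : Topology.IsInducing ι)
    (H : ∀ q₀ : N, ∃ (U : Set M) (_ : IsOpen U) (_ : ι q₀ ∈ U)
      (κ : Type) (_ : Fintype κ) (u : κ → M → ℝ), LocalGenerators F k U u) :
    SectionsAreGr F k := by
  intro O hO f hf hk h0 q₀ hq₀O
  obtain ⟨U, hU, hq₀, κ, _, u, h⟩ := H q₀
  obtain ⟨g, hg, hgr⟩ := h.gen q₀ hq₀ f (hf q₀ hq₀O) (hk q₀ hq₀O)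
  have hgs : ∀ᶠ q in 𝓝 q₀, ∀ j, SmoothNear E (ι q) (g j) :=
    Filter.eventually_all.2 fun j => hι.continuous.continuousAt.eventually (hg j).eventually
  have hg0 : ∀ᶠ q in 𝓝 q₀, ∀ j, g j (ι q) = 0 := by
    filter_upwards [hgr, hgs, hι.continuous.continuousAt.eventually (hO.mem_nhds hq₀O),
      hι.continuous.continuousAt.eventually (hU.mem_nhds hq₀)] with q h₁ h₂ h₃ h₄
    have h₅ := h.grClass_eq_sum h₄ (hf q h₃) (hk q h₃) h₂ h₁
    rw [h0 q h₃] at h₅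
    exact congrFun (h.coeff_eq h₄ (c := fun j => g j (ι q)) (c' := 0) (by simp [← h₅]))
  have hus := fun j => h.smooth j q₀ hq₀
  have hsm : SmoothNear E (ι q₀) (∑ j, g j * u j) := SmoothNear.sum _ fun j _ => (hg j).mul (hus j)
  have h₁ : germ f (hf q₀ hq₀O) = germ _ ((hf q₀ hq₀O).sub hsm) +
      ∑ j, germ (g j) (hg j) * germ (u j) (hus j) := by
    rw [← germ_sum_mul hg hus, germ_sub (hf q₀ hq₀O) hsm, sub_add_cancel]
  rw [h₁]
  refine Ideal.add_mem _ (hgr.self_of_nhds _) (Ideal.sum_mem _ fun j _ => ?_)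
  rw [add_comm k 1]
  refine filt_mul_le F 1 k q₀ (Ideal.mul_mem_mul ?_ (h.mem j q₀ hq₀))
  rw [filt_one hι]
  exact (germ_mem_idealI hι).2 (hg0.mono fun q hq => hq j)

end Filtration

/-! ### Generators in degrees 0, 1 and 2. -/

section Generators

variable {E : Type*} [NormedAddCommGroup E] [NormedSpace ℝ E]
  {E' : Type*} [NormedAddCommGroup E'] [NormedSpace ℝ E']
  {M : Type*} [TopologicalSpace M] [ChartedSpace E M] [IsManifold 𝓘(ℝ, E) ∞ M]
  {N : Type*} [TopologicalSpace N] [ChartedSpace E' N]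
  {ι : N → M} {F : ∀ q, Submodule ℝ (NormalSpace E E' ι q)} {q : N}
  {U : Set M} {π : M → N} {r : ℕ} {σ : Type*} [Fintype σ] {y : Fin r → M → ℝ} {z : σ → M → ℝ}
  {e : Fin r → ∀ q, F q}

omit [IsManifold 𝓘(ℝ, E) ∞ M] in
theorem germ_mem_of_eventuallyEq_zero (hι : Continuous ι) {k : ℕ} {f : M → ℝ}
    (hf : f =ᶠ[𝓝 (ι q)] 0) :
    ∀ᶠ q' in 𝓝 q, ∀ h : SmoothNear E (ι q') f, germ f h ∈ filt F k q' := by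
  filter_upwards [hι.continuousAt.eventually hf.eventuallyEq_nhds] with q' hq' h
  have : germ f h = 0 := (germ_eq_germ (hg := smoothNear_const (ι q') 0)).2 hq'
  rw [this]
  exact Ideal.zero_mem _

omit [IsManifold 𝓘(ℝ, E) ∞ M] in
-- The coefficient of f is f itself, with no remainder, and membership in 𝒜_(1) = 𝓘 forces the value
-- at the point to be zero.
theorem localGenerators_zero (U : Set M) (hι : Topology.IsInducing ι) :
    LocalGenerators F 0 U (fun _ : Unit => (fun _ : M => (1 : ℝ))) where
  smooth _ q _ := smoothNear_const _ 1
  mem _ q _ := by rw [filt_zero]; trivial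
  gen q hq f hf _ := by
    refine ⟨fun _ => f, fun _ => hf, germ_mem_of_eventuallyEq_zero hι.continuous
      (Filter.Eventually.of_forall fun x => ?_)⟩
    simp
  indep q hq g hg hs hm j := by
    rw [zero_add, filt_one hι] at hm
    have := ((germ_mem_idealI hι).1 hm).self_of_nhds
    simpa using this

namespace AdaptedCoords

theorem smooth_y (h : AdaptedCoords F U π y z e) (hq : ι q ∈ U) (i : Fin r) :
    SmoothNear E (ι q) (y i) :=
  smoothNear_of_contMDiffOn h.coords.isOpen (h.coords.contMDiffOn_coord (Sum.inl i)) hq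

theorem smooth_z (h : AdaptedCoords F U π y z e) (hq : ι q ∈ U) (j : σ) :
    SmoothNear E (ι q) (z j) :=
  smoothNear_of_contMDiffOn h.coords.isOpen (h.coords.contMDiffOn_coord (Sum.inr j)) hq

theorem smooth_coord (h : AdaptedCoords F U π y z e) (hq : ι q ∈ U) (k : Fin r ⊕ σ) :
    SmoothNear E (ι q) (Sum.elim y z k) :=
  smoothNear_of_contMDiffOn h.coords.isOpen (h.coords.contMDiffOn_coord k) hq

theorem y_eq_zero (h : AdaptedCoords F U π y z e) (hq : ι q ∈ U) (i : Fin r) : y i (ι q) = 0 :=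
  h.coords.coord_eq_zero q hq (Sum.inl i)

theorem z_eq_zero (h : AdaptedCoords F U π y z e) (hq : ι q ∈ U) (j : σ) : z j (ι q) = 0 :=
  h.coords.coord_eq_zero q hq (Sum.inr j)

theorem eventually_mem (h : AdaptedCoords F U π y z e) (hι : Continuous ι) (hq : ι q ∈ U) :
    ∀ᶠ q' in 𝓝 q, ι q' ∈ U :=
  hι.continuousAt.eventually (h.coords.isOpen.mem_nhds hq)

theorem germ_y_mem (h : AdaptedCoords F U π y z e) (hι : Topology.IsInducing ι) (hq : ι q ∈ U)
    (i : Fin r) : germ (y i) (h.smooth_y hq i) ∈ idealI E ι q :=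
  (germ_mem_idealI hι).2 ((h.eventually_mem hι.continuous hq).mono fun _ hq' => h.y_eq_zero hq' i)

theorem germ_z_mem (h : AdaptedCoords F U π y z e) (hι : Topology.IsInducing ι) (hq : ι q ∈ U)
    (j : σ) : germ (z j) (h.smooth_z hq j) ∈ idealJ F q :=
  (germ_mem_idealJ hι).2 ((h.eventually_mem hι.continuous hq).mono fun _ hq' =>
    ⟨h.z_eq_zero hq' j, fun v hv => (h.mem_iff _ hq' v).1 hv j⟩)

/-- The differential of `∑ gᵢ yᵢ + ∑ hⱼ zⱼ` along the submanifold. -/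
theorem dAt_eq (h : AdaptedCoords F U π y z e) (hq : ι q ∈ U) {f : M → ℝ}
    {g : Fin r ⊕ σ → M → ℝ} (hg : ∀ k, SmoothNear E (ι q) (g k))
    (hf : f =ᶠ[𝓝 (ι q)] ∑ k, g k * Sum.elim y z k) :
    dAt (E := E) (ι q) f = ∑ i, g (Sum.inl i) (ι q) • dAt (ι q) (y i) +
      ∑ j, g (Sum.inr j) (ι q) • dAt (ι q) (z j) := by
  rw [dAt_sum_mul hg (h.smooth_coord hq) (h.coords.coord_eq_zero q hq) hf, Fintype.sum_sum_type]
  rfl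

/-- The value on the frame of `F` of the differential of `∑ gᵢ yᵢ + ∑ hⱼ zⱼ`. -/
theorem dAt_frame (h : AdaptedCoords F U π y z e) (hq : ι q ∈ U) {f : M → ℝ}
    {g : Fin r ⊕ σ → M → ℝ} (hg : ∀ k, SmoothNear E (ι q) (g k))
    (hf : f =ᶠ[𝓝 (ι q)] ∑ k, g k * Sum.elim y z k) (i : Fin r) :
    dAt (ι q) f (liftNormal (e i q : NormalSpace E E' ι q)) = g (Sum.inl i) (ι q) := by
  have h₁ := normalClass_liftNormal (e i q : NormalSpace E E' ι q)
  have h₂ := (h.mem_iff q hq _).1 (h₁ ▸ (e i q).2)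
  have h₃ := h.dual q hq i _ h₁
  rw [h.dAt_eq hq hg hf]
  simp [h₂, h₃]

/-- Hadamard leaves the remainder Σ h_j z_j, which lies in 𝓙 = 𝒜_(2). For independence, the
differential of Σ g_i y_i is evaluated on e_i, where it equals g_i and vanishes for elements of 𝓙.
-/
theorem localGenerators_one (h : AdaptedCoords F U π y z e) (hι : Topology.IsInducing ι) :
    LocalGenerators F 1 U y where
  smooth j q hq := h.smooth_y hq j
  mem j q hq := by rw [filt_one hι]; exact h.germ_y_mem hι hq j
  gen q hq f hf hk := by
    rw [filt_one hι, germ_mem_idealI hι] at hk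
    obtain ⟨g, hg, he⟩ := h.coords.hadamard q hq f hf hk
    refine ⟨fun i => g (Sum.inl i), fun i => hg _, ?_⟩
    filter_upwards [h.eventually_mem hι.continuous hq,
      hι.continuous.continuousAt.eventually he.eventuallyEq_nhds,
      Filter.eventually_all.2 fun k => hι.continuous.continuousAt.eventually (hg k).eventually]
      with q' hq' he' hg' h'
    have hgz : ∀ j, SmoothNear E (ι q') (g (Sum.inr j)) := fun j => hg' _
    have h₁ : germ _ h' = ∑ j, germ (g (Sum.inr j)) (hgz j) * germ (z j) (h.smooth_z hq' j) := by
      rw [← germ_sum_mul hgz fun j => h.smooth_z hq' j, germ_eq_germ]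
      filter_upwards [he'] with x hx
      simp [hx, Fintype.sum_sum_type]
    rw [h₁, filt_two hι]
    exact Ideal.sum_mem _ fun j _ => Ideal.mul_mem_left _ _ (h.germ_z_mem hι hq' j)
  indep q hq g hg hs hm i := by
    rw [filt_two hι, germ_mem_idealJ hι] at hm
    have h₁ := hm.self_of_nhds.2 (liftNormal (e i q : NormalSpace E E' ι q)) (by
      rw [normalClass_liftNormal]; exact (e i q).2)
    rw [h.dAt_frame hq (g := Sum.elim g fun _ _ => 0) (fun k => by
      cases k with
      | inl k => exact hg k
      | inr k => exact smoothNear_const _ 0) (Filter.Eventually.of_forall fun x => by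
        simp [Fintype.sum_sum_type])] at h₁
    exact h₁

/-- Index set of the generators `yᵢ yₖ` (`i ≤ k`) and `zⱼ` of the ideal `𝓙`. -/
abbrev QuadIndex (r : ℕ) (σ : Type*) := {p : Fin r × Fin r // p.1 ≤ p.2} ⊕ σ

/-- The generators `yᵢ yₖ` (`i ≤ k`) and `zⱼ` of the ideal `𝓙`. -/
def quadGen (y : Fin r → M → ℝ) (z : σ → M → ℝ) : QuadIndex r σ → M → ℝ :=
  Sum.elim (fun p => y p.1.1 * y p.1.2) z

theorem smooth_quadGen (h : AdaptedCoords F U π y z e) (hq : ι q ∈ U) (k : QuadIndex r σ) :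
    SmoothNear E (ι q) (quadGen y z k) := by
  cases k with
  | inl p => exact (h.smooth_y hq _).mul (h.smooth_y hq _)
  | inr j => exact h.smooth_z hq j

theorem germ_quadGen_mem (h : AdaptedCoords F U π y z e) (hι : Topology.IsInducing ι)
    (hq : ι q ∈ U) (k : QuadIndex r σ) :
    germ (quadGen y z k) (h.smooth_quadGen hq k) ∈ idealJ F q := by
  cases k with
  | inl p =>
    exact idealI_mul_idealI_le hι (Ideal.mul_mem_mul (h.germ_y_mem hι hq p.1.1)
      (h.germ_y_mem hι hq p.1.2))
  | inr j => exact h.germ_z_mem hι hq j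

/-- The generators of `𝓙` are independent to leading order. -/
theorem quadGen_indep (h : AdaptedCoords F U π y z e) (hq : ι q ∈ U)
    {g : QuadIndex r σ → M → ℝ} (hg : ∀ k, SmoothNear E (ι q) (g k))
    (h0 : ∑ k, g k * quadGen y z k =ᶠ[𝓝 (ι q)] 0) (k : QuadIndex r σ) : g k (ι q) = 0 := by
  classical
  -- Restricted to a curve with coordinates s·v, the relation becomes quadratic in s in the y_i y_k
  -- and linear in the z_j, with coefficients converging to their values at the point.
  have hslice : ∀ v : Fin r ⊕ σ → ℝ, ∃ γ : ℝ → M,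
      (∀ k, Filter.Tendsto (fun s => g k (γ s)) (𝓝[≠] 0) (𝓝 (g k (ι q)))) ∧
      ∀ᶠ s in 𝓝[≠] (0 : ℝ),
        ∑ p : {p : Fin r × Fin r // p.1 ≤ p.2},
          g (Sum.inl p) (γ s) * (s * v (Sum.inl p.1.1) * (s * v (Sum.inl p.1.2))) +
        ∑ j, g (Sum.inr j) (γ s) * (s * v (Sum.inr j)) = 0 := by
    intro v
    obtain ⟨γ, hγ, hγ0, he⟩ := h.coords.slice q hq v
    have hγt : Filter.Tendsto γ (𝓝 0) (𝓝 (ι q)) := hγ0 ▸ hγ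
    refine ⟨γ, fun k => ((hg k).contMDiffAt.continuousAt.tendsto.comp hγt).mono_left
      nhdsWithin_le_nhds, ?_⟩
    filter_upwards [nhdsWithin_le_nhds he, nhdsWithin_le_nhds (hγt.eventually h0)] with s h₁ h₂
    have hy : ∀ i, y i (γ s) = s * v (Sum.inl i) := fun i => h₁.2 (Sum.inl i)
    have hz : ∀ j, z j (γ s) = s * v (Sum.inr j) := fun j => h₁.2 (Sum.inr j)
    simpa [Fintype.sum_sum_type, quadGen, hy, hz] using h₂
  -- With the z-part of v zero, division by s² and s → 0 show that the leading quadratic form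
  -- vanishes identically. Its coefficients are recovered by polarization.
  have hquad : ∀ v : Fin r → ℝ, ∑ p : {p : Fin r × Fin r // p.1 ≤ p.2},
      g (Sum.inl p) (ι q) * (v p.1.1 * v p.1.2) = 0 := by
    intro v
    obtain ⟨γ, hγ, he⟩ := hslice (Sum.elim v 0)
    refine tendsto_nhds_unique (tendsto_finsetSum _ fun p _ => (hγ (Sum.inl p)).mul_const _)
      (tendsto_const_nhds.congr' ?_)
    filter_upwards [he, self_mem_nhdsWithin] with s hs hs0
    have hs0 : s ≠ 0 := hs0
    simp only [Sum.elim_inl, Sum.elim_inr, Pi.zero_apply, mul_zero, Finset.sum_const_zero,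
      add_zero] at hs
    have h₁ : s ^ 2 * ∑ p : {p : Fin r × Fin r // p.1 ≤ p.2},
        g (Sum.inl p) (γ s) * (v p.1.1 * v p.1.2) = 0 := by
      rw [Finset.mul_sum, ← hs]
      exact Finset.sum_congr rfl fun p _ => by ring
    exact ((mul_eq_zero.1 h₁).resolve_left (pow_ne_zero 2 hs0)).symm
  have hdiag : ∀ i : Fin r, g (Sum.inl ⟨(i, i), le_rfl⟩) (ι q) = 0 := by
    intro i
    rw [← hquad (Pi.single i 1), Finset.sum_eq_single ⟨(i, i), le_rfl⟩]
    · simp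
    · rintro ⟨⟨a, b⟩, hab⟩ - hne
      by_cases ha : a = i
      · subst ha
        have hb : b ≠ a := fun hb => hne (by subst hb; rfl)
        simp [hb]
      · simp [Pi.single_apply, ha]
    · simp
  match k with
  | Sum.inr j =>
    -- Along the z_j direction only the term of z_j survives; divide by s and let s → 0.
    obtain ⟨γ, hγ, he⟩ := hslice (Sum.elim 0 (Pi.single j 1))
    refine tendsto_nhds_unique (hγ (Sum.inr j)) (tendsto_const_nhds.congr' ?_)
    filter_upwards [he, self_mem_nhdsWithin] with s hs hs0
    have hs0 : s ≠ 0 := hs0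
    simpa [Pi.single_apply, hs0, eq_comm] using hs
  | Sum.inl ⟨(i, k), hik⟩ =>
    have hik' : i ≤ k := hik
    obtain rfl | hlt := hik'.eq_or_lt
    · exact hdiag _
    · have hne : i ≠ k := hlt.ne
      -- The diagonal coefficients are already zero, so the vector e_i + e_k isolates the
      -- coefficient of y_i y_k; the index (k, i) is excluded by the ordering.
      rw [← hquad (Pi.single i 1 + Pi.single k 1), Finset.sum_eq_single ⟨(i, k), hik⟩]
      · simp [hne, hne.symm]
      · rintro ⟨⟨a, b⟩, hab⟩ - hne'
        have hab' : a ≤ b := hab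
        by_cases hd : a = b
        · subst hd
          rw [hdiag, zero_mul]
        · refine mul_eq_zero_of_right _ ?_
          by_contra hc
          obtain ⟨h₁, h₂⟩ := mul_ne_zero_iff.1 hc
          have h₃ : a = i ∨ a = k := by
            by_contra! hh
            simp [hh.1, hh.2] at h₁
          have h₄ : b = i ∨ b = k := by
            by_contra! hh
            simp [hh.1, hh.2] at h₂
          rcases h₃ with rfl | rfl <;> rcases h₄ with rfl | rfl
          · exact hd rfl
          · exact hne' rfl
          · exact absurd hlt (not_lt.2 hab')
          · exact hd rfl
      · simp

/-- The ideal `𝓘` is generated by the normal coordinates. -/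
theorem exists_eq_sum_of_mem_idealI (h : AdaptedCoords F U π y z e) (hι : Topology.IsInducing ι)
    (hq : ι q ∈ U) {x : SmoothGerm E (ι q)} (hx : x ∈ idealI E ι q) :
    ∃ (a : Fin r → SmoothGerm E (ι q)) (b : σ → SmoothGerm E (ι q)),
      x = ∑ i, a i * germ (y i) (h.smooth_y hq i) + ∑ j, b j * germ (z j) (h.smooth_z hq j) := by
  obtain ⟨f, hf, rfl⟩ := germ_surjective x
  obtain ⟨g, hg, he⟩ := h.coords.hadamard q hq f hf ((germ_mem_idealI hι).1 hx)
  refine ⟨fun i => germ (g (Sum.inl i)) (hg _), fun j => germ (g (Sum.inr j)) (hg _), ?_⟩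
  have h₁ : germ f hf = ∑ k, germ (g k) (hg k) * germ _ (h.smooth_coord hq k) := by
    rw [← germ_sum_mul hg fun k => h.smooth_coord hq k]
    exact germ_eq_germ.2 he
  rw [h₁, Fintype.sum_sum_type]
  rfl

/-- In f = Σ g_i y_i + Σ h_j z_j the coefficient g_i equals df(e_i) along `N`, so it vanishes there
when f ∈ 𝓙. Expanding g_i ∈ 𝓘 in the coordinates once more produces the quadratic generators. -/
theorem idealJ_eq_span (h : AdaptedCoords F U π y z e) (hι : Topology.IsInducing ι)
    (hq : ι q ∈ U) :
    idealJ F q = Ideal.span (Set.range fun k => germ (quadGen y z k) (h.smooth_quadGen hq k)) := by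
  refine le_antisymm (fun x hx => ?_) (Ideal.span_le.2 ?_)
  · have hz : ∀ j, germ (z j) (h.smooth_z hq j) ∈
        Ideal.span (Set.range fun k => germ (quadGen y z k) (h.smooth_quadGen hq k)) := fun j =>
      Ideal.subset_span ⟨Sum.inr j, rfl⟩
    have hyy : ∀ i k, germ (y i) (h.smooth_y hq i) * germ (y k) (h.smooth_y hq k) ∈
        Ideal.span (Set.range fun k => germ (quadGen y z k) (h.smooth_quadGen hq k)) := by
      intro i k
      rcases le_total i k with hik | hik
      · exact Ideal.subset_span ⟨Sum.inl ⟨(i, k), hik⟩, rfl⟩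
      · rw [mul_comm]
        exact Ideal.subset_span ⟨Sum.inl ⟨(k, i), hik⟩, rfl⟩
    obtain ⟨f, hf, rfl⟩ := germ_surjective x
    have hx' := (germ_mem_idealJ hι).1 hx
    obtain ⟨g, hg, he⟩ := h.coords.hadamard q hq f hf (hx'.mono fun _ h => h.1)
    have hgI : ∀ i, germ (g (Sum.inl i)) (hg _) ∈ idealI E ι q := by
      intro i
      rw [germ_mem_idealI hι]
      filter_upwards [hx', h.eventually_mem hι.continuous hq,
        hι.continuous.continuousAt.eventually he.eventuallyEq_nhds,
        Filter.eventually_all.2 fun k => hι.continuous.continuousAt.eventually (hg k).eventually]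
        with q' h₁ hq' he' hg'
      rw [← h.dAt_frame hq' hg' he' i]
      exact h₁.2 _ (by rw [normalClass_liftNormal]; exact (e i q').2)
    have h₁ : germ f hf = ∑ k, germ (g k) (hg k) * germ _ (h.smooth_coord hq k) := by
      rw [← germ_sum_mul hg fun k => h.smooth_coord hq k]
      exact germ_eq_germ.2 he
    rw [h₁, Fintype.sum_sum_type]
    refine Ideal.add_mem _ (Ideal.sum_mem _ fun i _ => ?_)
      (Ideal.sum_mem _ fun j _ => Ideal.mul_mem_left _ _ (hz j))
    obtain ⟨a, b, hab⟩ := h.exists_eq_sum_of_mem_idealI hι hq (hgI i)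
    have h₂ : germ (g (Sum.inl i)) (hg _) * germ (y i) (h.smooth_y hq i) ∈
        Ideal.span (Set.range fun k => germ (quadGen y z k) (h.smooth_quadGen hq k)) := by
      rw [hab, add_mul, Finset.sum_mul, Finset.sum_mul]
      refine Ideal.add_mem _ (Ideal.sum_mem _ fun k _ => ?_) (Ideal.sum_mem _ fun j _ => ?_)
      · rw [mul_assoc]
        exact Ideal.mul_mem_left _ _ (hyy k i)
      · exact Ideal.mul_mem_right _ _ (Ideal.mul_mem_left _ _ (hz j))
    exact h₂
  · rintro _ ⟨k, rfl⟩
    exact h.germ_quadGen_mem hι hq k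

theorem localGenerators_two (h : AdaptedCoords F U π y z e) (hι : Topology.IsInducing ι) :
    LocalGenerators F 2 U (quadGen y z) where
  smooth j q hq := h.smooth_quadGen hq j
  mem j q hq := by rw [filt_two hι]; exact h.germ_quadGen_mem hι hq j
  gen q hq f hf hk := by
    rw [filt_two hι, h.idealJ_eq_span hι hq] at hk
    obtain ⟨a, ha⟩ := Ideal.mem_span_range_iff_exists_fun.1 hk
    choose g hg hga using fun k => germ_surjective (a k)
    obtain rfl : (fun k => germ (g k) (hg k)) = a := funext hga
    rw [← germ_sum_mul hg fun k => h.smooth_quadGen hq k, germ_eq_germ] at ha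
    refine ⟨g, hg, germ_mem_of_eventuallyEq_zero hι.continuous ?_⟩
    filter_upwards [ha] with x hx
    rw [Pi.sub_apply, hx, sub_self]
    rfl
  indep q hq g hg hs hm k := by
    rw [filt_three hι, h.idealJ_eq_span hι hq, ← smul_eq_mul,
      Submodule.mem_ideal_smul_span_iff_exists_sum] at hm
    obtain ⟨a, haI, ha⟩ := hm
    choose b hb hba using fun k => germ_surjective (a k)
    have hsum : ∑ k, germ (b k) (hb k) * germ _ (h.smooth_quadGen hq k) = germ _ hs := by
      rw [← ha, Finsupp.sum_fintype _ _ fun _ => by rw [zero_smul]]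
      simp only [hba, smul_eq_mul]
    rw [← germ_sum_mul hb fun k => h.smooth_quadGen hq k, germ_eq_germ] at hsum
    -- An element of 𝓘𝓙 is a combination of the generators with coefficients `b` in 𝓘. Subtracting
    -- it gives an exact relation, and since `b` vanishes at the point the value of `g` is
    -- unaffected.
    have h₁ := h.quadGen_indep hq (g := fun k => g k - b k) (fun k => (hg k).sub (hb k)) (by
      filter_upwards [hsum] with x hx
      simp only [Finset.sum_apply, Pi.mul_apply, Pi.sub_apply, sub_mul,
        Finset.sum_sub_distrib] at hx ⊢
      rw [hx, sub_self]
      rfl) k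
    have h₂ : b k (ι q) = 0 := by
      have := idealI_le_maxIdeal hι (haI k)
      rwa [← hba, mem_maxIdeal, evalGerm_germ] at this
    rwa [Pi.sub_apply, h₂, sub_zero] at h₁

end AdaptedCoords

end Generators

/-! ### The symmetric square: spanning products and induced maps. -/

section SymmetricSquare

universe w

variable {X : Type w} [AddCommGroup X] [Module ℝ X] {Y : Type*} [AddCommGroup Y] [Module ℝ Y]

theorem symProd_comm (a b : X) : symProd a b = symProd b a := by
  have h := SymmetricPower.tprod_equiv (R := ℝ) (Equiv.swap (0 : Fin 2) 1) ![a, b]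
  have h₁ : (fun i => ![a, b] (Equiv.swap (0 : Fin 2) 1 i)) = ![b, a] := by
    funext i
    fin_cases i <;> simp
  rw [h₁] at h
  exact h.symm

theorem symProd_add_left (a a' b : X) : symProd (a + a') b = symProd a b + symProd a' b :=
  MultilinearMap.cons_add (SymmetricPower.tprod ℝ (ι := Fin 2) (M := X)) ![b] a a'

theorem symProd_smul_left (c : ℝ) (a b : X) : symProd (c • a) b = c • symProd a b :=
  MultilinearMap.cons_smul (SymmetricPower.tprod ℝ (ι := Fin 2) (M := X)) ![b] c a

variable (X) in
/-- The symmetric products span the symmetric square. -/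
theorem span_symProd :
    Submodule.span ℝ (Set.range fun p : X × X => symProd p.1 p.2) = ⊤ := by
  rw [← top_le_iff, ← SymmetricPower.span_tprod_eq_top, Submodule.span_le]
  rintro _ ⟨v, rfl⟩
  refine Submodule.subset_span ⟨(v 0, v 1), ?_⟩
  refine congrArg (SymmetricPower.tprod ℝ (ι := Fin 2) (M := X)) ?_
  funext i
  fin_cases i <;> rfl

/-- If `b` spans `X`, the products `bᵢ bₖ` with `i ≤ k` span the symmetric square of `X`. -/
theorem span_symProd_of_span {r : ℕ} {b : Fin r → X} (hb : Submodule.span ℝ (Set.range b) = ⊤) :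
    Submodule.span ℝ (Set.range fun p : {p : Fin r × Fin r // p.1 ≤ p.2} =>
      symProd (b p.1.1) (b p.1.2)) = ⊤ := by
  set S := Submodule.span ℝ (Set.range fun p : {p : Fin r × Fin r // p.1 ≤ p.2} =>
      symProd (b p.1.1) (b p.1.2))
  have h₁ : ∀ i k, symProd (b i) (b k) ∈ S := fun i k => by
    rcases le_total i k with h | h
    · exact Submodule.subset_span ⟨⟨(i, k), h⟩, rfl⟩
    · rw [symProd_comm]
      exact Submodule.subset_span ⟨⟨(k, i), h⟩, rfl⟩
  -- Linearity in the left factor, with the right one fixed; commutativity then lets the same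
  -- argument treat both factors.
  have key : ∀ y : X, (∀ i, symProd (b i) y ∈ S) → ∀ x, symProd x y ∈ S := by
    intro y hy x
    have hx : x ∈ Submodule.span ℝ (Set.range b) := by rw [hb]; trivial
    induction hx using Submodule.span_induction with
    | mem x hx =>
      obtain ⟨i, rfl⟩ := hx
      exact hy i
    | zero => rw [← zero_smul ℝ (0 : X), symProd_smul_left, zero_smul]; exact S.zero_mem
    | add x x' _ _ hx hx' => rw [symProd_add_left]; exact S.add_mem hx hx'
    | smul c x _ hx => rw [symProd_smul_left]; exact S.smul_mem c hx
  rw [← top_le_iff, ← span_symProd X, Submodule.span_le]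
  rintro _ ⟨p, rfl⟩
  exact key p.2 (fun i => by
    rw [symProd_comm]; exact key (b i) (fun k => h₁ k i) p.2) p.1

/-- The linear map on the symmetric square induced by a symmetric bilinear map. -/
def sym2Lift (B : X →ₗ[ℝ] X →ₗ[ℝ] Y) (hB : ∀ x x', B x x' = B x' x) : Sym2Power X →ₗ[ℝ] Y :=
  let μ : MultilinearMap ℝ (fun _ : Fin 2 => X) Y :=
    { toFun v := B (v 0) (v 1)
      map_update_add' v i x x' := by
        fin_cases i <;> simp [Function.update]
      map_update_smul' v i c x := by
        fin_cases i <;> simp [Function.update] }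
  -- The symmetric power is a quotient of the tensor power by the additive congruence generated by
  -- permutations of pure tensors, so compatibility is checked only on the two permutations of two
  -- indices.
  let φ : (addConGen (SymmetricPower.Rel ℝ (Fin 2) X)).Quotient →+ Y :=
    AddCon.lift _ (PiTensorProduct.lift μ).toAddMonoidHom (AddCon.addConGen_le.2 (by
      rintro _ _ ⟨σ, f⟩
      refine AddCon.ker_apply.2 ?_
      simp only [LinearMap.toAddMonoidHom_coe, PiTensorProduct.lift.tprod]
      change B (f 0) (f 1) = B (f (σ 0)) (f (σ 1))
      obtain h | h : σ 0 = 0 ∨ σ 0 = 1 := by omega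
      · have h' : σ 1 = 1 := by
          have : σ 1 ≠ σ 0 := σ.injective.ne (by decide)
          omega
        rw [h, h']
      · have h' : σ 1 = 0 := by
          have : σ 1 ≠ σ 0 := σ.injective.ne (by decide)
          omega
        rw [h, h', hB]))
  { toFun := φ
    map_add' := φ.map_add
    map_smul' c t := AddCon.induction_on t fun t =>
      (PiTensorProduct.lift μ).map_smul c t }

theorem sym2Lift_symProd (B : X →ₗ[ℝ] X →ₗ[ℝ] Y) (hB : ∀ x x', B x x' = B x' x) (x x' : X) :
    sym2Lift B hB (symProd x x') = B x x' :=
  PiTensorProduct.lift.tprod _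

end SymmetricSquare

/-! ### Operations on smooth sections and the maps out of the fibres. -/

section Sections

variable {E : Type*} [NormedAddCommGroup E] [NormedSpace ℝ E]
  {E' : Type*} [NormedAddCommGroup E'] [NormedSpace ℝ E']
  {M : Type*} [TopologicalSpace M] [ChartedSpace E M]
  {N : Type*} [TopologicalSpace N] [ChartedSpace E' N]
  {ι : N → M} {F : ∀ q, Submodule ℝ (NormalSpace E E' ι q)}

theorem grSmooth_of_local {k : ℕ} {W : Set N} {s : ∀ q, GrFibre F k q}
    (h : ∀ q₀ ∈ W, ∃ W' ⊆ W, q₀ ∈ W' ∧ grSmooth F k W' s) : grSmooth F k W s := by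
  intro q₀ hq₀
  obtain ⟨W', hW', hq, hs⟩ := h q₀ hq₀
  obtain ⟨U, hU, hqU, hUW, hf⟩ := hs q₀ hq
  exact ⟨U, hU, hqU, hUW.trans hW', hf⟩

theorem grSmooth.congr {k : ℕ} {W : Set N} {s s' : ∀ q, GrFibre F k q} (hs : grSmooth F k W s)
    (h : ∀ q ∈ W, s' q = s q) : grSmooth F k W s' := by
  intro q₀ hq₀
  obtain ⟨U, hU, hqU, hUW, f, hf⟩ := hs q₀ hq₀
  refine ⟨U, hU, hqU, hUW, f, fun q hq => ?_⟩
  obtain ⟨hfs, hfk, he⟩ := hf q hq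
  exact ⟨hfs, hfk, (h q (hUW hq)).trans he⟩

theorem grSmooth_zero (k : ℕ) {W : Set N}
    (hW : ∃ U : Set M, IsOpen U ∧ ι ⁻¹' U = W) :
    grSmooth F k W fun _ => 0 := by
  obtain ⟨U, hU, rfl⟩ := hW
  refine fun q₀ hq₀ => ⟨U, hU, hq₀, subset_rfl, fun _ => 0, fun q _ =>
    ⟨smoothNear_const _ 0, (filt F k q).zero_mem, ?_⟩⟩
  exact (map_zero _).symm

theorem grSmooth.add {k : ℕ} {W : Set N} {s s' : ∀ q, GrFibre F k q} (hs : grSmooth F k W s)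
    (hs' : grSmooth F k W s') : grSmooth F k W fun q => s q + s' q := by
  intro q₀ hq₀
  obtain ⟨U, hU, hqU, hUW, f, hf⟩ := hs q₀ hq₀
  obtain ⟨U', hU', hqU', -, f', hf'⟩ := hs' q₀ hq₀
  refine ⟨U ∩ U', hU.inter hU', ⟨hqU, hqU'⟩, fun q hq => hUW hq.1, f + f', fun q hq => ?_⟩
  obtain ⟨h₁, h₂, h₃⟩ := hf q hq.1
  obtain ⟨h₁', h₂', h₃'⟩ := hf' q hq.2
  refine ⟨h₁.add h₁', Ideal.add_mem _ h₂ h₂', ?_⟩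
  exact (congrArg₂ (· + ·) h₃ h₃').trans (map_add (grKer F k q).mkQ _ _).symm

theorem grSmooth.sum {k : ℕ} {W : Set N} (hW : ∃ U : Set M, IsOpen U ∧ ι ⁻¹' U = W)
    {κ : Type*} (t : Finset κ)
    {s : κ → ∀ q, GrFibre F k q} (hs : ∀ j ∈ t, grSmooth F k W (s j)) :
    grSmooth F k W fun q => ∑ j ∈ t, s j q := by
  classical
  induction t using Finset.induction_on with
  | empty => simpa using grSmooth_zero k hW
  | insert a t ha ih =>
    simp only [Finset.sum_insert ha]
    exact (hs a (Finset.mem_insert_self a t)).add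
      (ih fun j hj => hs j (Finset.mem_insert_of_mem hj))

theorem grSmooth.grMul {j k : ℕ} {W : Set N} {s : ∀ q, GrFibre F j q} {s' : ∀ q, GrFibre F k q}
    (hs : grSmooth F j W s) (hs' : grSmooth F k W s') :
    grSmooth F (j + k) W fun q => grMul F j k q (s q) (s' q) := by
  intro q₀ hq₀
  obtain ⟨U, hU, hqU, hUW, f, hf⟩ := hs q₀ hq₀
  obtain ⟨U', hU', hqU', -, f', hf'⟩ := hs' q₀ hq₀
  refine ⟨U ∩ U', hU.inter hU', ⟨hqU, hqU'⟩, fun q hq => hUW hq.1, f * f', fun q hq => ?_⟩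
  obtain ⟨h₁, h₂, h₃⟩ := hf q hq.1
  obtain ⟨h₁', h₂', h₃'⟩ := hf' q hq.2
  refine ⟨h₁.mul h₁', filt_mul_le F j k q (Ideal.mul_mem_mul h₂ h₂'), ?_⟩
  exact congrArg₂ (fun a b => WeightedNormal.grMul F j k q a b) h₃ h₃'

variable {q : N}

/-- A linear map on `𝒜_(k)` that kills `grKer` descends to the fibre of `gr(𝒜)_k`. -/
def grLift {k : ℕ} {X : Type*} [AddCommGroup X] [Module ℝ X] (T : filt F k q →ₗ[ℝ] X)
    (hT : ∀ x ∈ grKer F k q, T x = 0) : GrFibre F k q →ₗ[ℝ] X :=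
  (Submodule.liftQ ((grKer F k q).restrictScalars ℝ) T hT) ∘ₗ
    (Submodule.Quotient.restrictScalarsEquiv ℝ (grKer F k q)).symm.toLinearMap

theorem eval_eq_zero_of_mem_idealI (hι : Topology.IsInducing ι) {a : SmoothGerm E (ι q)}
    (ha : a ∈ idealI E ι q) : evalGerm E (ι q) a = 0 :=
  mem_maxIdeal.1 (idealI_le_maxIdeal hι ha)

/-- Leibniz at the base point, where both factors vanish. -/
theorem dGerm_eq_zero_of_mem_mul (hι : Topology.IsInducing ι) {a : SmoothGerm E (ι q)}
    (ha : a ∈ maxIdeal E (ι q) * idealI E ι q) : dGerm E (ι q) a = 0 := by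
  refine Submodule.mul_induction_on ha (fun a ha b hb => ?_) (fun a b ha hb => ?_)
  · rw [dGerm_mul, mem_maxIdeal.1 ha, eval_eq_zero_of_mem_idealI hι hb, zero_smul, zero_smul,
      add_zero]
  · rw [map_add, ha, hb, add_zero]

theorem dGerm_eq_zero_of_mem_range (hι : Topology.IsInducing ι)
    (hd : MDifferentiableAt 𝓘(ℝ, E') 𝓘(ℝ, E) ι q) {a : SmoothGerm E (ι q)}
    (ha : a ∈ idealI E ι q) {v : TangentSpace 𝓘(ℝ, E) (ι q)}
    (hv : v ∈ LinearMap.range (mfderiv 𝓘(ℝ, E') 𝓘(ℝ, E) ι q).toLinearMap) :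
    dGerm E (ι q) a v = 0 := by
  obtain ⟨f, hf, rfl⟩ := germ_surjective a
  rw [dGerm_germ]
  exact dAt_eq_zero_of_mem_range hd hf ((germ_mem_idealI hι).1 ha) hv

/-- The differential of germs in `𝒜_(k) ⊂ 𝓘`, as a linear form on the normal space. -/
def normalD (hι : Topology.IsInducing ι) (hd : MDifferentiableAt 𝓘(ℝ, E') 𝓘(ℝ, E) ι q) {k : ℕ}
    (hk : filt F k q ≤ idealI E ι q) :
    filt F k q →ₗ[ℝ] Module.Dual ℝ (NormalSpace E E' ι q) where
  toFun x := Submodule.liftQ _ (dGerm E (ι q) x.1) fun _ hv =>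
    dGerm_eq_zero_of_mem_range hι hd (hk x.2) hv
  map_add' x x' := by
    refine Submodule.linearMap_qext _ (LinearMap.ext fun v => ?_)
    exact congrArg (fun l : Module.Dual ℝ (TangentSpace 𝓘(ℝ, E) (ι q)) => l v)
      (map_add (dGerm E (ι q)) x.1 x'.1)
  map_smul' c x := by
    refine Submodule.linearMap_qext _ (LinearMap.ext fun v => ?_)
    exact congrArg (fun l : Module.Dual ℝ (TangentSpace 𝓘(ℝ, E) (ι q)) => l v)
      (map_smul (dGerm E (ι q)) c x.1)

theorem normalD_apply (hι : Topology.IsInducing ι) (hd : MDifferentiableAt 𝓘(ℝ, E') 𝓘(ℝ, E) ι q)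
    {k : ℕ} (hk : filt F k q ≤ idealI E ι q) (x : filt F k q)
    (v : TangentSpace 𝓘(ℝ, E) (ι q)) :
    normalD hι hd hk x (normalClass E E' ι q v) = dGerm E (ι q) x.1 v := rfl

theorem dGerm_eq_zero_of_mem_idealJ (hι : Topology.IsInducing ι) {a : SmoothGerm E (ι q)}
    (ha : a ∈ idealJ F q) {v : TangentSpace 𝓘(ℝ, E) (ι q)}
    (hv : normalClass E E' ι q v ∈ F q) : dGerm E (ι q) a v = 0 := by
  obtain ⟨f, hf, rfl⟩ := germ_surjective a
  rw [dGerm_germ]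
  exact ((germ_mem_idealJ hι).1 ha).self_of_nhds.2 v hv

/-- Evaluation of the classes in degree zero. -/
def grEval (hι : Topology.IsInducing ι) (F : ∀ q, Submodule ℝ (NormalSpace E E' ι q)) (q : N) :
    GrFibre F 0 q →ₗ[ℝ] ℝ :=
  grLift ((evalGerm E (ι q)).toLinearMap ∘ₗ (filt F 0 q).subtype.restrictScalars ℝ) (by
    intro x hx
    have hx' : x.1 ∈ filt F (0 + 1) q ⊔ maxIdeal E (ι q) * filt F 0 q := hx
    have h : filt F (0 + 1) q ≤ maxIdeal E (ι q) := (filt_one hι).le.trans (idealI_le_maxIdeal hι)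
    exact mem_maxIdeal.1 (sup_le h Ideal.mul_le_left hx'))

theorem grEval_grClass (hι : Topology.IsInducing ι) (f : M → ℝ) (hf : SmoothNear E (ι q) f)
    (hk : germ f hf ∈ filt F 0 q) : grEval hι F q (grClass F 0 q f hf hk) = f (ι q) :=
  evalGerm_germ hf

/-- The map `[f] ↦ df|_F` in degree one. -/
def grD1 (hι : Topology.IsInducing ι) (hd : MDifferentiableAt 𝓘(ℝ, E') 𝓘(ℝ, E) ι q)
    (F : ∀ q, Submodule ℝ (NormalSpace E E' ι q)) :
    GrFibre F 1 q →ₗ[ℝ] Module.Dual ℝ (F q) :=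
  grLift ((F q).subtype.dualMap ∘ₗ normalD hι hd (filt_one hι).le) (by
    rintro x hx
    -- What is divided out is 𝓙 + m·𝓘: differentials from 𝓙 vanish on F, those from m·𝓘 vanish
    -- altogether.
    have hx' : x.1 ∈ idealJ F q ⊔ maxIdeal E (ι q) * idealI E ι q :=
      sup_le_sup (filt_two hι).le (Ideal.mul_mono_right (filt_one hι).le) hx
    obtain ⟨a, ha, b, hb, hab⟩ := Submodule.mem_sup.1 hx'
    ext ⟨w, hw⟩
    obtain ⟨v, rfl⟩ := Submodule.mkQ_surjective _ w
    refine (normalD_apply hι hd (filt_one hι).le x v).trans ?_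
    rw [← hab, map_add, LinearMap.add_apply, dGerm_eq_zero_of_mem_idealJ hι ha hw,
      dGerm_eq_zero_of_mem_mul hι hb]
    simp)

theorem grD1_grClass (hι : Topology.IsInducing ι) (hd : MDifferentiableAt 𝓘(ℝ, E') 𝓘(ℝ, E) ι q)
    (f : M → ℝ) (hf : SmoothNear E (ι q) f) (hk : germ f hf ∈ filt F 1 q)
    (v : TangentSpace 𝓘(ℝ, E) (ι q)) (hv : normalClass E E' ι q v ∈ F q) :
    grD1 hι hd F (grClass F 1 q f hf hk) ⟨normalClass E E' ι q v, hv⟩ = dAt (ι q) f v :=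
  congrArg (fun l : Module.Dual ℝ (TangentSpace 𝓘(ℝ, E) (ι q)) => l v) (dGerm_germ hf)

theorem filt_two_le (hι : Topology.IsInducing ι) : filt F 2 q ≤ idealI E ι q :=
  (filt_two hι).le.trans (idealJ_le_idealI hι)

theorem normalD_eq_zero (hι : Topology.IsInducing ι)
    (hd : MDifferentiableAt 𝓘(ℝ, E') 𝓘(ℝ, E) ι q) {k : ℕ} (hk : filt F k q ≤ idealI E ι q)
    {x : filt F k q} (hx : x.1 ∈ maxIdeal E (ι q) * idealI E ι q) : normalD hι hd hk x = 0 := by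
  refine LinearMap.ext fun w => ?_
  obtain ⟨v, rfl⟩ := Submodule.mkQ_surjective _ w
  exact congrArg (fun l : Module.Dual ℝ (TangentSpace 𝓘(ℝ, E) (ι q)) => l v)
    (dGerm_eq_zero_of_mem_mul hι hx)

/-- Both 𝒜_(3) = 𝓘𝓙 and m·𝓙 lie in m·𝓘, whose differentials vanish at q. This makes df well defined
on A_2 in all normal directions. -/
theorem mem_mul_of_mem_grKer_two (hι : Topology.IsInducing ι) {x : filt F 2 q}
    (hx : x ∈ grKer F 2 q) : x.1 ∈ maxIdeal E (ι q) * idealI E ι q := by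
  have hx' : x.1 ∈ filt F 3 q ⊔ maxIdeal E (ι q) * filt F 2 q := hx
  refine sup_le ?_ (Ideal.mul_mono_right (filt_two_le hι)) hx'
  rw [filt_three hι]
  exact Ideal.mul_mono (idealI_le_maxIdeal hι) (idealJ_le_idealI hι)

theorem normalD_mem_ann (hι : Topology.IsInducing ι)
    (hd : MDifferentiableAt 𝓘(ℝ, E') 𝓘(ℝ, E) ι q) (x : filt F 2 q) :
    normalD hι hd (filt_two_le hι) x ∈ Ann F q := by
  rw [Submodule.mem_dualAnnihilator]
  intro w hw
  obtain ⟨v, rfl⟩ := Submodule.mkQ_surjective _ w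
  exact dGerm_eq_zero_of_mem_idealJ hι ((filt_two hι).le x.2) hw

/-- The map `[f] ↦ df` in degree two. -/
def grD2 (hι : Topology.IsInducing ι) (hd : MDifferentiableAt 𝓘(ℝ, E') 𝓘(ℝ, E) ι q)
    (F : ∀ q, Submodule ℝ (NormalSpace E E' ι q)) : GrFibre F 2 q →ₗ[ℝ] Ann F q :=
  grLift (X := Ann F q) (LinearMap.codRestrict (Ann F q) (normalD hι hd (filt_two_le hι))
    (normalD_mem_ann hι hd)) fun _ hx =>
      Subtype.ext (normalD_eq_zero hι hd _ (mem_mul_of_mem_grKer_two hι hx))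

theorem grD2_grClass (hι : Topology.IsInducing ι) (hd : MDifferentiableAt 𝓘(ℝ, E') 𝓘(ℝ, E) ι q)
    (f : M → ℝ) (hf : SmoothNear E (ι q) f) (hk : germ f hf ∈ filt F 2 q)
    (v : TangentSpace 𝓘(ℝ, E) (ι q)) :
    (grD2 hι hd F (grClass F 2 q f hf hk) : Module.Dual ℝ (NormalSpace E E' ι q))
      (normalClass E E' ι q v) = dAt (ι q) f v :=
  congrArg (fun l : Module.Dual ℝ (TangentSpace 𝓘(ℝ, E) (ι q)) => l v) (dGerm_germ hf)

theorem grD2_grMul (hι : Topology.IsInducing ι) (hd : MDifferentiableAt 𝓘(ℝ, E') 𝓘(ℝ, E) ι q)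
    (a b : GrFibre F 1 q) : grD2 hι hd F (grMul F 1 1 q a b) = 0 := by
  obtain ⟨x, rfl⟩ := Submodule.mkQ_surjective _ a
  obtain ⟨y, rfl⟩ := Submodule.mkQ_surjective _ b
  have h : x.1 * y.1 ∈ maxIdeal E (ι q) * idealI E ι q :=
    Ideal.mul_mem_mul (idealI_le_maxIdeal hι ((filt_one hι).le x.2)) ((filt_one hι).le y.2)
  exact Subtype.ext (normalD_eq_zero hι hd (filt_two_le hι)
    (x := ⟨x.1 * y.1, filt_mul_le F 1 1 q (Ideal.mul_mem_mul x.2 y.2)⟩) h)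

/-- The differential of a smooth section of `A_k`, `k ≥ 1`, pairs smoothly with smooth sections of
the normal bundle. -/
theorem contMDiffOn_pairing [IsManifold 𝓘(ℝ, E) ∞ M] (hι : ContMDiff 𝓘(ℝ, E') 𝓘(ℝ, E) ∞ ι)
    (hιi : Topology.IsInducing ι) {k : ℕ} (hk : ∀ q, filt F k q ≤ idealI E ι q) {W W' : Set N}
    (hW' : IsOpen W') (hW'W : W' ⊆ W) {s : ∀ q, GrFibre F k q} (hs : grSmooth F k W s)
    {τ : ∀ q, NormalSpace E E' ι q} (hτ : normalSmooth E E' ι W' τ) {D : N → ℝ}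
    (hD : ∀ q ∈ W', ∀ f hf hk, s q = grClass F k q f hf hk →
      D q = dAt (ι q) f (liftNormal (τ q))) :
    ContMDiffOn 𝓘(ℝ, E') 𝓘(ℝ) ∞ D W' := by
  intro q₀ hq₀
  obtain ⟨U, hU, hqU, hUW, f, hf⟩ := hs q₀ (hW'W hq₀)
  have hV : IsOpen (ι ⁻¹' U ∩ W') := (hU.preimage hι.continuous).inter hW'
  have h₁ := contMDiffOn_dAt_lift hι hV (f := f) (fun q hq => (hf q hq.1).choose)
    (fun q hq => ((germ_mem_idealI hιi).1 (hk q (hf q hq.1).choose_spec.choose)).self_of_nhds)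
    (hτ.mono Set.inter_subset_right hV)
  refine ContMDiffAt.contMDiffWithinAt
    ((h₁.contMDiffAt (hV.mem_nhds ⟨hqU, hq₀⟩)).congr_of_eventuallyEq ?_)
  filter_upwards [hV.mem_nhds ⟨hqU, hq₀⟩] with q hq
  obtain ⟨hfs, hfk, he⟩ := hf q hq.1
  exact hD q hq.2 f hfs hfk he

end Sections

/-! ### The three fibre maps computed in the local frames. -/

section Fibres

variable {E : Type*} [NormedAddCommGroup E] [NormedSpace ℝ E]
  {E' : Type*} [NormedAddCommGroup E'] [NormedSpace ℝ E']
  {M : Type*} [TopologicalSpace M] [ChartedSpace E M] [IsManifold 𝓘(ℝ, E) ∞ M]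
  {N : Type*} [TopologicalSpace N] [ChartedSpace E' N]
  {ι : N → M} {F : ∀ q, Submodule ℝ (NormalSpace E E' ι q)} {q : N}

omit [IsManifold 𝓘(ℝ, E) ∞ M] in
theorem grEval_bijective (hι : Topology.IsInducing ι) : Function.Bijective (grEval hι F q) := by
  have h := localGenerators_zero (F := F) Set.univ hι
  have hone : grEval hι F q (h.frame () q) = 1 := by
    rw [h.frame_eq (Set.mem_univ _)]
    exact grEval_grClass hι _ _ _
  refine ⟨(injective_iff_map_eq_zero _).2 fun ξ hξ => ?_, fun c => ⟨c • h.frame () q, ?_⟩⟩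
  · have hs : ξ ∈ Submodule.span ℝ (Set.range fun j => h.frame j q) := by
      rw [h.span_frame (Set.mem_univ _)]; trivial
    obtain ⟨c, rfl⟩ := (Submodule.mem_span_range_iff_exists_fun ℝ).1 hs
    simp only [Finset.univ_unique, Finset.sum_singleton, PUnit.default_eq_unit, map_smul, hone,
      smul_eq_mul, mul_one] at hξ ⊢
    rw [hξ, zero_smul]
  · rw [map_smul, hone, smul_eq_mul, mul_one]

namespace AdaptedCoords

variable {U : Set M} {π : M → N} {r : ℕ} {σ : Type*} [Fintype σ] {y : Fin r → M → ℝ}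
  {z : σ → M → ℝ} {e : Fin r → ∀ q, F q}

theorem dAt_y_frame (h : AdaptedCoords F U π y z e) (hq : ι q ∈ U) (i j : Fin r) :
    dAt (ι q) (y j) (liftNormal (e i q : NormalSpace E E' ι q)) = if j = i then 1 else 0 :=
  h.dual q hq i _ (normalClass_liftNormal _) j

/-- Vectors in `F` are combinations of the frame with coefficients `dy`. -/
theorem eq_sum_frame (h : AdaptedCoords F U π y z e) (hq : ι q ∈ U) (w : F q) :
    w = ∑ i, dAt (ι q) (y i) (liftNormal (w : NormalSpace E E' ι q)) • e i q := by
  set c : Fin r → ℝ := fun i => dAt (ι q) (y i) (liftNormal (w : NormalSpace E E' ι q))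
  have hz : ∀ w : F q, ∀ j, dAt (ι q) (z j) (liftNormal (w : NormalSpace E E' ι q)) = 0 :=
    fun w => (h.mem_iff q hq _).1 (by rw [normalClass_liftNormal]; exact w.2)
  have h₁ := h.coords.ker q hq (liftNormal (w : NormalSpace E E' ι q) -
      ∑ i, c i • liftNormal (e i q : NormalSpace E E' ι q)) (fun k => by
    cases k with
    | inl j => simp [h.dAt_y_frame hq, c]
    | inr j => simp [hz])
  have h₂ := (Submodule.Quotient.eq _).2 h₁
  refine Subtype.ext ?_
  rw [Submodule.coe_sum]
  refine (normalClass_liftNormal (w : NormalSpace E E' ι q)).symm.trans (h₂.trans ?_)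
  refine (map_sum (Submodule.mkQ _) _ _).trans (Finset.sum_congr rfl fun i _ => ?_)
  exact congrArg (c i • ·) (normalClass_liftNormal (e i q : NormalSpace E E' ι q))

theorem grD1_sum_frame (h : AdaptedCoords F U π y z e) (hι : Topology.IsInducing ι)
    (hd : MDifferentiableAt 𝓘(ℝ, E') 𝓘(ℝ, E) ι q) (hq : ι q ∈ U) (c : Fin r → ℝ) (i : Fin r) :
    grD1 hι hd F (∑ j, c j • (h.localGenerators_one hι).frame j q) (e i q) = c i := by
  have h₁ : ∀ j, grD1 hι hd F ((h.localGenerators_one hι).frame j q) (e i q) =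
      if j = i then 1 else 0 := fun j => by
    rw [(h.localGenerators_one hι).frame_eq hq, ← h.dAt_y_frame hq,
      ← grD1_grClass hι hd (y j) ((h.localGenerators_one hι).smooth j q hq)
      ((h.localGenerators_one hι).mem j q hq) _ (by rw [normalClass_liftNormal]; exact (e i q).2)]
    congr 1
    exact Subtype.ext (normalClass_liftNormal _).symm
  simp [h₁]

theorem dual_ext (h : AdaptedCoords F U π y z e) (hq : ι q ∈ U) {α β : Module.Dual ℝ (F q)}
    (hαβ : ∀ i, α (e i q) = β (e i q)) : α = β := by
  ext w
  rw [h.eq_sum_frame hq w, map_sum, map_sum]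
  simp only [map_smul, hαβ]

/-- The frame [y_j] is sent to the family dual to the e_i, so α is the image of Σ α(e_j)[y_j] and
the coefficients of a class are read off by pairing with e_i. -/
theorem grD1_bijective (h : AdaptedCoords F U π y z e) (hι : Topology.IsInducing ι)
    (hd : MDifferentiableAt 𝓘(ℝ, E') 𝓘(ℝ, E) ι q) (hq : ι q ∈ U) :
    Function.Bijective (grD1 hι hd F) := by
  refine ⟨(injective_iff_map_eq_zero _).2 fun ξ hξ => ?_, fun α =>
    ⟨∑ j, α (e j q) • (h.localGenerators_one hι).frame j q, h.dual_ext hq fun i =>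
      h.grD1_sum_frame hι hd hq _ i⟩⟩
  have hs : ξ ∈ Submodule.span ℝ (Set.range fun j => (h.localGenerators_one hι).frame j q) := by
    rw [(h.localGenerators_one hι).span_frame hq]; trivial
  obtain ⟨c, rfl⟩ := (Submodule.mem_span_range_iff_exists_fun ℝ).1 hs
  refine Finset.sum_eq_zero fun i _ => ?_
  rw [← h.grD1_sum_frame hι hd hq c i, hξ, LinearMap.zero_apply, zero_smul]

/-- The differential in degree two only sees the generators `zⱼ`. -/
theorem grD2_sum_frame (h : AdaptedCoords F U π y z e) (hι : Topology.IsInducing ι)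
    (hd : MDifferentiableAt 𝓘(ℝ, E') 𝓘(ℝ, E) ι q) (hq : ι q ∈ U) (c : QuadIndex r σ → ℝ)
    (v : TangentSpace 𝓘(ℝ, E) (ι q)) :
    (grD2 hι hd F (∑ k, c k • (h.localGenerators_two hι).frame k q) :
      Module.Dual ℝ (NormalSpace E E' ι q)) (normalClass E E' ι q v) =
        ∑ j, c (Sum.inr j) * dAt (ι q) (z j) v := by
  have h₁ : ∀ k, (grD2 hι hd F ((h.localGenerators_two hι).frame k q) :
      Module.Dual ℝ (NormalSpace E E' ι q)) (normalClass E E' ι q v) =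
        dAt (ι q) (quadGen y z k) v := fun k => by
    rw [(h.localGenerators_two hι).frame_eq hq, grD2_grClass]
  have h₂ : ∀ p : {p : Fin r × Fin r // p.1 ≤ p.2},
      dAt (ι q) (quadGen y z (Sum.inl p)) v = 0 := fun p => by
    rw [quadGen, Sum.elim_inl, dAt_mul (h.smooth_y hq _) (h.smooth_y hq _), h.y_eq_zero hq,
      h.y_eq_zero hq, zero_smul, zero_smul, add_zero, LinearMap.zero_apply]
  rw [map_sum, Submodule.coe_sum, LinearMap.sum_apply]
  simp only [map_smul, Submodule.coe_smul, LinearMap.smul_apply, h₁, Fintype.sum_sum_type, h₂,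
    smul_eq_mul, mul_zero, Finset.sum_const_zero, zero_add]
  rfl

/-- A form in ann(F), pulled back to the tangent space, vanishes on the common kernel of the
finitely many dz_j, hence is a combination of them; the same combination of the classes [z_j] is a
preimage. -/
theorem grD2_surjective (h : AdaptedCoords F U π y z e) (hι : Topology.IsInducing ι)
    (hd : MDifferentiableAt 𝓘(ℝ, E') 𝓘(ℝ, E) ι q) (hq : ι q ∈ U) :
    Function.Surjective (grD2 hι hd F) := by
  intro β
  have hspan := mem_span_of_iInf_ker_le_ker (L := fun j => dAt (E := E) (ι q) (z j))
    (K := (β : Module.Dual ℝ (NormalSpace E E' ι q)) ∘ₗ Submodule.mkQ _) (fun v hv => by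
      have hv' : ∀ j, dAt (ι q) (z j) v = 0 := by simpa [Submodule.mem_iInf] using hv
      exact (Submodule.mem_dualAnnihilator _).1 β.2 _ ((h.mem_iff q hq v).2 hv'))
  obtain ⟨c, hc⟩ := (Submodule.mem_span_range_iff_exists_fun ℝ).1 hspan
  refine ⟨∑ k, (Sum.elim 0 c : QuadIndex r σ → ℝ) k • (h.localGenerators_two hι).frame k q,
    Subtype.ext (LinearMap.ext fun w => ?_)⟩
  obtain ⟨v, rfl⟩ := Submodule.mkQ_surjective _ w
  refine (h.grD2_sum_frame hι hd hq _ v).trans ?_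
  refine Eq.trans ?_ (congrArg (fun l : Module.Dual ℝ (TangentSpace 𝓘(ℝ, E) (ι q)) => l v) hc)
  simp

theorem frame_two_eq (h : AdaptedCoords F U π y z e) (hι : Topology.IsInducing ι) (hq : ι q ∈ U)
    (p : {p : Fin r × Fin r // p.1 ≤ p.2}) :
    (h.localGenerators_two hι).frame (Sum.inl p) q = grMul F 1 1 q
      ((h.localGenerators_one hι).frame p.1.1 q) ((h.localGenerators_one hι).frame p.1.2 q) := by
  rw [(h.localGenerators_two hι).frame_eq hq, (h.localGenerators_one hι).frame_eq hq,
    (h.localGenerators_one hι).frame_eq hq]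
  rfl

/-- Elements in the kernel of the differential in degree two are combinations of the `yᵢ yₖ`. -/
theorem exists_eq_sum_of_grD2_eq_zero (h : AdaptedCoords F U π y z e) (hι : Topology.IsInducing ι)
    (hd : MDifferentiableAt 𝓘(ℝ, E') 𝓘(ℝ, E) ι q) (hq : ι q ∈ U) {ξ : GrFibre F 2 q}
    (hξ : grD2 hι hd F ξ = 0) : ∃ c : {p : Fin r × Fin r // p.1 ≤ p.2} → ℝ,
      ξ = ∑ p, c p • (h.localGenerators_two hι).frame (Sum.inl p) q := by
  classical
  have hs : ξ ∈ Submodule.span ℝ (Set.range fun j => (h.localGenerators_two hι).frame j q) := by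
    rw [(h.localGenerators_two hι).span_frame hq]; trivial
  obtain ⟨c, rfl⟩ := (Submodule.mem_span_range_iff_exists_fun ℝ).1 hs
  have hc : ∀ j, c (Sum.inr j) = 0 := fun j => by
    -- The normal differentials take arbitrary values, so some v satisfies dz_k(v) = δ_jk and
    -- isolates the coefficient of z_j.
    obtain ⟨v, hv⟩ := h.coords.surjective q hq (Sum.elim 0 (Pi.single j 1))
    have h₁ := h.grD2_sum_frame hι hd hq c v
    have h₂ : ∀ k, dAt (ι q) (z k) v = (Pi.single j 1 : σ → ℝ) k := fun k => hv (Sum.inr k)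
    rw [hξ] at h₁
    simpa [h₂, Pi.single_apply] using h₁.symm
  exact ⟨fun p => c (Sum.inl p), by simp [Fintype.sum_sum_type, hc]⟩

end AdaptedCoords

end Fibres

/-! ### The multiplication map from the symmetric square. -/

section Multiplication

variable {E : Type*} [NormedAddCommGroup E] [NormedSpace ℝ E]
  {E' : Type*} [NormedAddCommGroup E'] [NormedSpace ℝ E']
  {M : Type*} [TopologicalSpace M] [ChartedSpace E M]
  {N : Type*} [TopologicalSpace N] [ChartedSpace E' N]
  {ι : N → M} {F : ∀ q, Submodule ℝ (NormalSpace E E' ι q)} {q : N}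

theorem grMul_comm (a b : GrFibre F 1 q) : grMul F 1 1 q a b = grMul F 1 1 q b a := by
  obtain ⟨x, rfl⟩ := Submodule.mkQ_surjective _ a
  obtain ⟨y, rfl⟩ := Submodule.mkQ_surjective _ b
  exact congrArg (grKer F (1 + 1) q).mkQ (Subtype.ext (mul_comm x.1 y.1))

/-- The multiplication `Sym²(F^*) → A_2` induced by an isomorphism `A_1 ≅ F^*`. -/
def symMul (Φ : GrFibre F 1 q ≃ₗ[ℝ] Module.Dual ℝ (F q)) :
    Sym2Power (Module.Dual ℝ (F q)) →ₗ[ℝ] GrFibre F 2 q :=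
  sym2Lift ((LinearMap.restrictScalars₁₂ ℝ ℝ (grMul F 1 1 q)).compl₁₂ Φ.symm.toLinearMap
    Φ.symm.toLinearMap) fun _ _ => grMul_comm _ _

theorem symMul_symProd (Φ : GrFibre F 1 q ≃ₗ[ℝ] Module.Dual ℝ (F q)) (α β : Module.Dual ℝ (F q)) :
    symMul Φ (symProd α β) = grMul F 1 1 q (Φ.symm α) (Φ.symm β) :=
  sym2Lift_symProd _ _ α β

end Multiplication

/-! ### Smoothness of the degree two maps and exactness of the sequence. -/

section Multiplication

variable {E : Type*} [NormedAddCommGroup E] [NormedSpace ℝ E]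
  {E' : Type*} [NormedAddCommGroup E'] [NormedSpace ℝ E']
  {M : Type*} [TopologicalSpace M] [ChartedSpace E M] [IsManifold 𝓘(ℝ, E) ∞ M]
  {N : Type*} [TopologicalSpace N] [ChartedSpace E' N]
  {ι : N → M} {F : ∀ q, Submodule ℝ (NormalSpace E E' ι q)}

theorem isSmoothBundleMap_symMul (hιi : Topology.IsInducing ι)
    (Φ : ∀ q, GrFibre F 1 q ≃ₗ[ℝ] Module.Dual ℝ (F q))
    (hΦ : IsSmoothBundleMap (subDualSmooth F) (grSmooth F 1) fun q => (Φ q).symm.toLinearMap) :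
    IsSmoothBundleMap (sym2Smooth (subDualSmooth F)) (grSmooth F 2) fun q => symMul (Φ q) := by
  intro W hW s hs
  refine grSmooth_of_local fun q₀ hq₀ => ?_
  obtain ⟨W', hW', hq₀W', hW'W, n, a, b, ha, hb, he⟩ := hs q₀ hq₀
  have hm : ∀ j, grSmooth F (1 + 1) W' fun q =>
      grMul F 1 1 q ((Φ q).symm (a j q)) ((Φ q).symm (b j q)) := fun j =>
    grSmooth.grMul (hΦ W' hW' _ (ha j)) (hΦ W' hW' _ (hb j))
  have hsum := grSmooth.sum (hιi.isOpen_iff.1 hW') Finset.univ fun j _ => hm j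
  refine ⟨W', hW'W, hq₀W', grSmooth.congr (k := 2) hsum fun q hq => ?_⟩
  rw [he q hq, map_sum]
  exact Finset.sum_congr rfl fun j _ => symMul_symProd (Φ q) (a j q) (b j q)

theorem isSmoothBundleMap_grD2 (hd : ∀ q, MDifferentiableAt 𝓘(ℝ, E') 𝓘(ℝ, E) ι q)
    (hι : ContMDiff 𝓘(ℝ, E') 𝓘(ℝ, E) ∞ ι)
    (hιi : Topology.IsInducing ι) :
    IsSmoothBundleMap (grSmooth F 2) (annSmooth F) fun q => grD2 hιi (hd q) F := by
  intro W hW s hs W' hW' hW'W τ hτ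
  refine contMDiffOn_pairing hι hιi (fun q => filt_two_le hιi) hW' hW'W hs hτ
      fun q hq f hf hk he => ?_
  rw [← grD2_grClass hιi (hd q) f hf hk, normalClass_liftNormal, ← he]

variable {q : N} {U : Set M} {π : M → N} {r : ℕ} {σ : Type*} [Fintype σ] {y : Fin r → M → ℝ}
  {z : σ → M → ℝ} {e : Fin r → ∀ q, F q}

theorem AdaptedCoords.symMul_sum (h : AdaptedCoords F U π y z e) (hι : Topology.IsInducing ι)
    (hq : ι q ∈ U) (Φ : GrFibre F 1 q ≃ₗ[ℝ] Module.Dual ℝ (F q))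
    (c : {p : Fin r × Fin r // p.1 ≤ p.2} → ℝ) :
    symMul Φ (∑ p, c p • symProd (Φ ((h.localGenerators_one hι).frame p.1.1 q))
      (Φ ((h.localGenerators_one hι).frame p.1.2 q))) =
        ∑ p, c p • (h.localGenerators_two hι).frame (Sum.inl p) q := by
  simp only [map_sum, map_smul, symMul_symProd, LinearEquiv.symm_apply_apply,
    h.frame_two_eq hι hq]

/-- The products with i ≤ k span Sym²(F^*) and map to the independent classes [y_i y_k]. A spanning
family with independent image forces injectivity, so no basis of the symmetric square is needed
beforehand. -/
theorem AdaptedCoords.symMul_injective (h : AdaptedCoords F U π y z e)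
    (hι : Topology.IsInducing ι) (hq : ι q ∈ U)
    (Φ : GrFibre F 1 q ≃ₗ[ℝ] Module.Dual ℝ (F q)) : Function.Injective (symMul Φ) := by
  refine (injective_iff_map_eq_zero _).2 fun t ht => ?_
  have hb : Submodule.span ℝ
      (Set.range fun i => Φ ((h.localGenerators_one hι).frame i q)) = ⊤ := by
    have := congrArg (Submodule.map Φ.toLinearMap) ((h.localGenerators_one hι).span_frame hq)
    rwa [Submodule.map_span, ← Set.range_comp, Submodule.map_top, LinearEquiv.range] at this
  have hs := span_symProd_of_span hb
  obtain ⟨c, rfl⟩ := (Submodule.mem_span_range_iff_exists_fun ℝ).1 (hs ▸ Submodule.mem_top (x := t))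
  rw [h.symMul_sum hι hq] at ht
  have h₁ := Fintype.linearIndependent_iff.1 ((h.localGenerators_two hι).linearIndependent_frame hq)
    (Sum.elim c 0) (by simpa [Fintype.sum_sum_type] using ht)
  exact Finset.sum_eq_zero fun p _ => by rw [show c p = 0 from h₁ (Sum.inl p), zero_smul]

theorem AdaptedCoords.range_symMul (h : AdaptedCoords F U π y z e)
    (hι : Topology.IsInducing ι) (hd : MDifferentiableAt 𝓘(ℝ, E') 𝓘(ℝ, E) ι q) (hq : ι q ∈ U)
    (Φ : GrFibre F 1 q ≃ₗ[ℝ] Module.Dual ℝ (F q)) :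
    LinearMap.range (symMul Φ) = LinearMap.ker (grD2 hι hd F) := by
  refine le_antisymm ?_ fun ξ hξ => ?_
  · rw [LinearMap.range_eq_map, ← span_symProd, Submodule.map_span_le]
    rintro _ ⟨p, rfl⟩
    rw [symMul_symProd]
    exact grD2_grMul hι hd _ _
  · obtain ⟨c, rfl⟩ := h.exists_eq_sum_of_grD2_eq_zero hι hd hq hξ
    exact ⟨_, h.symMul_sum hι hq Φ c⟩

end Multiplication

/-! ### Bundle structure and the isomorphisms in degrees 0 and 1. -/

section BundleMaps

variable {E : Type*} [NormedAddCommGroup E] [NormedSpace ℝ E] [FiniteDimensional ℝ E]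
  {E' : Type*} [NormedAddCommGroup E'] [NormedSpace ℝ E'] [FiniteDimensional ℝ E']
  {M : Type*} [TopologicalSpace M] [ChartedSpace E M] [IsManifold 𝓘(ℝ, E) ∞ M]
  {N : Type*} [TopologicalSpace N] [ChartedSpace E' N]
  {ι : N → M} {F : ∀ q, Submodule ℝ (NormalSpace E E' ι q)}

theorem isVectorBundle_grSmooth_and_sectionsAreGr
    (hι : Manifold.IsSmoothEmbedding 𝓘(ℝ, E') 𝓘(ℝ, E) ∞ ι) (hF : IsSubbundle F) {k : ℕ}
    (hk : k ≤ 2) : IsVectorBundle E' (grSmooth F k) ∧ SectionsAreGr F k := by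
  have hιi : Topology.IsInducing ι := hι.isEmbedding.isInducing
  have H : ∀ q₀ : N, ∃ (U : Set M) (_ : IsOpen U) (_ : ι q₀ ∈ U) (π : M → N)
      (_ : ContMDiffOn 𝓘(ℝ, E) 𝓘(ℝ, E') ∞ π U) (_ : ∀ q, ι q ∈ U → π (ι q) = q)
      (κ : Type) (_ : Fintype κ) (u : κ → M → ℝ), LocalGenerators F k U u := by
    intro q₀
    obtain ⟨U, hU, π, r, σ, _, y, z, e, h⟩ := exists_adaptedCoords hι hF q₀
    refine ⟨U, h.coords.isOpen, hU, π, h.coords.contMDiffOn_proj, h.coords.proj_apply, ?_⟩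
    interval_cases k
    · exact ⟨Unit, inferInstance, _, localGenerators_zero U hιi⟩
    · exact ⟨Fin r, inferInstance, y, h.localGenerators_one hιi⟩
    · exact ⟨AdaptedCoords.QuadIndex r σ, inferInstance, AdaptedCoords.quadGen y z,
        h.localGenerators_two hιi⟩
  refine ⟨isVectorBundle_of_localGenerators hι.contMDiff H,
    sectionsAreGr_of_localGenerators hιi fun q₀ => ?_⟩
  obtain ⟨U, hU, hq₀, -, -, -, h⟩ := H q₀
  exact ⟨U, hU, hq₀, h⟩

/-- Forward, a representative f gives f ∘ ι. Backward, s corresponds to s·[1], which is smooth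
because s extends off `N` through the retraction. -/
theorem isSmoothBundleIso_eval (hι : Manifold.IsSmoothEmbedding 𝓘(ℝ, E') 𝓘(ℝ, E) ∞ ι)
    (hF : IsSubbundle F) (Φ : ∀ q, GrFibre F 0 q ≃ₗ[ℝ] ℝ)
    (hΦ : ∀ q f hf hk, Φ q (grClass F 0 q f hf hk) = f (ι q)) :
    IsSmoothBundleIso (grSmooth F 0) (trivialSmooth E') Φ := by
  have hιi : Topology.IsInducing ι := hι.isEmbedding.isInducing
  refine ⟨fun W hW s hs q₀ hq₀ => ContMDiffAt.contMDiffWithinAt ?_, fun W hW s hs => ?_⟩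
  · obtain ⟨U, hU, hqU, hUW, f, hf⟩ := hs q₀ hq₀
    refine ((hf q₀ hqU).choose.contMDiffAt.comp q₀
      hι.contMDiff.contMDiffAt).congr_of_eventuallyEq ?_
    filter_upwards [(hU.preimage hιi.continuous).mem_nhds hqU] with q hq
    obtain ⟨hfs, hfk, he⟩ := hf q hq
    simp only [he]
    exact hΦ q f hfs hfk
  · refine grSmooth_of_local fun q₀ hq₀ => ?_
    obtain ⟨U, hU, π, r, σ, _, y, z, e, h⟩ := exists_adaptedCoords hι hF q₀
    refine ⟨W ∩ ι ⁻¹' U, Set.inter_subset_left, ⟨hq₀, hU⟩, ?_⟩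
    have hl := localGenerators_zero (F := F) U hιi
    refine hl.grSmooth_of_coeff (c := fun _ => s) h.coords.isOpen h.coords.contMDiffOn_proj
      h.coords.proj_apply (hW.inter (h.coords.isOpen.preimage hιi.continuous))
      Set.inter_subset_right (fun _ => ContMDiffOn.mono hs Set.inter_subset_left) fun q hq => ?_
    have hone : Φ q (hl.frame () q) = 1 := by
      rw [hl.frame_eq hq.2]
      exact hΦ q _ _ _
    refine (Φ q).injective (((Φ q).apply_symm_apply _).trans ?_)
    simp [hone]

/-- Forward, df pairs smoothly with sections of F. Backward, a section s of F^* has coefficients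
s(e_i) in the frame [y_i], smooth because the e_i are smooth sections of F. -/
theorem isSmoothBundleIso_grD1 (hd : ∀ q, MDifferentiableAt 𝓘(ℝ, E') 𝓘(ℝ, E) ι q)
    (hι : Manifold.IsSmoothEmbedding 𝓘(ℝ, E') 𝓘(ℝ, E) ∞ ι)
    (hF : IsSubbundle F) (Φ : ∀ q, GrFibre F 1 q ≃ₗ[ℝ] Module.Dual ℝ (F q))
    (hΦ : ∀ q, (Φ q).toLinearMap = grD1 hι.isEmbedding.isInducing (hd q) F) :
    IsSmoothBundleIso (grSmooth F 1) (subDualSmooth F) Φ := by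
  have hιi : Topology.IsInducing ι := hι.isEmbedding.isInducing
  refine ⟨fun W hW s hs W' hW' hW'W τ hτ => ?_, fun W hW s hs => ?_⟩
  · refine contMDiffOn_pairing hι.contMDiff hιi (fun q => (filt_one hιi).le) hW' hW'W hs hτ
      fun q hq f hf hk he => ?_
    have hv : normalClass E E' ι q (liftNormal (τ q : NormalSpace E E' ι q)) ∈ F q := by
      rw [normalClass_liftNormal]
      exact (τ q).2
    rw [← grD1_grClass hιi (hd q) f hf hk _ hv]
    beta_reduce
    rw [hΦ, he]
    congr 1
    exact Subtype.ext (normalClass_liftNormal _).symm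
  · refine grSmooth_of_local fun q₀ hq₀ => ?_
    obtain ⟨U, hU, π, r, σ, _, y, z, e, h⟩ := exists_adaptedCoords hι hF q₀
    have hV : IsOpen (W ∩ ι ⁻¹' U) := hW.inter (h.coords.isOpen.preimage hιi.continuous)
    refine ⟨W ∩ ι ⁻¹' U, Set.inter_subset_left, ⟨hq₀, hU⟩, ?_⟩
    refine (h.localGenerators_one hιi).grSmooth_of_coeff (c := fun i q => s q (e i q))
      h.coords.isOpen h.coords.contMDiffOn_proj h.coords.proj_apply hV
      Set.inter_subset_right (fun i => hs _ hV Set.inter_subset_left _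
        (normalSmooth.mono Set.inter_subset_right hV (h.smooth_frame i))) fun q hq => ?_
    refine (Φ q).injective (((Φ q).apply_symm_apply _).trans (h.dual_ext hq.2 fun i => ?_))
    rw [← LinearEquiv.coe_toLinearMap, hΦ q]
    exact (h.grD1_sum_frame hιi (hd q) hq.2 (fun j => s q (e j q)) i).symm

end BundleMaps

end WeightedNormal

end

open WeightedNormal in
theorem mainTheorem9
    {E : Type*} [NormedAddCommGroup E] [NormedSpace ℝ E] [FiniteDimensional ℝ E]
    {E' : Type*} [NormedAddCommGroup E'] [NormedSpace ℝ E'] [FiniteDimensional ℝ E']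
    {M : Type*} [TopologicalSpace M] [T2Space M] [SecondCountableTopology M]
    [ChartedSpace E M] [IsManifold 𝓘(ℝ, E) ∞ M]
    {N : Type*} [TopologicalSpace N] [ChartedSpace E' N] [IsManifold 𝓘(ℝ, E') ∞ N]
    (ι : N → M) (hι : Manifold.IsSmoothEmbedding 𝓘(ℝ, E') 𝓘(ℝ, E) ∞ ι)
    (hclosed : IsClosed (Set.range ι))
    (F : ∀ q : N, Submodule ℝ (NormalSpace E E' ι q)) (hF : IsSubbundle F) :
    -- `A_0`, `A_1`, `A_2` are smooth vector bundles with sheaves of sections `gr(𝒜)_k`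
    (∀ k ≤ 2, IsVectorBundle E' (grSmooth F k) ∧ SectionsAreGr F k) ∧
    ∃ (Φ₀ : ∀ q, GrFibre F 0 q ≃ₗ[ℝ] ℝ)
      (Φ₁ : ∀ q, GrFibre F 1 q ≃ₗ[ℝ] Module.Dual ℝ (F q))
      (m : ∀ q, Sym2Power (Module.Dual ℝ (F q)) →ₗ[ℝ] GrFibre F 2 q)
      (p : ∀ q, GrFibre F 2 q →ₗ[ℝ] Ann F q),
      -- `A_0` is the trivial line bundle, `[f] ↦ f|_N`
      IsSmoothBundleIso (grSmooth F 0) (trivialSmooth E') Φ₀ ∧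
      (∀ q f hf hk, Φ₀ q (grClass F 0 q f hf hk) = f (ι q)) ∧
      -- `A_1 ≅ F^*`, `[f] ↦ df|_F`
      IsSmoothBundleIso (grSmooth F 1) (subDualSmooth F) Φ₁ ∧
      (∀ q f hf hk (v : TangentSpace 𝓘(ℝ, E) (ι q)) (hv : normalClass E E' ι q v ∈ F q),
        Φ₁ q (grClass F 1 q f hf hk) ⟨normalClass E E' ι q v, hv⟩ =
          mfderiv 𝓘(ℝ, E) 𝓘(ℝ) f (ι q) v) ∧
      -- `Sym²(F^*) → A_2` is multiplication in `A`
      IsSmoothBundleMap (sym2Smooth (subDualSmooth F)) (grSmooth F 2) m ∧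
      (∀ q (α β : GrFibre F 1 q), m q (symProd (Φ₁ q α) (Φ₁ q β)) = grMul F 1 1 q α β) ∧
      -- `A_2 → ann(F)` is `[f] ↦ df`
      IsSmoothBundleMap (grSmooth F 2) (annSmooth F) p ∧
      (∀ q f hf hk (v : TangentSpace 𝓘(ℝ, E) (ι q)),
        (p q (grClass F 2 q f hf hk) : Module.Dual ℝ (NormalSpace E E' ι q))
          (normalClass E E' ι q v) = mfderiv 𝓘(ℝ, E) 𝓘(ℝ) f (ι q) v) ∧
      -- `0 → Sym²(F^*) → A_2 → ann(F) → 0` is exact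
      ∀ q, Function.Injective (m q) ∧ LinearMap.range (m q) = LinearMap.ker (p q) ∧
        Function.Surjective (p q) := by
  have hιi : Topology.IsInducing ι := hι.isEmbedding.isInducing
  have hd : ∀ q, MDifferentiableAt 𝓘(ℝ, E') 𝓘(ℝ, E) ι q := hι.contMDiff.mdifferentiable (by simp)
  have hbij : ∀ q, Function.Bijective (grD1 hιi (hd q) F) := fun q => by
    obtain ⟨U, hU, π, r, σ, _, y, z, e, h⟩ := exists_adaptedCoords hι hF q
    exact h.grD1_bijective hιi (hd q) hU
  let Φ₁ : ∀ q, GrFibre F 1 q ≃ₗ[ℝ] Module.Dual ℝ (F q) := fun q =>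
    LinearEquiv.ofBijective _ (hbij q)
  have hΦ₁ := isSmoothBundleIso_grD1 hd hι hF Φ₁ fun _ => rfl
  refine ⟨fun k hk => isVectorBundle_grSmooth_and_sectionsAreGr hι hF hk,
    fun q => LinearEquiv.ofBijective (grEval hιi F q) (grEval_bijective hιi), Φ₁,
    fun q => symMul (Φ₁ q), fun q => grD2 hιi (hd q) F,
    isSmoothBundleIso_eval hι hF _ fun q f hf hk => grEval_grClass hιi f hf hk,
    fun q f hf hk => grEval_grClass hιi f hf hk, hΦ₁,
    fun q f hf hk v hv => grD1_grClass hιi (hd q) f hf hk v hv,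
    isSmoothBundleMap_symMul hιi Φ₁ hΦ₁.2, fun q α β => ?_,
    isSmoothBundleMap_grD2 hd hι.contMDiff hιi,
    fun q f hf hk v => grD2_grClass hιi (hd q) f hf hk v, fun q => ?_⟩
  · rw [symMul_symProd, LinearEquiv.symm_apply_apply, LinearEquiv.symm_apply_apply]
  · obtain ⟨U, hU, π, r, σ, _, y, z, e, h⟩ := exists_adaptedCoords hι hF q
    exact ⟨h.symMul_injective hιi hU _, h.range_symMul hιi (hd q) hU _,
      h.grD2_surjective hιi (hd q) hU⟩
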